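/- Let $k$ be a commutative ring and let $\mathcal C$ be a small $k$-linear category that is locally bounded (for each object $c$ there are only finitely many objects $c'$ with $\mathcal C(c,c')\neq 0$ and only finitely many $c''$ with $\mathcal C(c'',c)\neq 0$) and Hom-finite (each $\mathcal C(c,c')$ is a finitely generated projective $k$-module); for example, a $k$-algebra $\Lambda$ that is finitely generated projective as a $k$-module, viewed as a category with one object. Let $\mathcal C\text{-}\mathrm{Mod}$ be the category of left $\mathcal C$-modules, i.e. of $k$-linear functors $\mathcal C\to k\text{-}\mathrm{Mod}$; right $\mathcal C$-modules are the $k$-linear functors $\mathcal C^{\mathrm{op}}\to k\text{-}\mathrm{Mod}$. Put $D=\operatorname{Hom}_k(-,k)$. Assume that $$\sup_{c\in\mathcal C}\operatorname{proj.dim} D(\mathcal C(-,c))<\infty\quad\text{and}\quad \sup_{c\in\mathcal C}\operatorname{proj.dim} D(\mathcal C(c,-))<\infty ,$$ the projective dimensions being those of left, respectively right, $\mathcal C$-modules (with values in $\mathbb N\cup\{\infty\}$; the zero module has projective dimension $0$, and the supremum of the empty set is $0$). Then $$\sup_{c\in\mathcal C}\operatorname{proj.dim} D(\mathcal C(-,c))=\sup_{c\in\mathcal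 C}\operatorname{proj.dim} D(\mathcal C(c,-)),$$ and this number $n$ is the Gorenstein dimension of the endofunctor $P=i_!\circ i^*$, $P(F)=\bigoplus_{c}\mathcal C(c,-)\otimes_k F(c)$, of $\mathcal C\text{-}\mathrm{Mod}$. Here $i^*(F)=(F(c))_{c}$, $i_!((B^c)_c)=\bigoplus_c\mathcal C(c,-)\otimes_kB^c$, and the last assertion has the following meaning. Let $\nu(F)(c)=D(\mathcal C(c,-))\otimes_{\mathcal C}F$ and $\nu^-(F)(c)=\operatorname{Hom}_{\mathcal C}(D(\mathcal C(-,c)),F)$. Then every object of $\mathcal C\text{-}\mathrm{Mod}$ is a quotient of some $P(A)$, and $\nu$ is a Nakayama functor relative to $P$: $\nu$ is left adjoint to $\nu^-$, $I:=\nu\circ P$ is right adjoint to $P$, and the unit $A\to\nu^-\nu(A)$ is an isomorphism for every $A$ of the form $P(A')$. An object is called $P$-projective ($I$-injective) if it is a direct summand of some $P(A')$ (of some $I(A')$). It is called Gorenstein $P$-projective if it is isomorphic to $\operatorname{Ker}(Q_0\to Q_{-1})$ for an exact complex $(Q_i)_{i\in\mathbb Z}$ of $P$-projective objects such that $\nu(Q_\bullet)$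 is exact, and Gorenstein $I$-injective if it is isomorphic to $\operatorname{Ker}(J_0\to J_{-1})$ for an exact complex $(J_i)_{i\in\mathbb Z}$ of $I$-injective objects such that $\nu^-(J_\bullet)$ is exact. The derived functors $L_i\nu$ and $R^i\nu^-$ are computed by $P$-projective resolutions and $I$-injective coresolutions. The functor $P$ is Iwanaga-Gorenstein, that is, there is an $m\ge 0$ with $L_i\nu(A)=0$ and $R^i\nu^-(A)=0$ for all $A$ and all $i>m$, and $n$ is equal to each of the following four numbers, whose common value is the Gorenstein dimension of $P$: the supremum over all $A$ of the smallest length of a resolution of $A$ by Gorenstein $P$-projective objects; the supremum over all $A$ of the smallest length of a coresolution of $A$ by Gorenstein $I$-injective objects; the smallest $s\geq 0$ such that $L_i\nu(A)=0$ for all $i>s$ and all $A$; the smallest $t\geq 0$ such that $R^i\nu^-(A)=0$ for all $i>t$ and all $A$. -/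

import Mathlib

open CategoryTheory Limits Opposite MonoidalCategory
open scoped ZeroObject

universe u v w

noncomputable section

namespace NakayamaGorenstein

/-! ### Homological algebra relative to an endofunctor with a Nakayama functor -/

section Relative

variable {A : Type w} [Category.{v} A] [Abelian A]

/-- A resolution `⋯ → X₁ → X₀ → M → 0` of `M` by objects that have the property `X`. -/
structure LeftResolution (X : ObjectProperty A) (M : A) where
  complex : ChainComplex A ℕ
  prop : ∀ n, X (complex.X n)
  π : complex ⟶ (ChainComplex.single₀ A).obj M
  quasiIso : QuasiIso π

/-- A coresolution `0 → M → X⁰ → X¹ → ⋯` of `M` by objects that have the property `X`. -/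
structure RightResolution (X : ObjectProperty A) (M : A) where
  complex : CochainComplex A ℕ
  prop : ∀ n, X (complex.X n)
  ι : (CochainComplex.single₀ A).obj M ⟶ complex
  quasiIso : QuasiIso ι

/-- The resolution dimension of `M`: the smallest `n` such that there is an exact sequence
`0 → Xₙ → ⋯ → X₀ → M → 0` with all `Xᵢ` in `X`, and `⊤` if there is none. -/
def resolutionDim (X : ObjectProperty A) (M : A) : ℕ∞ :=
  ⨅ (n : ℕ) (_ : ∃ R : LeftResolution X M, ∀ i, n < i → IsZero (R.complex.X i)), (n : ℕ∞)

/-- The coresolution dimension of `M`. -/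
def coresolutionDim (X : ObjectProperty A) (M : A) : ℕ∞ :=
  ⨅ (n : ℕ) (_ : ∃ R : RightResolution X M, ∀ i, n < i → IsZero (R.complex.X i)), (n : ℕ∞)

/-- The global resolution dimension of the category. -/
def globalResolutionDim (X : ObjectProperty A) : ℕ∞ := ⨆ M : A, resolutionDim X M

/-- The global coresolution dimension of the category. -/
def globalCoresolutionDim (X : ObjectProperty A) : ℕ∞ := ⨆ M : A, coresolutionDim X M

/-- The functor `F` is generating: every object is a quotient of some `F.obj N`. -/
def IsGenerating (F : A ⥤ A) : Prop := ∀ M : A, ∃ (N : A) (f : F.obj N ⟶ M), Epi f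

/-- The direct summands of objects `F.obj N`. For `F = P` these are the `P`-projective objects,
and for `F = I` the `I`-injective ones. -/
def summandsOfImage (F : A ⥤ A) : ObjectProperty A :=
  fun M => ∃ N : A, Nonempty (Retract M (F.obj N))

/-- `M = Ker (Q₀ ⟶ Q₋₁)` for an exact complex `Q`, unbounded in both directions, whose terms are
direct summands of objects `F.obj N`, and which stays exact under `G`. -/
def totallyAcyclicKernels (F G : A ⥤ A) [G.Additive] : ObjectProperty A :=
  fun M => ∃ Q : ChainComplex A ℤ,
    (∀ i, summandsOfImage F (Q.X i)) ∧ Q.Acyclic ∧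
    ((G.mapHomologicalComplex _).obj Q).Acyclic ∧
    Nonempty (M ≅ kernel (Q.d 0 (-1)))

/-- A Nakayama functor `ν`, with right adjoint `ν'`, relative to `P`. -/
def IsNakayamaFunctor (P ν ν' : A ⥤ A) : Prop :=
  ∃ adj : ν ⊣ ν', Nonempty (P ⊣ P ⋙ ν) ∧ ∀ M : A, IsIso (adj.unit.app (P.obj M))

/-- The Gorenstein `P`-projective objects. -/
abbrev gorensteinProjective (P ν : A ⥤ A) [ν.Additive] : ObjectProperty A :=
  totallyAcyclicKernels P ν

/-- The Gorenstein `I`-injective objects, `I = ν ∘ P`. -/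
abbrev gorensteinInjective (P ν ν' : A ⥤ A) [ν'.Additive] : ObjectProperty A :=
  totallyAcyclicKernels (P ⋙ ν) ν'

/-- `Lᵢν(M) = 0` for `i > 0`. The left derived functors of `ν` are computed by the resolutions by
`P`-projective objects, which form a class adapted to `ν`. -/
def LeftDerivedVanishes (P ν : A ⥤ A) [ν.Additive] (i : ℕ) (M : A) : Prop :=
  ∀ R : LeftResolution (summandsOfImage P) M,
    ((ν.mapHomologicalComplex _).obj R.complex).ExactAt i

/-- `Rⁱν'(M) = 0` for `i > 0`. The right derived functors of `ν'` are computed by the coresolutions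
by `I`-injective objects, `I = ν ∘ P`, which form a class adapted to `ν'`. -/
def RightDerivedVanishes (P ν ν' : A ⥤ A) [ν'.Additive] (i : ℕ) (M : A) : Prop :=
  ∀ R : RightResolution (summandsOfImage (P ⋙ ν)) M,
    ((ν'.mapHomologicalComplex _).obj R.complex).ExactAt i

/-- `P` is Iwanaga-Gorenstein, with respect to the Nakayama functor `ν ⊣ ν'`. -/
def IsIwanagaGorenstein (P ν ν' : A ⥤ A) [ν.Additive] [ν'.Additive] : Prop :=
  ∃ m : ℕ, ∀ (M : A) (i : ℕ), m < i →
    LeftDerivedVanishes P ν i M ∧ RightDerivedVanishes P ν ν' i M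

/-- `P` is a generating functor with Nakayama functor `ν ⊣ ν'`, it is Iwanaga-Gorenstein, and its
Gorenstein dimension, the common value of the four numbers below, is `n`. -/
structure HasGorensteinDimension (P ν ν' : A ⥤ A) [ν.Additive] [ν'.Additive] (n : ℕ) : Prop where
  isGenerating : IsGenerating P
  isNakayamaFunctor : IsNakayamaFunctor P ν ν'
  isIwanagaGorenstein : IsIwanagaGorenstein P ν ν'
  dim_projective : globalResolutionDim (gorensteinProjective P ν) = n
  dim_injective : globalCoresolutionDim (gorensteinInjective P ν ν') = n
  isLeast_left : IsLeast {s : ℕ | ∀ (M : A) (i : ℕ), s < i → LeftDerivedVanishes P ν i M} n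
  isLeast_right : IsLeast {t : ℕ | ∀ (M : A) (i : ℕ), t < i → RightDerivedVanishes P ν ν' i M} n

/-- The projective dimension, in `ℕ ∪ {∞}`; the zero object has projective dimension `0`. -/
def projDim (M : A) : ℕ∞ := (projectiveDimension M).unbotD 0

end Relative

/-! ### Modules over a linear category -/

section LinearCategories

/-- The opposite of a `k`-linear category is `k`-linear. -/
instance oppositeLinear (k : Type*) [CommRing k] (C : Type*) [Category* C] [Preadditive C]
    [Linear k C] : Linear k Cᵒᵖ where
  homModule _ _ :=
    { smul := fun r f => (r • f.unop).op
      one_smul := fun f => Quiver.Hom.unop_inj (one_smul k f.unop)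
      mul_smul := fun r s f => Quiver.Hom.unop_inj (mul_smul r s f.unop)
      smul_zero := fun r => Quiver.Hom.unop_inj (smul_zero r)
      smul_add := fun r f g => Quiver.Hom.unop_inj (smul_add r f.unop g.unop)
      add_smul := fun r s f => Quiver.Hom.unop_inj (add_smul r s f.unop)
      zero_smul := fun f => Quiver.Hom.unop_inj (zero_smul k f.unop) }
  smul_comp _ _ _ r f g := Quiver.Hom.unop_inj (Linear.comp_smul _ _ _ g.unop r f.unop)
  comp_smul _ _ _ f r g := Quiver.Hom.unop_inj (Linear.smul_comp _ _ _ r g.unop f.unop)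

lemma linearYoneda_map_smul (k : Type*) [CommRing k] (C : Type*) [Category* C] [Preadditive C]
    [Linear k C] (c : C) : ((linearYoneda k C).obj c).Linear k where
  map_smul f r := ModuleCat.hom_ext <| LinearMap.ext fun x => Linear.smul_comp _ _ _ r f.unop x

lemma linearCoyoneda_map_smul (k : Type*) [CommRing k] (C : Type*) [Category* C] [Preadditive C]
    [Linear k C] (c : Cᵒᵖ) : ((linearCoyoneda k C).obj c).Linear k where
  map_smul f r := ModuleCat.hom_ext <| LinearMap.ext fun x => Linear.comp_smul _ _ _ x r f

variable (k : Type u) [CommRing k] (C : Type u) [Category.{u} C] [Preadditive C] [Linear k C]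

/-- For each object there are only finitely many objects that it maps to, or that map to it,
nontrivially. -/
def IsLocallyBounded (C : Type u) [Category.{u} C] [Preadditive C] : Prop :=
  ∀ c : C, {c' : C | ∃ f : c ⟶ c', f ≠ 0}.Finite ∧ {c' : C | ∃ f : c' ⟶ c, f ≠ 0}.Finite

/-- All morphism modules are finitely generated projective over `k`. -/
def IsHomFinite : Prop := ∀ c c' : C, Module.Finite k (c ⟶ c') ∧ Module.Projective k (c ⟶ c')

/-- The property of a functor to `k`-modules of being `k`-linear. -/
def linearFunctors : ObjectProperty (C ⥤ ModuleCat.{u} k) := fun F => F.Additive ∧ F.Linear k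

/-- The category `C-Mod` of left `C`-modules, that is of `k`-linear functors from `C` to
`k`-modules. The category of right `C`-modules is `CMod k Cᵒᵖ`. -/
abbrev CMod := (linearFunctors k C).FullSubcategory

variable {k C}

lemma linearFunctors_of_jointly_epi {F : C ⥤ ModuleCat.{u} k} {J : Type*}
    (G : J → (C ⥤ ModuleCat.{u} k)) (hG : ∀ j, linearFunctors k C (G j)) (ι : ∀ j, G j ⟶ F)
    (h : ∀ (X : C) (W : ModuleCat.{u} k) (a b : F.obj X ⟶ W),
      (∀ j, (ι j).app X ≫ a = (ι j).app X ≫ b) → a = b) :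
    linearFunctors k C F := by
  refine ⟨⟨?_⟩, ⟨?_⟩⟩
  · intro X Y f g
    refine h _ _ _ _ fun j => ?_
    have := (hG j).1
    rw [← NatTrans.naturality, Functor.map_add, Preadditive.comp_add, ← NatTrans.naturality,
      ← NatTrans.naturality, Preadditive.add_comp]
  · intro X Y f r
    refine h _ _ _ _ fun j => ?_
    have := (hG j).2
    rw [← NatTrans.naturality, Functor.map_smul, Linear.comp_smul, ← NatTrans.naturality,
      Linear.smul_comp]

lemma linearFunctors_of_jointly_mono {F : C ⥤ ModuleCat.{u} k} {J : Type*}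
    (G : J → (C ⥤ ModuleCat.{u} k)) (hG : ∀ j, linearFunctors k C (G j)) (π : ∀ j, F ⟶ G j)
    (h : ∀ (X : C) (W : ModuleCat.{u} k) (a b : W ⟶ F.obj X),
      (∀ j, a ≫ (π j).app X = b ≫ (π j).app X) → a = b) :
    linearFunctors k C F := by
  refine ⟨⟨?_⟩, ⟨?_⟩⟩
  · intro X Y f g
    refine h _ _ _ _ fun j => ?_
    have := (hG j).1
    rw [NatTrans.naturality, Functor.map_add, Preadditive.add_comp, NatTrans.naturality,
      NatTrans.naturality, Preadditive.comp_add]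
  · intro X Y f r
    refine h _ _ _ _ fun j => ?_
    have := (hG j).2
    rw [NatTrans.naturality, Functor.map_smul, Linear.smul_comp, NatTrans.naturality,
      Linear.comp_smul]

instance : (linearFunctors k C).IsClosedUnderSubobjects where
  prop_of_mono {_ Y} f _ hY :=
    linearFunctors_of_jointly_mono (fun _ : Unit => Y) (fun _ => hY) (fun _ => f)
      fun Z _ _ _ hab => (cancel_mono (f.app Z)).1 (hab ())

instance : (linearFunctors k C).IsClosedUnderQuotients where
  prop_of_epi {X _} f _ hX :=
    linearFunctors_of_jointly_epi (fun _ : Unit => X) (fun _ => hX) (fun _ => f)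
      fun Z _ _ _ hab => (cancel_epi (f.app Z)).1 (hab ())

instance (J : Type*) [Category J] [HasLimitsOfShape J (ModuleCat.{u} k)] :
    (linearFunctors k C).IsClosedUnderLimitsOfShape J where
  limitsOfShape_le := by
    rintro F ⟨p⟩
    refine linearFunctors_of_jointly_mono (fun j => p.diag.obj j) p.prop_diag_obj
      (fun j => p.π.app j) fun X W a b hab => ?_
    exact (isLimitOfPreserves ((evaluation _ _).obj X) p.isLimit).hom_ext hab

instance (J : Type*) [Category J] [HasColimitsOfShape J (ModuleCat.{u} k)] :
    (linearFunctors k C).IsClosedUnderColimitsOfShape J where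
  colimitsOfShape_le := by
    rintro F ⟨p⟩
    refine linearFunctors_of_jointly_epi (fun j => p.diag.obj j) p.prop_diag_obj
      (fun j => p.ι.app j) fun X W a b hab => ?_
    exact (isColimitOfPreserves ((evaluation _ _).obj X) p.isColimit).hom_ext hab

instance : (linearFunctors k C).IsClosedUnderFiniteProducts where

instance : (linearFunctors k C).ContainsZero where
  exists_zero := ⟨0, isZero_zero _,
    linearFunctors_of_jointly_epi (fun j : Empty => j.elim) (fun j => j.elim) (fun j => j.elim)
      fun X _ _ _ _ => ((Functor.isZero_iff _).1 (isZero_zero _) X).eq_of_src _ _⟩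

variable (k C)

/-- The algebraic dual `D = Hom_k(-, k)`. -/
def dual : (ModuleCat.{u} k)ᵒᵖ ⥤ ModuleCat.{u} k :=
  (linearYoneda k (ModuleCat.{u} k)).obj (ModuleCat.of k k)

instance : (dual k).Additive := inferInstanceAs ((linearYoneda k _).obj _).Additive

instance : (dual k).Linear k := linearYoneda_map_smul k _ _

variable {k C} in
lemma dual_linear {F : C ⥤ ModuleCat.{u} k} (hF : linearFunctors k C F) :
    linearFunctors k Cᵒᵖ (F.op ⋙ dual k) := by
  obtain ⟨_, _⟩ := hF
  have : F.op.Linear k := ⟨fun f r => Quiver.Hom.unop_inj (F.map_smul r f.unop)⟩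
  exact ⟨inferInstance, inferInstance⟩

variable {k C} in
lemma dual_linear' {F : Cᵒᵖ ⥤ ModuleCat.{u} k} (hF : linearFunctors k Cᵒᵖ F) :
    linearFunctors k C (F.rightOp ⋙ dual k) := by
  obtain ⟨_, _⟩ := hF
  have : F.rightOp.Additive := ⟨fun {_ _ f g} => Quiver.Hom.unop_inj (F.map_add (f := f.op))⟩
  have : F.rightOp.Linear k := ⟨fun f r => Quiver.Hom.unop_inj (F.map_smul r f.op)⟩
  exact ⟨inferInstance, inferInstance⟩

lemma linearYoneda_linear (c : C) : linearFunctors k Cᵒᵖ ((linearYoneda k C).obj c) :=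
  ⟨inferInstance, linearYoneda_map_smul k C c⟩

lemma linearCoyoneda_linear (c : Cᵒᵖ) : linearFunctors k C ((linearCoyoneda k C).obj c) :=
  ⟨inferInstance, linearCoyoneda_map_smul k C c⟩

lemma comp_tensorRight_linear {F : C ⥤ ModuleCat.{u} k} (hF : linearFunctors k C F)
    (B : ModuleCat.{u} k) : linearFunctors k C (F ⋙ tensorRight B) := by
  obtain ⟨_, _⟩ := hF
  exact ⟨inferInstance, inferInstance⟩

/-- The left module `D(C(-, c))`, contravariantly functorial in `c`. -/
def dualLeft : Cᵒᵖ ⥤ CMod k C :=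
  (linearFunctors k C).lift
    { obj := fun c => ((linearYoneda k C).obj c.unop).rightOp ⋙ dual k
      map := fun f => Functor.whiskerRight
        (NatTrans.rightOp ((linearYoneda k C).map f.unop)) (dual k) }
    fun c => dual_linear' (linearYoneda_linear k C c.unop)

lemma dualLeft_additive : (dualLeft k C).Additive where
  map_add {c d f g} := by
    ext a : 3
    exact ModuleCat.hom_ext <| LinearMap.ext fun x => ModuleCat.hom_ext <| LinearMap.ext fun y =>
      (congrArg x.hom (Preadditive.comp_add _ _ _ y f.unop g.unop)).trans (map_add x.hom _ _)

lemma dualLeft_linear : (dualLeft k C).Linear k where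
  map_smul {c d} f r := by
    ext a : 3
    exact ModuleCat.hom_ext <| LinearMap.ext fun x => ModuleCat.hom_ext <| LinearMap.ext fun y =>
      (congrArg x.hom (Linear.comp_smul _ _ _ y r f.unop)).trans (map_smul x.hom _ _)

/-- The right module `D(C(c, -))`, covariantly functorial in `c`. -/
def dualRight : C ⥤ CMod k Cᵒᵖ :=
  (linearFunctors k Cᵒᵖ).lift
    { obj := fun c => ((linearCoyoneda k C).obj (op c)).op ⋙ dual k
      map := fun f => Functor.whiskerRight
        (NatTrans.op ((linearCoyoneda k C).map f.op)) (dual k) }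
    fun c => dual_linear (linearCoyoneda_linear k C (op c))

/-- The tensor product `M ⊗_C F` of a right and a left module, as the coend of `M(a) ⊗_k F(b)`,
that is the quotient of `⨁ c, M(c) ⊗_k F(c)` by the relations `x f ⊗ y = x ⊗ f y`. -/
def tensorOver : (Cᵒᵖ ⥤ ModuleCat.{u} k) ⥤ (C ⥤ ModuleCat.{u} k) ⥤ ModuleCat.{u} k :=
  externalProductBifunctorCurried Cᵒᵖ C (ModuleCat.{u} k) ⋙
    (Functor.whiskeringRight _ _ _).obj (coendFunctor C (ModuleCat.{u} k))

/-- The functor `ν F = (c ↦ D(C(c, -)) ⊗_C F)` on left modules. -/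
def nu : CMod k C ⥤ CMod k C :=
  (linearFunctors k C).lift
    ((linearFunctors k C).ι ⋙ (tensorOver k C).flip ⋙
      (Functor.whiskeringLeft _ _ _).obj (dualRight k C ⋙ (linearFunctors k Cᵒᵖ).ι))
    fun F => linearFunctors_of_jointly_epi
      (fun c : C => (((linearYoneda k C).obj c).rightOp ⋙ dual k) ⋙ tensorRight (F.obj.obj c))
      (fun c => comp_tensorRight_linear k C (dual_linear' (linearYoneda_linear k C c)) _)
      (fun c =>
        { app := fun d => coend.ι (((externalProductBifunctorCurried Cᵒᵖ C (ModuleCat.{u} k)).obj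
            ((dualRight k C).obj d).obj).obj F.obj) c
          naturality := fun _ _ f => (coend.ι_map
            (((externalProductBifunctorCurried Cᵒᵖ C (ModuleCat.{u} k)).map
              ((dualRight k C).map f).hom).app F.obj) c).symm })
      fun _ _ _ _ h => coend.hom_ext h

/-- The functor `ν⁻ F = (c ↦ Hom_C(D(C(-, c)), F))` on left modules. -/
def nuMinus : CMod k C ⥤ CMod k C :=
  (linearFunctors k C).lift
    (linearYoneda k (CMod k C) ⋙ (Functor.whiskeringLeft _ _ _).obj (dualLeft k C).rightOp)
    fun F => by
      have : (dualLeft k C).rightOp.Additive := ⟨fun {_ _ _ _} => Quiver.Hom.unop_inj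
        ((dualLeft_additive k C).map_add)⟩
      have : (dualLeft k C).rightOp.Linear k := ⟨fun f r => Quiver.Hom.unop_inj
        ((dualLeft_linear k C).map_smul f.op r)⟩
      have := linearYoneda_map_smul k (CMod k C) F
      exact ⟨inferInstanceAs ((dualLeft k C).rightOp ⋙ (linearYoneda k (CMod k C)).obj F).Additive,
        inferInstanceAs (((dualLeft k C).rightOp ⋙ (linearYoneda k (CMod k C)).obj F).Linear k)⟩

lemma ι_nu_map {F G : CMod k C} (f : F ⟶ G) (c d : C) :
    coend.ι (((externalProductBifunctorCurried Cᵒᵖ C (ModuleCat.{u} k)).obj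
      ((dualRight k C).obj c).obj).obj F.obj) d ≫ ((nu k C).map f).hom.app c =
    (((dualRight k C).obj c).obj.obj (op d) ◁ f.hom.app d) ≫
      coend.ι (((externalProductBifunctorCurried Cᵒᵖ C (ModuleCat.{u} k)).obj
        ((dualRight k C).obj c).obj).obj G.obj) d :=
  coend.ι_map (((externalProductBifunctorCurried Cᵒᵖ C (ModuleCat.{u} k)).obj
    ((dualRight k C).obj c).obj).map f.hom) d

instance : (nu k C).Additive where
  map_add {F G} f g := by
    ext c : 3
    refine coend.hom_ext (F := ((externalProductBifunctorCurried Cᵒᵖ C (ModuleCat.{u} k)).obj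
      ((dualRight k C).obj c).obj).obj F.obj) fun d => ?_
    refine (ι_nu_map k C (f + g) c d).trans ?_
    refine Eq.trans ?_ (Preadditive.comp_add _ _ _ _ (((nu k C).map f).hom.app c)
      (((nu k C).map g).hom.app c)).symm
    refine Eq.trans ?_ (congrArg₂ (· + ·) (ι_nu_map k C f c d) (ι_nu_map k C g c d)).symm
    refine Eq.trans (congrArg (· ≫ _)
      (MonoidalPreadditive.whiskerLeft_add (f.hom.app d) (g.hom.app d))) ?_
    exact Preadditive.add_comp _ _ _ _ _ _

instance : (nuMinus k C).Additive where
  map_add {F G} f g := by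
    ext c : 3
    exact ModuleCat.hom_ext <| LinearMap.ext fun x => Preadditive.comp_add _ _ _ x f g

/-- The evaluation functor `i^* F = (F(c))_c`. -/
def iUpperStar : CMod k C ⥤ (C → ModuleCat.{u} k) :=
  Functor.pi' fun c => (linearFunctors k C).ι ⋙ (evaluation C (ModuleCat.{u} k)).obj c

/-- The functor `i_! (B^c)_c = ⨁ c, C(c, -) ⊗_k B^c`. -/
def iLowerShriek : (C → ModuleCat.{u} k) ⥤ CMod k C :=
  (linearFunctors k C).lift
    { obj := fun B => ∐ fun c : C => (linearCoyoneda k C).obj (op c) ⋙ tensorRight (B c)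
      map := fun f => Limits.Sigma.map fun c : C =>
        Functor.whiskerLeft _ ((tensoringRight (ModuleCat.{u} k)).map (f c)) }
    fun B => ObjectProperty.prop_colimit _ _ fun c =>
      comp_tensorRight_linear k C (linearCoyoneda_linear k C (op c.as)) (B c.as)

/-- The endofunctor `P = i_! ∘ i^*`. -/
def functorP : CMod k C ⥤ CMod k C := iUpperStar k C ⋙ iLowerShriek k C

end LinearCategories

end NakayamaGorenstein

end

set_option linter.unusedSectionVars false

noncomputable section

/-! Let a be the supremum of the projective dimensions of the left modules D(C(-,c)), and b that of
the right modules D(C(c,-)). Everything rests on the inequality a ≤ b, which becomes b ≤ a for the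
opposite category. It has three ingredients. (1) The modules I(N) are of the form i_*B, and a
morphism to i_*B is a family of k-linear maps. Since D(C(-,c)) and all its syzygies have
k-projective values, i_*B has no higher Ext from them. Vanishing of R^i ν⁻ is therefore vanishing of
Ext^i(D(C(-,c)), -) for all c, and R^i ν⁻ = 0 for all i > t exactly when a ≤ t
(`rvan_iff_dualLeft`). (2) Dualising into injective k-modules E reduces the vanishing of L_i ν at M
to that of Ext^i(D(C(c,-)), Hom_k(M,E)). Hence b ≤ t forces L_i ν = 0 for all i > t
(`lvan_of_dualRight`). The converse implication is not needed. (3) In an abelian category with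
enough projectives, if R^i ν' vanishes for large i and L_i ν = 0 for i > s, then already R^i ν' = 0
for i > s (`rvan_of_lvan`). Under these bounds ν and ν' are inverse to each other between the
objects acyclic for ν and those acyclic for ν'. If R^i ν'(B) = 0 for i > q+1, then B has a
coresolution νT_0 → ⋯ → νT_{q+1} → 0 with T_0 acyclic and the other T_i projective, and it comes
from a complex T. When L_i ν = 0 for i > q, a map out of T_{q+1} that kills the incoming
differential factors through T_{q+2} = 0. Applied to the cokernel of T_q → T_{q+1} this shows that
the differential is epi; it stays epi under ν'ν, which gives R^{q+1} ν'(B) = 0. Descending induction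
lowers the bound to s. So b ≤ s gives the vanishing of L_i ν beyond s, then that of R^i ν⁻, then a ≤
s. The same chain shows that no smaller number bounds the L_i ν. The two resolution dimensions
reduce to these vanishing degrees: the Gorenstein objects are exactly the acyclic ones
(`gorensteinProjective_eq`, `gorensteinInjective_eq`), and a resolution by acyclic objects can be
stopped as soon as a syzygy is acyclic. Indices are shifted by one throughout: `LVan n` concerns
L_{n+1}, and `RVan n` concerns R^{n+1}. -/

namespace NakayamaGorenstein

/-! ### Derived functors of a right exact functor by iterated kernels of a counit -/

section LeftAdapted

variable {A : Type w} [Category.{v} A] [Abelian A]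

/-- A right exact functor `F` together with an exact functor `P` such that `P ⋙ F` is exact, and a
counit `P ⟶ 𝟭` that is epi, and split epi on the objects `P.obj N`. Then the summands of objects
`P.obj N` are adapted to `F`. -/
structure LeftAdapted (F P : A ⥤ A) [F.Additive] [P.Additive] where
  rightExact : PreservesFiniteColimits F
  exact : ∀ {S : ShortComplex A}, S.ShortExact → (S.map P).ShortExact
  exact_comp : ∀ {S : ShortComplex A}, S.ShortExact → (S.map (P ⋙ F)).ShortExact
  ε : P ⟶ 𝟭 A
  epi : ∀ M, Epi (ε.app M)
  split : ∀ N, ∃ s : P.obj N ⟶ P.obj (P.obj N), s ≫ ε.app (P.obj N) = 𝟙 _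

namespace LeftAdapted

attribute [instance] epi

variable {F P : A ⥤ A} [F.Additive] [P.Additive] (h : LeftAdapted F P)

/-- The kernel of the counit. -/
def K : A ⥤ A where
  obj M := kernel (h.ε.app M)
  map f := kernel.map _ _ (P.map f) f (h.ε.naturality f).symm

/-- The inclusion of the kernel of the counit. -/
def ι : h.K ⟶ P where
  app M := kernel.ι (h.ε.app M)
  naturality _ _ _ := kernel.lift_ι _ _ _

instance (M : A) : Mono (h.ι.app M) := inferInstanceAs (Mono (kernel.ι _))

@[simp]
lemma ι_ε (M : A) : h.ι.app M ≫ h.ε.app M = 0 := kernel.condition _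

instance : h.K.Additive where
  map_add {X Y f g} := by
    rw [← cancel_mono (h.ι.app Y)]
    simp [h.ι.naturality, Functor.map_add, Preadditive.comp_add]

/-- The short exact sequence `0 ⟶ K M ⟶ P M ⟶ M ⟶ 0`. -/
abbrev cover (M : A) : ShortComplex A := ShortComplex.mk (h.ι.app M) (h.ε.app M) (h.ι_ε M)

lemma cover_shortExact (M : A) : (h.cover M).ShortExact where
  exact := (h.cover M).exact_of_f_is_kernel (kernelIsKernel _)
  mono_f := inferInstance
  epi_g := h.epi M

/-- The vanishing of `L_{n+1} F`. -/
def LVan : ℕ → ObjectProperty A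
  | 0 => fun M => Mono (F.map (h.ι.app M))
  | n + 1 => fun M => LVan n (h.K.obj M)

lemma lvan_zero_iff (M : A) : h.LVan 0 M ↔ Mono (F.map (h.ι.app M)) := Iff.rfl

lemma map_K_comp {X Y Z : A} {f : X ⟶ Y} {g : Y ⟶ Z} (w : f ≫ g = 0) :
    h.K.map f ≫ h.K.map g = 0 := by
  rw [← h.K.map_comp, w, h.K.map_zero]

/-- The snake lemma for the counit, which is epi, so that no cokernels interfere. Exactness of `K`
lets every statement about `LVan n` be reduced to `n = 0` by passing to kernels. -/
lemma map_K_shortExact {S : ShortComplex A} (hS : S.ShortExact) :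
    (ShortComplex.mk (h.K.map S.f) (h.K.map S.g) (h.map_K_comp S.zero)).ShortExact := by
  have := hS.mono_f
  have := hS.epi_g
  have hP := h.exact hS
  have hPf : Mono (P.map S.f) := hP.mono_f
  have hPg : Epi (P.map S.g) := hP.epi_g
  refine { exact := ?_, mono_f := ?_, epi_g := ?_ }
  · rw [ShortComplex.exact_iff_exact_up_to_refinements]
    intro B x hx
    change B ⟶ h.K.obj S.X₂ at x
    change x ≫ h.K.map S.g = 0 at hx
    obtain ⟨B', π, _, y, hy⟩ := hP.exact.exact_up_to_refinements (x ≫ h.ι.app _)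
      (by
        change (x ≫ h.ι.app S.X₂) ≫ P.map S.g = 0
        rw [Category.assoc, ← h.ι.naturality, reassoc_of% hx, zero_comp])
    change B' ⟶ P.obj S.X₁ at y
    change π ≫ x ≫ h.ι.app _ = y ≫ P.map S.f at hy
    have hy' : y ≫ h.ε.app S.X₁ = 0 := by
      rw [← cancel_mono S.f]
      have := h.ε.naturality S.f
      dsimp at this ⊢
      rw [Category.assoc, ← this, ← reassoc_of% hy]
      simp
    refine ⟨B', π, inferInstance, kernel.lift _ y hy', ?_⟩
    let t : B' ⟶ h.K.obj S.X₁ := kernel.lift _ y hy'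
    change π ≫ x = t ≫ h.K.map S.f
    have e : t ≫ h.ι.app S.X₁ = y := kernel.lift_ι _ _ _
    rw [← cancel_mono (h.ι.app _), Category.assoc, Category.assoc, hy, h.ι.naturality,
      reassoc_of% e]
  · change Mono (h.K.map S.f)
    have : Mono (h.K.map S.f ≫ h.ι.app _) := by
      rw [h.ι.naturality]
      exact mono_comp' inferInstance hPf
    exact mono_of_mono _ (h.ι.app _)
  · change Epi (h.K.map S.g)
    rw [epi_iff_surjective_up_to_refinements]
    intro B y
    obtain ⟨B₁, π₁, _, z, hz⟩ := surjective_up_to_refinements_of_epi (P.map S.g) (y ≫ h.ι.app _)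
    obtain ⟨B₂, π₂, _, x, hx⟩ := hS.exact.exact_up_to_refinements (z ≫ h.ε.app _) (by
      have := h.ε.naturality S.g
      dsimp at this
      rw [Category.assoc, ← this, ← reassoc_of% hz]
      simp)
    obtain ⟨B₃, π₃, _, t, ht⟩ := surjective_up_to_refinements_of_epi (h.ε.app _) x
    have hn := h.ε.naturality S.f
    dsimp at hn hx ht t
    -- The lift `z` need not lie in the kernel of the counit, but its image in `S.X₂` comes from
    -- `S.X₁`; it is corrected by a preimage `t` of that element in `P S.X₁`.
    have hy' : (π₃ ≫ π₂ ≫ z - t ≫ P.map S.f) ≫ h.ε.app S.X₂ = 0 := by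
      rw [Preadditive.sub_comp, Category.assoc, Category.assoc, hx, Category.assoc, hn,
        ← Category.assoc, ht, Category.assoc, sub_self]
    let r : B₃ ⟶ h.K.obj S.X₂ := kernel.lift _ _ hy'
    have hr : r ≫ h.ι.app S.X₂ = _ := kernel.lift_ι _ _ _
    refine ⟨B₃, π₃ ≫ π₂ ≫ π₁, inferInstance, r, ?_⟩
    rw [← cancel_mono (h.ι.app _), Category.assoc r, h.ι.naturality, reassoc_of% hr]
    have e : P.map S.f ≫ P.map S.g = 0 := by rw [← P.map_comp, S.zero, P.map_zero]
    simp [hz, e]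

lemma lvan_of_retract {n : ℕ} {M N : A} (r : Retract M N) (hN : h.LVan n N) : h.LVan n M := by
  induction n generalizing M N with
  | zero =>
    rw [lvan_zero_iff] at hN ⊢
    have : Mono (F.map (h.K.map r.i) ≫ F.map (h.ι.app N)) := mono_comp' ((r.map h.K).map F).splitMono.mono hN
    rw [← F.map_comp, h.ι.naturality, F.map_comp] at this
    exact mono_of_mono _ (F.map (P.map r.i))
  | succ n ih => exact ih (r.map h.K) hN

lemma lvan_of_iso {n : ℕ} {M N : A} (e : M ≅ N) (hN : h.LVan n N) : h.LVan n M :=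
  h.lvan_of_retract (.ofIso e) hN

/-- The counit at `P N` splits, so its kernel sequence survives any additive functor, and `K (P N)`
is a summand of `P (P N)`, to which the induction applies. -/
lemma lvan_P (n : ℕ) (N : A) : h.LVan n (P.obj N) := by
  obtain ⟨s, hs⟩ := h.split N
  induction n generalizing N with
  | zero =>
    let σ : (h.cover (P.obj N)).Splitting := .ofExactOfSection _
      (h.cover_shortExact _).exact s hs (inferInstanceAs (Mono (h.ι.app _)))
    rw [lvan_zero_iff]
    exact (σ.map F).splitMono_f.mono
  | succ n ih =>
    let σ : (h.cover (P.obj N)).Splitting := .ofExactOfSection _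
      (h.cover_shortExact _).exact s hs (inferInstanceAs (Mono (h.ι.app _)))
    have r : Retract (h.K.obj (P.obj N)) (P.obj (P.obj N)) := ⟨_, _, σ.f_r⟩
    show h.LVan n (h.K.obj (P.obj N))
    exact h.lvan_of_retract r (ih _ (h.split _).choose (h.split _).choose_spec)

lemma lvan_of_summandsOfImage (n : ℕ) {M : A} (hM : summandsOfImage P M) : h.LVan n M := by
  obtain ⟨N, ⟨r⟩⟩ := hM
  exact h.lvan_of_retract r (h.lvan_P n N)


section

variable {X₁ X₂ X₃ : A} {f : X₁ ⟶ X₂} {g : X₂ ⟶ X₃} {w : f ≫ g = 0}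
  (hS : (ShortComplex.mk f g w).ShortExact)

include h hS

lemma epi_map : Epi (F.map g) := by
  have := ((Functor.preservesFiniteColimits_tfae F).out 0 3).2 h.rightExact
  exact (this _ hS).2

lemma exact_map :
    (ShortComplex.mk (F.map f) (F.map g) (by rw [← F.map_comp, w, F.map_zero])).Exact := by
  have := ((Functor.preservesFiniteColimits_tfae F).out 0 3).2 h.rightExact
  exact (this _ hS).1

lemma lift_map {B : A} (x : B ⟶ F.obj X₂) (hx : x ≫ F.map g = 0) :
    ∃ (B' : A) (π : B' ⟶ B) (_ : Epi π) (y : B' ⟶ F.obj X₁), π ≫ x = y ≫ F.map f :=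
  (h.exact_map hS).exact_up_to_refinements x hx

end

lemma map_ι_ε (M : A) : F.map (h.ι.app M) ≫ F.map (h.ε.app M) = 0 := by
  rw [← F.map_comp, h.ι_ε, F.map_zero]

lemma map_ι_naturality {M N : A} (f : M ⟶ N) :
    F.map (h.K.map f) ≫ F.map (h.ι.app N) = F.map (h.ι.app M) ≫ F.map (P.map f) := by
  rw [← F.map_comp, h.ι.naturality, F.map_comp]

lemma map_ε_naturality {M N : A} (f : M ⟶ N) :
    F.map (P.map f) ≫ F.map (h.ε.app N) = F.map (h.ε.app M) ≫ F.map f := by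
  rw [← F.map_comp, h.ε.naturality, F.map_comp, Functor.id_map]

section

variable {S : ShortComplex A} (hS : S.ShortExact)

include hS

/-- The piece L₁F(X₃) → F(X₁) → F(X₂) of the long exact sequence, by a chase through the rows
obtained from `K`, `P` and the identity under `F`. An element killed in F(X₂) lifts to F(P X₁), its
image in F(P X₂) comes from F(K X₂), and the hypothesis moves it back into F(K X₁). -/
lemma mono_map (h₃ : h.LVan 0 S.X₃) : Mono (F.map S.f) := by
  rw [lvan_zero_iff] at h₃
  have hPf : Mono (F.map (P.map S.f)) := (h.exact_comp hS).mono_f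
  refine Preadditive.mono_of_cancel_zero _ fun {B} x hx => ?_
  have := h.epi_map (h.cover_shortExact S.X₁)
  obtain ⟨B₁, π₁, _, y, hy⟩ := surjective_up_to_refinements_of_epi (F.map (h.ε.app S.X₁)) x
  obtain ⟨B₂, π₂, _, z, hz⟩ := h.lift_map (h.cover_shortExact S.X₂) (y ≫ F.map (P.map S.f)) (by
    rw [Category.assoc, map_ε_naturality, ← reassoc_of% hy, hx, comp_zero])
  obtain ⟨B₃, π₃, _, w, hw⟩ := h.lift_map (h.map_K_shortExact hS) z (by
    rw [← cancel_mono (F.map (h.ι.app S.X₃)), Category.assoc, map_ι_naturality, ← reassoc_of% hz,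
      ← F.map_comp, ← P.map_comp, S.zero, P.map_zero, F.map_zero]
    simp)
  have e : π₃ ≫ π₂ ≫ y = w ≫ F.map (h.ι.app S.X₁) := by
    rw [← cancel_mono (F.map (P.map S.f))]
    simp only [Category.assoc]
    rw [hz, reassoc_of% hw, map_ι_naturality]
  rw [← cancel_epi (π₃ ≫ π₂ ≫ π₁), comp_zero, Category.assoc, Category.assoc, hy, ← Category.assoc,
    ← Category.assoc, Category.assoc π₃, e]
  simp [h.map_ι_ε]

/-- The same diagram read backwards: exactness of L₁F(X₂) → L₁F(X₃) → F(X₁) → F(X₂). -/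
lemma lvan_zero_of_mono (h₂ : h.LVan 0 S.X₂) (hf : Mono (F.map S.f)) : h.LVan 0 S.X₃ := by
  rw [lvan_zero_iff] at h₂ ⊢
  refine Preadditive.mono_of_cancel_zero _ fun {B} t ht => ?_
  have := h.epi_map (h.map_K_shortExact hS)
  obtain ⟨B₁, π₁, _, z, hz⟩ := surjective_up_to_refinements_of_epi (F.map (h.K.map S.g)) t
  obtain ⟨B₂, π₂, _, y, hy⟩ := (h.exact_comp hS).exact.exact_up_to_refinements
    (z ≫ F.map (h.ι.app S.X₂)) (by
      change (z ≫ F.map (h.ι.app S.X₂)) ≫ F.map (P.map S.g) = 0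
      rw [Category.assoc, ← map_ι_naturality, ← reassoc_of% hz, ht, comp_zero])
  change B₂ ⟶ F.obj (P.obj S.X₁) at y
  change π₂ ≫ z ≫ F.map (h.ι.app S.X₂) = y ≫ F.map (P.map S.f) at hy
  obtain ⟨B₃, π₃, _, w, hw⟩ := h.lift_map (h.cover_shortExact S.X₁) y (by
    rw [← cancel_mono (F.map S.f), Category.assoc, ← map_ε_naturality, ← reassoc_of% hy, map_ι_ε]
    simp)
  have e : π₃ ≫ π₂ ≫ z = w ≫ F.map (h.K.map S.f) := by
    rw [← cancel_mono (F.map (h.ι.app S.X₂))]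
    simp only [Category.assoc]
    rw [hy, reassoc_of% hw, map_ι_naturality]
  have e' : F.map (h.K.map S.f) ≫ F.map (h.K.map S.g) = 0 := by
    rw [← F.map_comp, ← h.K.map_comp, S.zero, h.K.map_zero, F.map_zero]
  rw [← cancel_epi (π₃ ≫ π₂ ≫ π₁), comp_zero, Category.assoc, Category.assoc, hz, ← Category.assoc,
    ← Category.assoc, Category.assoc π₃, e, Category.assoc, e', comp_zero]

lemma lvan_X₂ {n : ℕ} (h₁ : h.LVan n S.X₁) (h₃ : h.LVan n S.X₃) : h.LVan n S.X₂ := by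
  induction n generalizing S with
  | zero =>
    rw [lvan_zero_iff] at h₁ h₃ ⊢
    let φ : ShortComplex.mk (F.map (h.K.map S.f)) (F.map (h.K.map S.g))
        (by rw [← F.map_comp, h.map_K_comp S.zero, F.map_zero]) ⟶ S.map (P ⋙ F) :=
      { τ₁ := F.map (h.ι.app S.X₁)
        τ₂ := F.map (h.ι.app S.X₂)
        τ₃ := F.map (h.ι.app S.X₃)
        comm₁₂ := (h.map_ι_naturality S.f).symm
        comm₂₃ := (h.map_ι_naturality S.g).symm }
    exact ShortComplex.mono_of_mono_of_mono_of_mono φ (h.exact_map (h.map_K_shortExact hS))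
      (h.exact_comp hS).mono_f h₁ h₃
  | succ n ih => exact ih (h.map_K_shortExact hS) h₁ h₃

/-- Exactness at the middle of L_{n+2}F(X₃) → L_{n+1}F(X₁) → L_{n+1}F(X₂). Together with `lvan_X₃`
it yields dimension shifting. -/
lemma lvan_X₁ {n : ℕ} (h₂ : h.LVan n S.X₂) (h₃ : h.LVan (n + 1) S.X₃) : h.LVan n S.X₁ := by
  induction n generalizing S with
  | zero =>
    have : Mono (F.map (h.K.map S.f)) := h.mono_map (h.map_K_shortExact hS) h₃
    have : Mono (F.map (h.K.map S.f) ≫ F.map (h.ι.app S.X₂)) := mono_comp' this h₂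
    rw [map_ι_naturality] at this
    exact mono_of_mono _ (F.map (P.map S.f))
  | succ n ih => exact ih (h.map_K_shortExact hS) h₂ h₃

lemma lvan_X₃ {n : ℕ} (h₁ : h.LVan n S.X₁) (h₂ : h.LVan (n + 1) S.X₂) :
    h.LVan (n + 1) S.X₃ := by
  induction n generalizing S with
  | zero =>
    refine h.lvan_zero_of_mono (h.map_K_shortExact hS) h₂ ?_
    have hPf : Mono (F.map (P.map S.f)) := (h.exact_comp hS).mono_f
    have : Mono (F.map (h.ι.app S.X₁) ≫ F.map (P.map S.f)) := mono_comp' h₁ hPf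
    rw [← map_ι_naturality] at this
    exact mono_of_mono _ (F.map (h.ι.app S.X₂))
  | succ n ih => exact ih (h.map_K_shortExact hS) h₁ h₂

end

/-- The objects on which all `L_n F`, `n > 0`, vanish. -/
def acyclic : ObjectProperty A := fun M => ∀ n, h.LVan n M

end LeftAdapted
end LeftAdapted

/-! ### Cutting complexes into short exact sequences and splicing them back -/

section Complexes

variable {A : Type w} [Category.{v} A] [Abelian A]

/-- A right exact functor commutes with cokernels. Homology of the image complex in one degree is
thereby controlled by the image of a single morphism out of a cokernel. -/
lemma mono_desc_map_iff (F : A ⥤ A) [F.Additive] [PreservesFiniteColimits F] {X Y Z : A}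
    (f : X ⟶ Y) (g : Y ⟶ Z) (w : f ≫ g = 0) (w' : F.map f ≫ F.map g = 0) :
    Mono (cokernel.desc (F.map f) (F.map g) w') ↔ Mono (F.map (cokernel.desc f g w)) := by
  rw [← cokernelComparison_map_desc f F w]
  exact mono_comp_iff_of_isIso _ _

lemma epi_lift_map_iff (F : A ⥤ A) [F.Additive] [PreservesFiniteLimits F] {X Y Z : A}
    (f : X ⟶ Y) (g : Y ⟶ Z) (w : f ≫ g = 0) (w' : F.map f ≫ F.map g = 0) :
    Epi (kernel.lift (F.map g) (F.map f) w') ↔ Epi (F.map (kernel.lift g f w)) := by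
  rw [← map_lift_kernelComparison g F w]
  refine ⟨fun h => ?_, fun h => epi_comp' h inferInstance⟩
  have : Epi ((F.map (kernel.lift g f w) ≫ kernelComparison g F) ≫ inv (kernelComparison g F)) :=
    epi_comp' h inferInstance
  rwa [Category.assoc, IsIso.hom_inv_id, Category.comp_id] at this

lemma exact_congr {X Y Z : A} {f f' : X ⟶ Y} {g g' : Y ⟶ Z} {w : f ≫ g = 0}
    (h : (ShortComplex.mk f g w).Exact) (hf : f' = f) (hg : g' = g) (w' : f' ≫ g' = 0) :
    (ShortComplex.mk f' g' w').Exact := by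
  subst hf hg
  exact h

section Chain

variable {α : Type*} [AddRightCancelSemigroup α] [One α]

/-- The cokernel of the differential into degree `n`. -/
abbrev chainCoker (K : ChainComplex A α) (n : α) : A := cokernel (K.d (n + 1) n)

/-- The morphism to degree `n` that is induced by the differential. -/
abbrev chainCokerDesc (K : ChainComplex A α) (n : α) : chainCoker K (n + 1) ⟶ K.X n :=
  cokernel.desc _ (K.d (n + 1) n) (K.d_comp_d _ _ _)

lemma chainCokerDesc_comp (K : ChainComplex A α) (n : α) :
    chainCokerDesc K n ≫ cokernel.π (K.d (n + 1) n) = 0 := by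
  rw [← cancel_epi (cokernel.π _)]
  simp

lemma chain_exactAt_succ_iff' (K : ChainComplex A α) (n : α) :
    K.ExactAt (n + 1) ↔
      (ShortComplex.mk (K.d (n + 1 + 1) (n + 1)) (K.d (n + 1) n) (K.d_comp_d _ _ _)).Exact :=
  HomologicalComplex.exactAt_iff' K (n + 1 + 1) (n + 1) n
    (ComplexShape.prev_eq' _ rfl) (ComplexShape.next_eq' _ rfl)

lemma chain_exactAt_succ_iff (K : ChainComplex A α) (n : α) :
    K.ExactAt (n + 1) ↔ Mono (chainCokerDesc K n) :=
  (chain_exactAt_succ_iff' K n).trans (ShortComplex.exact_iff_mono_cokernel_desc _)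

lemma chain_map_exactAt_succ_iff (F : A ⥤ A) [F.Additive] (hF : PreservesFiniteColimits F)
    (K : ChainComplex A α) (n : α) :
    ((F.mapHomologicalComplex _).obj K).ExactAt (n + 1) ↔ Mono (F.map (chainCokerDesc K n)) := by
  rw [chain_exactAt_succ_iff]
  exact mono_desc_map_iff F _ _ _ _

lemma chainCoker_shortExact (K : ChainComplex A α) (n : α) (h : K.ExactAt (n + 1)) :
    (ShortComplex.mk _ _ (chainCokerDesc_comp K n)).ShortExact where
  exact := by
    rw [ShortComplex.exact_iff_exact_up_to_refinements]
    intro B x hx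
    obtain ⟨B', π, _, y, hy⟩ :=
      (ShortComplex.exact_cokernel (K.d (n + 1) n)).exact_up_to_refinements x hx
    exact ⟨B', π, inferInstance, y ≫ cokernel.π _, by simpa using hy⟩
  mono_f := (chain_exactAt_succ_iff K n).1 h
  epi_g := inferInstanceAs (Epi (cokernel.π _))

end Chain

section Cochain

variable {α : Type*} [AddRightCancelSemigroup α] [One α]

/-- The kernel of the differential from degree `n`. -/
abbrev cochainKer (K : CochainComplex A α) (n : α) : A := kernel (K.d n (n + 1))

/-- The morphism from degree `n` that is induced by the differential. -/
abbrev cochainKerLift (K : CochainComplex A α) (n : α) : K.X n ⟶ cochainKer K (n + 1) :=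
  kernel.lift _ (K.d n (n + 1)) (K.d_comp_d _ _ _)

lemma comp_cochainKerLift (K : CochainComplex A α) (n : α) :
    kernel.ι (K.d n (n + 1)) ≫ cochainKerLift K n = 0 := by
  rw [← cancel_mono (kernel.ι _)]
  simp

lemma cochain_exactAt_succ_iff' (K : CochainComplex A α) (n : α) :
    K.ExactAt (n + 1) ↔
      (ShortComplex.mk (K.d n (n + 1)) (K.d (n + 1) (n + 1 + 1)) (K.d_comp_d _ _ _)).Exact :=
  HomologicalComplex.exactAt_iff' K n (n + 1) (n + 1 + 1)
    (ComplexShape.prev_eq' _ rfl) (ComplexShape.next_eq' _ rfl)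

lemma cochain_exactAt_succ_iff (K : CochainComplex A α) (n : α) :
    K.ExactAt (n + 1) ↔ Epi (cochainKerLift K n) :=
  (cochain_exactAt_succ_iff' K n).trans (ShortComplex.exact_iff_epi_kernel_lift _)

lemma cochain_map_exactAt_succ_iff (F : A ⥤ A) [F.Additive] (hF : PreservesFiniteLimits F)
    (K : CochainComplex A α) (n : α) :
    ((F.mapHomologicalComplex _).obj K).ExactAt (n + 1) ↔ Epi (F.map (cochainKerLift K n)) := by
  rw [cochain_exactAt_succ_iff]
  exact epi_lift_map_iff F _ _ _ _

lemma cochainKer_shortExact (K : CochainComplex A α) (n : α) (h : K.ExactAt (n + 1)) :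
    (ShortComplex.mk _ _ (comp_cochainKerLift K n)).ShortExact where
  exact := by
    rw [ShortComplex.exact_iff_exact_up_to_refinements]
    intro B x hx
    have hx' : x ≫ K.d n (n + 1) = 0 := by
      have := hx =≫ kernel.ι _
      simpa using this
    exact ⟨B, 𝟙 B, inferInstance, kernel.lift _ x hx', by simp⟩
  mono_f := inferInstanceAs (Mono (kernel.ι _))
  epi_g := (cochain_exactAt_succ_iff K n).1 h

end Cochain

/-- A resolution of `M`, cut into short exact sequences `0 ⟶ G (n+1) ⟶ Q n ⟶ G n ⟶ 0`. -/
structure LeftSeq (M : A) where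
  G : ℕ → A
  Q : ℕ → A
  f : ∀ n, G (n + 1) ⟶ Q n
  g : ∀ n, Q n ⟶ G n
  w : ∀ n, f n ≫ g n = 0
  shortExact : ∀ n, (ShortComplex.mk _ _ (w n)).ShortExact
  iso : G 0 ≅ M

/-- A coresolution of `M`, cut into short exact sequences `0 ⟶ G n ⟶ Q n ⟶ G (n+1) ⟶ 0`. -/
structure RightSeq (M : A) where
  G : ℕ → A
  Q : ℕ → A
  f : ∀ n, G n ⟶ Q n
  g : ∀ n, Q n ⟶ G (n + 1)
  w : ∀ n, f n ≫ g n = 0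
  shortExact : ∀ n, (ShortComplex.mk _ _ (w n)).ShortExact
  iso : G 0 ≅ M


/-- Neither the image of `f` nor the kernel of `g` changes. -/
lemma splice_exact {X₁ X₂ Y Z₁ Z₂ : A} (e : X₁ ⟶ X₂) [Epi e] {f : X₂ ⟶ Y} {g : Y ⟶ Z₁}
    (m : Z₁ ⟶ Z₂) [Mono m] {w : f ≫ g = 0} (h : (ShortComplex.mk f g w).Exact)
    (w' : (e ≫ f) ≫ (g ≫ m) = 0) : (ShortComplex.mk (e ≫ f) (g ≫ m) w').Exact := by
  let φ : ShortComplex.mk (e ≫ f) (g ≫ m) w' ⟶ ShortComplex.mk f (g ≫ m) (by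
      rw [reassoc_of% w, zero_comp]) := { τ₁ := e, τ₂ := 𝟙 _, τ₃ := 𝟙 _ }
  let ψ : ShortComplex.mk f g w ⟶ ShortComplex.mk f (g ≫ m) (by
      rw [reassoc_of% w, zero_comp]) := { τ₁ := 𝟙 _, τ₂ := 𝟙 _, τ₃ := m }
  rw [ShortComplex.exact_iff_of_epi_of_isIso_of_mono φ,
    ← ShortComplex.exact_iff_of_epi_of_isIso_of_mono ψ]
  exact h

section Chain

lemma chain_quasiIsoAt_zero_iff {K : ChainComplex A ℕ} {M : A}
    (π : K ⟶ (ChainComplex.single₀ A).obj M) (p : K.X 0 ⟶ M) (hp : p = π.f 0)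
    (w : K.d 1 0 ≫ p = 0) :
    QuasiIsoAt π 0 ↔ (ShortComplex.mk (K.d 1 0) p w).Exact ∧ Epi p := by
  subst hp
  rw [ChainComplex.quasiIsoAt₀_iff, ShortComplex.quasiIso_iff_of_zeros']
  · rfl
  · exact K.shape _ _ (by simp)
  · rfl
  · rfl

lemma cochain_quasiIsoAt_zero_iff {K : CochainComplex A ℕ} {M : A}
    (ι : (CochainComplex.single₀ A).obj M ⟶ K) (p : M ⟶ K.X 0) (hp : p = ι.f 0)
    (w : p ≫ K.d 0 1 = 0) :
    QuasiIsoAt ι 0 ↔ (ShortComplex.mk p (K.d 0 1) w).Exact ∧ Mono p := by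
  subst hp
  rw [CochainComplex.quasiIsoAt₀_iff, ShortComplex.quasiIso_iff_of_zeros]
  · rfl
  · rfl
  · rfl
  · exact K.shape _ _ (by simp)

variable {α : Type*} [AddRightCancelSemigroup α] [One α] [DecidableEq α]

/-- The chain complex obtained by splicing short exact sequences
`0 ⟶ G (n+1) ⟶ Q n ⟶ G n ⟶ 0`. -/
abbrev chainOfSeq {G Q : α → A} (f : ∀ n, G (n + 1) ⟶ Q n) (g : ∀ n, Q n ⟶ G n)
    (w : ∀ n, f n ≫ g n = 0) : ChainComplex A α :=
  ChainComplex.of Q (fun n => g (n + 1) ≫ f n) fun n => by simp [reassoc_of% w]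

lemma chainOfSeq_d {G Q : α → A} (f : ∀ n, G (n + 1) ⟶ Q n) (g : ∀ n, Q n ⟶ G n)
    (w : ∀ n, f n ≫ g n = 0) (n : α) :
    (chainOfSeq f g w).d (n + 1) n = g (n + 1) ≫ f n :=
  ChainComplex.of_d (X := Q) (d := fun n => g (n + 1) ≫ f n) n

lemma chainOfSeq_exactAt {G Q : α → A} (f : ∀ n, G (n + 1) ⟶ Q n) (g : ∀ n, Q n ⟶ G n)
    (w : ∀ n, f n ≫ g n = 0) (h : ∀ n, (ShortComplex.mk _ _ (w n)).ShortExact) (n : α) :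
    (chainOfSeq f g w).ExactAt (n + 1) := by
  rw [chain_exactAt_succ_iff']
  have : Epi (g (n + 1 + 1)) := (h _).epi_g
  have : Mono (f n) := (h _).mono_f
  exact exact_congr (splice_exact (g (n + 1 + 1)) (f n) (h (n + 1)).exact
    (by simp [reassoc_of% w])) (chainOfSeq_d _ _ _ _) (chainOfSeq_d _ _ _ _) _

/-- The cochain complex obtained by splicing short exact sequences
`0 ⟶ G n ⟶ Q n ⟶ G (n+1) ⟶ 0`. -/
abbrev cochainOfSeq {G Q : α → A} (f : ∀ n, G n ⟶ Q n) (g : ∀ n, Q n ⟶ G (n + 1))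
    (w : ∀ n, f n ≫ g n = 0) : CochainComplex A α :=
  CochainComplex.of Q (fun n => g n ≫ f (n + 1)) fun n => by simp [reassoc_of% w]

lemma cochainOfSeq_d {G Q : α → A} (f : ∀ n, G n ⟶ Q n) (g : ∀ n, Q n ⟶ G (n + 1))
    (w : ∀ n, f n ≫ g n = 0) (n : α) :
    (cochainOfSeq f g w).d n (n + 1) = g n ≫ f (n + 1) :=
  CochainComplex.of_d (X := Q) (d := fun n => g n ≫ f (n + 1)) n

lemma cochainOfSeq_exactAt {G Q : α → A} (f : ∀ n, G n ⟶ Q n) (g : ∀ n, Q n ⟶ G (n + 1))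
    (w : ∀ n, f n ≫ g n = 0) (h : ∀ n, (ShortComplex.mk _ _ (w n)).ShortExact) (n : α) :
    (cochainOfSeq f g w).ExactAt (n + 1) := by
  rw [cochain_exactAt_succ_iff']
  have : Epi (g n) := (h _).epi_g
  have : Mono (f (n + 1 + 1)) := (h _).mono_f
  exact exact_congr (splice_exact (g n) (f (n + 1 + 1)) (h (n + 1)).exact
    (by simp [reassoc_of% w])) (cochainOfSeq_d _ _ _ _) (cochainOfSeq_d _ _ _ _) _

end Chain

/-- The resolution obtained by splicing short exact sequences. -/
def LeftSeq.resolution {X : ObjectProperty A} {M : A} (s : LeftSeq M) (hX : ∀ n, X (s.Q n)) :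
    LeftResolution X M :=
  have w : (chainOfSeq s.f s.g s.w).d 1 0 ≫ s.g 0 ≫ s.iso.hom = 0 := by
    have : (chainOfSeq s.f s.g s.w).d 1 0 = s.g 1 ≫ s.f 0 := chainOfSeq_d s.f s.g s.w 0
    rw [this]
    simp [reassoc_of% s.w]
  { complex := chainOfSeq s.f s.g s.w
    prop := hX
    π := (ChainComplex.toSingle₀Equiv _ _).symm ⟨s.g 0 ≫ s.iso.hom, w⟩
    quasiIso := ⟨fun n => by
      cases n with
      | zero =>
        have : Epi (s.g (0 + 1)) := (s.shortExact _).epi_g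
        have : Epi (s.g 0) := (s.shortExact _).epi_g
        rw [chain_quasiIsoAt_zero_iff _ (s.g 0 ≫ s.iso.hom)
          (ChainComplex.toSingle₀Equiv_symm_apply_f_zero _ w).symm w]
        refine ⟨?_, inferInstance⟩
        exact exact_congr (splice_exact (s.g (0 + 1)) s.iso.hom (s.shortExact 0).exact
          (by simp [reassoc_of% s.w])) (chainOfSeq_d s.f s.g s.w 0) rfl _
      | succ n =>
        rw [quasiIsoAt_iff_exactAt']
        · exact chainOfSeq_exactAt _ _ _ s.shortExact n
        · exact ChainComplex.exactAt_succ_single_obj _ _⟩ }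

/-- The coresolution obtained by splicing short exact sequences. -/
def RightSeq.coresolution {X : ObjectProperty A} {M : A} (s : RightSeq M) (hX : ∀ n, X (s.Q n)) :
    RightResolution X M :=
  have w : (s.iso.inv ≫ s.f 0) ≫ (cochainOfSeq s.f s.g s.w).d 0 1 = 0 := by
    have : (cochainOfSeq s.f s.g s.w).d 0 1 = s.g 0 ≫ s.f 1 := cochainOfSeq_d s.f s.g s.w 0
    rw [this]
    simp [reassoc_of% s.w]
  { complex := cochainOfSeq s.f s.g s.w
    prop := hX
    ι := (CochainComplex.fromSingle₀Equiv _ _).symm ⟨s.iso.inv ≫ s.f 0, w⟩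
    quasiIso := ⟨fun n => by
      cases n with
      | zero =>
        have : Mono (s.f (0 + 1)) := (s.shortExact _).mono_f
        have : Mono (s.f 0) := (s.shortExact _).mono_f
        have e := CochainComplex.fromSingle₀Equiv_symm_apply_f_zero
          (C := cochainOfSeq s.f s.g s.w) (s.iso.inv ≫ s.f 0) w
        rw [cochain_quasiIsoAt_zero_iff _ (s.iso.inv ≫ s.f 0) e.symm w]
        refine ⟨?_, inferInstance⟩
        exact exact_congr (splice_exact s.iso.inv (s.f (0 + 1)) (s.shortExact 0).exact
          (by simp [reassoc_of% s.w])) rfl (cochainOfSeq_d s.f s.g s.w 0) _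
      | succ n =>
        rw [quasiIsoAt_iff_exactAt]
        · exact cochainOfSeq_exactAt _ _ _ s.shortExact n
        · exact CochainComplex.exactAt_succ_single_obj _ _⟩ }

namespace LeftResolution

variable {X : ObjectProperty A} {M : A} (R : LeftResolution X M)

lemma exactAt_succ (n : ℕ) : R.complex.ExactAt (n + 1) := by
  have := R.quasiIso
  rw [← quasiIsoAt_iff_exactAt' R.π (n + 1) (ChainComplex.exactAt_succ_single_obj _ _)]
  infer_instance

lemma d_comp_π : R.complex.d 1 0 ≫ (show R.complex.X 0 ⟶ M from R.π.f 0) = 0 :=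
  ((ChainComplex.toSingle₀Equiv _ _) R.π).2

lemma augmentation_exact : (ShortComplex.mk (R.complex.d 1 0)
    (show R.complex.X 0 ⟶ M from R.π.f 0) R.d_comp_π).Exact ∧
    Epi (show R.complex.X 0 ⟶ M from R.π.f 0) :=
  (chain_quasiIsoAt_zero_iff R.π _ rfl R.d_comp_π).1 (R.quasiIso.quasiIsoAt 0)

/-- The augmentation identifies `M` with the cokernel of the first differential. -/
def cokerIso : chainCoker R.complex 0 ≅ M :=
  have := R.augmentation_exact.2
  (cokernelIsCokernel _).coconePointUniqueUpToIso R.augmentation_exact.1.gIsCokernel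

/-- The short exact sequences of a resolution. -/
def seq : LeftSeq M where
  G := chainCoker R.complex
  Q := R.complex.X
  f := chainCokerDesc R.complex
  g _ := cokernel.π _
  w := chainCokerDesc_comp R.complex
  shortExact n := chainCoker_shortExact _ _ (R.exactAt_succ n)
  iso := R.cokerIso

end LeftResolution

namespace RightResolution

variable {X : ObjectProperty A} {M : A} (R : RightResolution X M)

lemma exactAt_succ (n : ℕ) : R.complex.ExactAt (n + 1) := by
  have := R.quasiIso
  rw [← quasiIsoAt_iff_exactAt R.ι (n + 1) (CochainComplex.exactAt_succ_single_obj _ _)]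
  infer_instance

lemma ι_comp_d : (show M ⟶ R.complex.X 0 from R.ι.f 0) ≫ R.complex.d 0 1 = 0 :=
  ((CochainComplex.fromSingle₀Equiv _ _) R.ι).2

lemma augmentation_exact : (ShortComplex.mk (show M ⟶ R.complex.X 0 from R.ι.f 0)
    (R.complex.d 0 1) R.ι_comp_d).Exact ∧ Mono (show M ⟶ R.complex.X 0 from R.ι.f 0) :=
  (cochain_quasiIsoAt_zero_iff R.ι _ rfl R.ι_comp_d).1 (R.quasiIso.quasiIsoAt 0)

/-- The augmentation identifies `M` with the kernel of the first differential. -/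
def kerIso : cochainKer R.complex 0 ≅ M :=
  have := R.augmentation_exact.2
  (kernelIsKernel _).conePointUniqueUpToIso R.augmentation_exact.1.fIsKernel

/-- The short exact sequences of a coresolution. -/
def seq : RightSeq M where
  G := cochainKer R.complex
  Q := R.complex.X
  f _ := kernel.ι _
  g := cochainKerLift R.complex
  w := comp_cochainKerLift R.complex
  shortExact n := cochainKer_shortExact _ _ (R.exactAt_succ n)
  iso := R.kerIso

end RightResolution

end Complexes

/-! ### Acyclic resolutions, dimension shifting and resolution dimension -/

section LeftAdaptedResolutions

variable {A : Type w} [Category.{v} A] [Abelian A]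

lemma eqToHom_conj_comp_eq_zero {X Y Z X' Y' Z' : A} (e₁ : X' = X) (e₂ : Y' = Y) (e₃ : Z' = Z)
    (f : X ⟶ Y) (g : Y ⟶ Z) (w : f ≫ g = 0) :
    (eqToHom e₁ ≫ f ≫ eqToHom e₂.symm) ≫ eqToHom e₂ ≫ g ≫ eqToHom e₃.symm = 0 := by
  subst e₁ e₂ e₃
  simpa using w

omit [Abelian A] in
lemma eqToHom_comp_conj {X Y X' Y' : A} (e₁ : X = X') (f : X ⟶ Y) (e₂ : Y = Y') :
    eqToHom e₁ ≫ eqToHom e₁.symm ≫ f ≫ eqToHom e₂ = f ≫ eqToHom e₂ := by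
  simp

namespace LeftAdapted

variable {F P : A ⥤ A} [F.Additive] [P.Additive] (h : LeftAdapted F P)

lemma lvan_shift {S : ShortComplex A} (hS : S.ShortExact) (h₂ : h.acyclic S.X₂) (n : ℕ) :
    h.LVan (n + 1) S.X₃ ↔ h.LVan n S.X₁ :=
  ⟨fun h₃ => h.lvan_X₁ hS (h₂ n) h₃, fun h₁ => h.lvan_X₃ hS h₁ (h₂ _)⟩

lemma lvan_zero_iff_mono {S : ShortComplex A} (hS : S.ShortExact) (h₂ : h.acyclic S.X₂) :
    h.LVan 0 S.X₃ ↔ Mono (F.map S.f) :=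
  ⟨fun h₃ => h.mono_map hS h₃, fun h₁ => h.lvan_zero_of_mono hS (h₂ 0) h₁⟩

lemma acyclic_X₁ {S : ShortComplex A} (hS : S.ShortExact) (h₂ : h.acyclic S.X₂)
    (h₃ : h.acyclic S.X₃) : h.acyclic S.X₁ :=
  fun n => (h.lvan_shift hS h₂ n).1 (h₃ _)

lemma acyclic_X₂ {S : ShortComplex A} (hS : S.ShortExact) (h₁ : h.acyclic S.X₁)
    (h₃ : h.acyclic S.X₃) : h.acyclic S.X₂ :=
  fun n => h.lvan_X₂ hS (h₁ n) (h₃ n)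

lemma acyclic_of_iso {M N : A} (e : M ≅ N) (hN : h.acyclic N) : h.acyclic M :=
  fun n => h.lvan_of_iso e (hN n)

lemma acyclic_of_isZero {M : A} (hM : IsZero M) : h.acyclic M := fun n =>
  h.lvan_of_retract ⟨0, 0, hM.eq_of_src _ _⟩ (h.lvan_P n M)

lemma acyclic_of_summandsOfImage {M : A} (hM : summandsOfImage P M) : h.acyclic M :=
  fun n => h.lvan_of_summandsOfImage n hM

lemma acyclic_P (M : A) : h.acyclic (P.obj M) := fun n => h.lvan_P n M

lemma map_shortExact {S : ShortComplex A} (hS : S.ShortExact) (h₃ : h.LVan 0 S.X₃) :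
    (S.map F).ShortExact where
  exact := h.exact_map hS
  mono_f := h.mono_map hS h₃
  epi_g := h.epi_map hS

lemma lvan_seq {M : A} (s : LeftSeq M) (hs : ∀ n, h.acyclic (s.Q n)) (n m : ℕ) :
    h.LVan m (s.G n) ↔ h.LVan (n + m) M := by
  induction n generalizing m with
  | zero =>
    rw [zero_add]
    exact ⟨h.lvan_of_iso s.iso.symm, h.lvan_of_iso s.iso⟩
  | succ n ih => rw [← h.lvan_shift (s.shortExact n) (hs n), ih, Nat.add_right_comm, Nat.add_assoc]

lemma mono_map_seq_iff {M : A} (s : LeftSeq M) (hs : ∀ n, h.acyclic (s.Q n)) (n : ℕ) :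
    Mono (F.map (s.f n)) ↔ h.LVan n M := by
  rw [← h.lvan_zero_iff_mono (s.shortExact n) (hs n)]
  exact h.lvan_seq s hs n 0

/-- The iterated kernels of the counit. -/
def syzygy (M : A) : ℕ → A
  | 0 => M
  | n + 1 => h.K.obj (syzygy M n)

lemma lvan_syzygy (M : A) (n m : ℕ) : h.LVan m (h.syzygy M n) ↔ h.LVan (n + m) M := by
  induction n generalizing m with
  | zero => rw [zero_add]; rfl
  | succ n ih => exact (ih (m + 1)).trans (by rw [Nat.add_right_comm, Nat.add_assoc])

/-- The standard resolution by objects `P.obj N`. -/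
def standardSeq (M : A) : LeftSeq M where
  G := h.syzygy M
  Q n := P.obj (h.syzygy M n)
  f _ := h.ι.app _
  g _ := h.ε.app _
  w _ := h.ι_ε _
  shortExact _ := h.cover_shortExact _
  iso := Iso.refl _

/-- The standard resolution, truncated after the term of degree `s`. -/
def truncatedSeq (M : A) (s : ℕ) : LeftSeq M where
  G n := if n ≤ s then h.syzygy M n else 0
  Q n := if n < s then P.obj (h.syzygy M n) else if n = s then h.syzygy M n else 0
  f n := if hn : n < s then
      eqToHom (if_pos hn) ≫ h.ι.app (h.syzygy M n) ≫ eqToHom (if_pos hn).symm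
    else 0
  g n := if hn : n < s then
      eqToHom (if_pos hn) ≫ h.ε.app (h.syzygy M n) ≫ eqToHom (if_pos hn.le).symm
    -- In degree `s` this is the identity of the last syzygy, which takes the place of an object
    -- `P.obj N`; beyond it is the identity of zero.
    else eqToHom (by split_ifs <;> first | rfl | omega)
  w n := by
    by_cases hn : n < s
    · rw [dif_pos hn, dif_pos hn]
      exact eqToHom_conj_comp_eq_zero (if_pos hn) (if_pos hn) (if_pos hn.le) _ _ (h.ι_ε _)
    · rw [dif_neg hn, zero_comp]
  shortExact n := by
    by_cases hn : n < s
    · refine ShortComplex.shortExact_of_iso ?_ (h.cover_shortExact (h.syzygy M n))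
      have e₁ : h.K.obj (h.syzygy M n) = if n + 1 ≤ s then h.syzygy M (n + 1) else 0 :=
        (if_pos hn).symm
      have e₂ : P.obj (h.syzygy M n) = if n < s then P.obj (h.syzygy M n) else
        if n = s then h.syzygy M n else 0 := (if_pos hn).symm
      have e₃ : h.syzygy M n = if n ≤ s then h.syzygy M n else 0 := (if_pos hn.le).symm
      refine ShortComplex.isoMk (eqToIso e₁) (eqToIso e₂) (eqToIso e₃) ?_ ?_
      · change eqToHom e₁ ≫ dite _ _ _ = h.ι.app _ ≫ eqToHom e₂
        rw [dif_pos hn]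
        exact eqToHom_comp_conj e₁ _ _
      · change eqToHom e₂ ≫ dite _ _ _ = h.ε.app _ ≫ eqToHom e₃
        rw [dif_pos hn]
        exact eqToHom_comp_conj e₂ _ _
    · have h0 : IsZero (if n + 1 ≤ s then h.syzygy M (n + 1) else 0) := by
        rw [if_neg (by omega)]
        exact isZero_zero A
      simp only [dif_neg hn]
      refine { exact := ?_, mono_f := ⟨fun _ _ _ => h0.eq_of_tgt _ _⟩, epi_g := by dsimp; infer_instance }
      rw [ShortComplex.exact_iff_mono _ rfl]
      dsimp
      infer_instance
  iso := eqToIso (if_pos (Nat.zero_le s))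

lemma acyclic_truncatedSeq {M : A} {s : ℕ} (hM : ∀ n, s ≤ n → h.LVan n M) (n : ℕ) :
    h.acyclic ((h.truncatedSeq M s).Q n) := by
  dsimp [truncatedSeq]
  split_ifs with h₁ h₂
  · exact h.acyclic_P _
  · intro m
    rw [lvan_syzygy]
    exact hM _ (by omega)
  · exact h.acyclic_of_isZero (isZero_zero A)

lemma isZero_truncatedSeq (M : A) {s n : ℕ} (hn : s < n) :
    IsZero ((h.truncatedSeq M s).Q n) := by
  dsimp [truncatedSeq]
  rw [if_neg (by omega), if_neg (by omega)]
  exact isZero_zero A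

/-- For `m ≤ n` the object `s.G (n + 1)` is a quotient of `s.Q (n + 1) = 0`, so the monomorphism
that tests `LVan n` has zero source. -/
lemma lvan_of_isZero_seq {M : A} (s : LeftSeq M) (hs : ∀ n, h.acyclic (s.Q n)) {m : ℕ}
    (h0 : ∀ i, m < i → IsZero (s.Q i)) {n : ℕ} (hn : m ≤ n) : h.LVan n M := by
  rw [← h.mono_map_seq_iff s hs n]
  have := (s.shortExact (n + 1)).epi_g
  have hz : IsZero (s.G (n + 1)) := by
    rw [IsZero.iff_id_eq_zero, ← cancel_epi (s.g (n + 1))]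
    exact (h0 _ (by omega)).eq_of_src _ _
  exact ⟨fun _ _ _ => (F.map_isZero hz).eq_of_tgt _ _⟩

lemma resolution_exactAt_iff {X : ObjectProperty A} (hX : ∀ M, X M → h.acyclic M) {M : A}
    (R : LeftResolution X M) (n : ℕ) :
    ((F.mapHomologicalComplex _).obj R.complex).ExactAt (n + 1) ↔ h.LVan n M := by
  rw [chain_map_exactAt_succ_iff F h.rightExact]
  exact h.mono_map_seq_iff R.seq (fun n => hX _ (R.prop n)) n

omit [Abelian A] in
lemma summandsOfImage_obj (F : A ⥤ A) (N : A) : summandsOfImage F (F.obj N) :=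
  ⟨N, ⟨.refl _⟩⟩

/-- Each single resolution decides the vanishing, so the universal quantifier in the definition is
harmless; the standard resolution shows that it is not vacuous. -/
lemma leftDerivedVanishes_iff (n : ℕ) (M : A) :
    LeftDerivedVanishes P F (n + 1) M ↔ h.LVan n M := by
  refine ⟨fun hM => ?_, fun hM R => ?_⟩
  · rw [← h.resolution_exactAt_iff (fun _ => h.acyclic_of_summandsOfImage)]
    exact hM ((h.standardSeq M).resolution fun n => summandsOfImage_obj _ _)
  · exact (h.resolution_exactAt_iff (fun _ => h.acyclic_of_summandsOfImage) R n).2 hM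

end LeftAdapted

lemma iInf_natCast_le_iff (p : ℕ → Prop) (s : ℕ) :
    (⨅ (n : ℕ) (_ : p n), (n : ℕ∞)) ≤ s ↔ ∃ n ≤ s, p n := by
  refine ⟨fun hs => ?_, fun ⟨n, hn, hp⟩ => (iInf₂_le n hp).trans (by exact_mod_cast hn)⟩
  have : (⨅ (n : ℕ) (_ : p n), (n : ℕ∞)) < ((s + 1 : ℕ) : ℕ∞) :=
    hs.trans_lt (by exact_mod_cast Nat.lt_succ_self s)
  simp only [iInf_lt_iff] at this
  obtain ⟨n, hn, h⟩ := this
  exact ⟨n, by have : n < s + 1 := by exact_mod_cast h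
               omega, hn⟩

lemma iSup_eq_natCast_of_isLeast {ι : Type*} (f : ι → ℕ∞) {n : ℕ}
    (h : IsLeast {s : ℕ | ∀ i, f i ≤ s} n) : ⨆ i, f i = n := by
  refine le_antisymm (iSup_le h.1) ?_
  by_contra hlt
  rw [not_le] at hlt
  obtain ⟨m, hm⟩ := ENat.ne_top_iff_exists.1 hlt.ne_top
  have : n ≤ m := h.2 fun i => hm ▸ le_iSup f i
  rw [← hm] at hlt
  exact absurd (by exact_mod_cast hlt : m < n) (not_lt.2 this)

namespace LeftAdapted

variable {F P : A ⥤ A} [F.Additive] [P.Additive] (h : LeftAdapted F P)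

/-- The syzygy in degree `s` is acyclic exactly when all L_i F(M) with i > s vanish, and then the
standard resolution can be stopped there. -/
lemma resolutionDim_acyclic_le_iff (M : A) (s : ℕ) :
    resolutionDim h.acyclic M ≤ s ↔ ∀ n, s ≤ n → h.LVan n M := by
  rw [resolutionDim, iInf_natCast_le_iff]
  refine ⟨fun ⟨m, hm, R, hR⟩ n hn => h.lvan_of_isZero_seq R.seq R.prop hR (hm.trans hn),
    fun hM => ⟨s, le_rfl, (h.truncatedSeq M s).resolution (h.acyclic_truncatedSeq hM),
      fun i hi => h.isZero_truncatedSeq M hi⟩⟩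

end LeftAdapted

end LeftAdaptedResolutions

/-! ### Both derived functors of a Nakayama functor, the right one via the opposite category -/

section NakayamaData

variable {A : Type w} [Category.{v} A] [Abelian A]

/-- A Nakayama functor `ν ⊣ ν'` relative to `P`, together with an epimorphism `P ⟶ 𝟭` that splits
on the objects `P.obj N`, and a monomorphism `𝟭 ⟶ P ⋙ ν` that splits on the objects
`(P ⋙ ν).obj N`. -/
structure NakayamaData (P ν ν' : A ⥤ A) where
  adj : ν ⊣ ν'
  adjP : P ⊣ P ⋙ ν
  isIso_unit : ∀ M, IsIso (adj.unit.app (P.obj M))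
  ε : P ⟶ 𝟭 A
  epi : ∀ M, Epi (ε.app M)
  split_ε : ∀ N, ∃ s : P.obj N ⟶ P.obj (P.obj N), s ≫ ε.app (P.obj N) = 𝟙 _
  η : 𝟭 A ⟶ P ⋙ ν
  mono : ∀ M, Mono (η.app M)
  split_η : ∀ N, ∃ s : (P ⋙ ν).obj ((P ⋙ ν).obj N) ⟶ (P ⋙ ν).obj N,
    η.app ((P ⋙ ν).obj N) ≫ s = 𝟙 _

namespace NakayamaData

attribute [instance] isIso_unit epi mono

variable {P ν ν' : A ⥤ A} (h : NakayamaData P ν ν')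

include h in
lemma preservesFiniteColimits_ν : PreservesFiniteColimits ν :=
  have := h.adj.leftAdjoint_preservesColimits
  inferInstance

include h in
lemma preservesFiniteLimits_ν' : PreservesFiniteLimits ν' :=
  have := h.adj.rightAdjoint_preservesLimits
  inferInstance

include h in
lemma preservesFiniteColimits_P : PreservesFiniteColimits P :=
  have := h.adjP.leftAdjoint_preservesColimits
  inferInstance

include h in
lemma preservesFiniteLimits_I : PreservesFiniteLimits (P ⋙ ν) :=
  have := h.adjP.rightAdjoint_preservesLimits
  inferInstance

include h in
lemma preservesFiniteColimits_I : PreservesFiniteColimits (P ⋙ ν) :=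
  have := h.preservesFiniteColimits_P
  have := h.preservesFiniteColimits_ν
  comp_preservesFiniteColimits _ _

/-- `P` is recovered from `P ⋙ ν`. -/
def isoP : P ≅ (P ⋙ ν) ⋙ ν' :=
  NatIso.ofComponents (fun M => asIso (h.adj.unit.app (P.obj M)))
    fun f => h.adj.unit.naturality (P.map f)

include h in
-- Being a left adjoint, `P` is right exact. It is also left exact, since the unit exhibits it as a
-- composite of the right adjoints `P ⋙ ν` and `ν'`.
lemma preservesFiniteLimits_P : PreservesFiniteLimits P :=
  have := h.preservesFiniteLimits_I
  have := h.preservesFiniteLimits_ν'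
  have : PreservesFiniteLimits ((P ⋙ ν) ⋙ ν') := comp_preservesFiniteLimits _ _
  preservesFiniteLimits_of_natIso h.isoP.symm

variable [P.Additive] [ν.Additive] [ν'.Additive]

/-- The summands of objects `P.obj N` are adapted to `ν`. -/
def left : LeftAdapted ν P where
  rightExact := h.preservesFiniteColimits_ν
  exact hS :=
    have := h.preservesFiniteColimits_P
    have := h.preservesFiniteLimits_P
    hS.map_of_exact P
  exact_comp hS :=
    have := h.preservesFiniteColimits_I
    have := h.preservesFiniteLimits_I
    hS.map_of_exact (P ⋙ ν)
  ε := h.ε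
  epi := h.epi
  split := h.split_ε

/-- The summands of objects `(P ⋙ ν).obj N` are adapted to `ν'`. -/
def right : LeftAdapted ν'.op (P ⋙ ν).op where
  rightExact :=
    have := h.preservesFiniteLimits_ν'
    preservesFiniteColimits_op ν'
  exact hS :=
    have := h.preservesFiniteColimits_I
    have := h.preservesFiniteLimits_I
    (hS.unop.map_of_exact (P ⋙ ν)).op
  exact_comp hS :=
    have := h.preservesFiniteColimits_P
    have := h.preservesFiniteLimits_P
    have : PreservesFiniteLimits ((P ⋙ ν) ⋙ ν') := preservesFiniteLimits_of_natIso h.isoP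
    have : PreservesFiniteColimits ((P ⋙ ν) ⋙ ν') := preservesFiniteColimits_of_natIso h.isoP
    (hS.unop.map_of_exact ((P ⋙ ν) ⋙ ν')).op
  ε :=
    { app := fun M => (h.η.app M.unop).op
      naturality := fun _ _ f => Quiver.Hom.unop_inj (h.η.naturality f.unop).symm }
  epi M := inferInstanceAs (Epi (h.η.app M.unop).op)
  split N :=
    ⟨(h.split_η N.unop).choose.op, Quiver.Hom.unop_inj (h.split_η N.unop).choose_spec⟩

/-- The vanishing of `L_{n+1} ν`. -/
abbrev LVan (n : ℕ) (M : A) : Prop := h.left.LVan n M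

/-- The vanishing of `R^{n+1} ν'`. -/
abbrev RVan (n : ℕ) (M : A) : Prop := h.right.LVan n (op M)

/-- The objects on which all `R^n ν'`, `n > 0`, vanish. -/
def coacyclic : ObjectProperty A := fun M => ∀ n, h.RVan n M

section

variable {X₁ X₂ X₃ : A} {f : X₁ ⟶ X₂} {g : X₂ ⟶ X₃} {w : f ≫ g = 0}
  (hS : (ShortComplex.mk f g w).ShortExact)

include hS

lemma rvan_shift (h₂ : h.coacyclic X₂) (n : ℕ) : h.RVan (n + 1) X₁ ↔ h.RVan n X₃ :=
  h.right.lvan_shift (S := ShortComplex.mk g.op f.op (by rw [← op_comp, w, op_zero])) hS.op h₂ n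

lemma rvan_zero_iff_epi (h₂ : h.coacyclic X₂) : h.RVan 0 X₁ ↔ Epi (ν'.map g) :=
  (h.right.lvan_zero_iff_mono
    (S := ShortComplex.mk g.op f.op (by rw [← op_comp, w, op_zero])) hS.op h₂).trans
    (op_mono_iff (ν'.map g))

lemma coacyclic_X₃ (h₁ : h.coacyclic X₁) (h₂ : h.coacyclic X₂) : h.coacyclic X₃ :=
  fun n => (h.rvan_shift hS h₂ n).1 (h₁ _)

lemma coacyclic_X₂ (h₁ : h.coacyclic X₁) (h₃ : h.coacyclic X₃) : h.coacyclic X₂ :=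
  h.right.acyclic_X₂ (S := ShortComplex.mk g.op f.op (by rw [← op_comp, w, op_zero])) hS.op h₃ h₁

lemma map_ν'_shortExact (h₁ : h.RVan 0 X₁) :
    (ShortComplex.mk (ν'.map f) (ν'.map g) (by rw [← ν'.map_comp, w, ν'.map_zero])).ShortExact :=
  (h.right.map_shortExact
    (S := ShortComplex.mk g.op f.op (by rw [← op_comp, w, op_zero])) hS.op h₁).unop

lemma map_ν_shortExact (h₃ : h.LVan 0 X₃) :
    (ShortComplex.mk (ν.map f) (ν.map g) (by rw [← ν.map_comp, w, ν.map_zero])).ShortExact :=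
  h.left.map_shortExact hS h₃

end

lemma rvan_of_iso {n : ℕ} {M N : A} (e : M ≅ N) (hN : h.RVan n N) : h.RVan n M :=
  h.right.lvan_of_iso e.op.symm hN

lemma coacyclic_of_summandsOfImage {M : A} (hM : summandsOfImage (P ⋙ ν) M) : h.coacyclic M :=
  h.right.acyclic_of_summandsOfImage (by
    obtain ⟨N, ⟨r⟩⟩ := hM
    exact ⟨op N, ⟨r.op⟩⟩)

lemma coacyclic_I (M : A) : h.coacyclic (ν.obj (P.obj M)) := h.right.acyclic_P (op M)

end NakayamaData

end NakayamaData

/-! ### Equivalence between acyclic and coacyclic objects -/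

section Gorenstein

variable {A : Type w} [Category.{v} A] [Abelian A]

namespace NakayamaData

variable {P ν ν' : A ⥤ A} (h : NakayamaData P ν ν') [P.Additive] [ν.Additive] [ν'.Additive]

/-- Since L₁ν(M) = 0, the sequence 0 → νK → νP M → νM → 0 is exact with coacyclic middle term, so
the vanishing of R^{n+1}ν' at νM is that of R^{n+2}ν' at νK. The kernel K is again acyclic, and
after enough steps the degree exceeds the bound. -/
lemma coacyclic_map_ν (hr : ∃ m, ∀ n, m ≤ n → ∀ M, h.RVan n M) {M : A}
    (hM : h.left.acyclic M) : h.coacyclic (ν.obj M) := by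
  obtain ⟨m, hm⟩ := hr
  suffices H : ∀ (j : ℕ) (M : A), h.left.acyclic M → ∀ n, m ≤ n + j → h.RVan n (ν.obj M) from
    fun n => H m M hM n (by omega)
  intro j
  induction j with
  | zero => exact fun M _ n hn => hm n hn _
  | succ j ih =>
    intro M hM n hn
    have hS := h.left.cover_shortExact M
    exact (h.rvan_shift (h.map_ν_shortExact hS (hM 0)) (h.coacyclic_I M) n).1
      (ih _ (h.left.acyclic_X₁ hS (h.left.acyclic_P M) hM) _ (by omega))

/-- By naturality it suffices that `ν'ν` maps the counit `ε` at `M` to an epimorphism, because the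
unit at `P M` is invertible. The obstruction is R¹ν'(νK), which vanishes as νK is coacyclic. -/
lemma epi_unit (hr : ∃ m, ∀ n, m ≤ n → ∀ M, h.RVan n M) {M : A}
    (hM : h.left.acyclic M) : Epi (h.adj.unit.app M) := by
  have hS := h.left.cover_shortExact M
  have hK := h.coacyclic_map_ν hr (h.left.acyclic_X₁ hS (h.left.acyclic_P M) hM) 0
  have : Epi (ν'.map (ν.map (h.ε.app M))) :=
    (h.rvan_zero_iff_epi (h.map_ν_shortExact hS (hM 0)) (h.coacyclic_I M)).1 hK
  have e := h.adj.unit.naturality (h.ε.app M)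
  have : Epi (h.ε.app M ≫ h.adj.unit.app M) := by
    dsimp at e
    rw [e]
    infer_instance
  exact epi_of_epi (h.ε.app M) _

/-- Four lemma for the unit on 0 → K → P M → M → 0: it is invertible in the middle and epi at K,
hence mono at M. -/
lemma isIso_unit_app (hr : ∃ m, ∀ n, m ≤ n → ∀ M, h.RVan n M) {M : A}
    (hM : h.left.acyclic M) : IsIso (h.adj.unit.app M) := by
  have hS := h.left.cover_shortExact M
  have hK := h.left.acyclic_X₁ hS (h.left.acyclic_P M) hM
  have hT := h.map_ν_shortExact hS (hM 0)
  have hU := h.map_ν'_shortExact hT (h.coacyclic_map_ν hr hK 0)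
  let φ : h.left.cover M ⟶ ShortComplex.mk (ν'.map (ν.map (h.left.ι.app M)))
      (ν'.map (ν.map (h.left.ε.app M)))
      (by rw [← ν'.map_comp, h.left.map_ι_ε, ν'.map_zero]) :=
    { τ₁ := h.adj.unit.app _
      τ₂ := h.adj.unit.app _
      τ₃ := h.adj.unit.app _
      comm₁₂ := (h.adj.unit.naturality (h.left.ι.app M)).symm
      comm₂₃ := (h.adj.unit.naturality (h.left.ε.app M)).symm }
  have := h.isIso_unit M
  have hmono : Mono (h.adj.unit.app M) :=
    ShortComplex.mono_of_epi_of_epi_of_mono φ hU.exact hS.epi_g (h.epi_unit hr hK)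
      (inferInstanceAs (Mono (h.adj.unit.app (P.obj M))))
  have := h.epi_unit hr hM
  exact isIso_of_mono_of_epi _

lemma isIso_counit_I (M : A) : IsIso (h.adj.counit.app (ν.obj (P.obj M))) := by
  have := h.adj.left_triangle_components (P.obj M)
  have := h.isIso_unit M
  exact IsIso.of_isIso_fac_left (h.adj.left_triangle_components (P.obj M))

/-- The cokernel of `η`. -/
abbrev cocover (M : A) : ShortComplex A :=
  ShortComplex.mk (h.η.app M) (cokernel.π (h.η.app M)) (cokernel.condition _)

lemma cocover_shortExact (M : A) : (h.cocover M).ShortExact where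
  exact := (h.cocover M).exact_of_g_is_cokernel (cokernelIsCokernel _)
  mono_f := h.mono M
  epi_g := inferInstanceAs (Epi (cokernel.π _))

/-- The mirror image of `coacyclic_map_ν`, shifting along 0 → M → I M → coker → 0; the middle term
becomes acyclic because `ν'` carries `I M` back to `P M`. -/
lemma acyclic_map_ν' (hl : ∃ m, ∀ n, m ≤ n → ∀ M, h.LVan n M) {M : A}
    (hM : h.coacyclic M) : h.left.acyclic (ν'.obj M) := by
  obtain ⟨m, hm⟩ := hl
  suffices H : ∀ (j : ℕ) (M : A), h.coacyclic M → ∀ n, m ≤ n + j → h.LVan n (ν'.obj M) from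
    fun n => H m M hM n (by omega)
  intro j
  induction j with
  | zero => exact fun M _ n hn => hm n hn _
  | succ j ih =>
    intro M hM n hn
    have hS := h.cocover_shortExact M
    have hI : h.left.acyclic (ν'.obj ((P ⋙ ν).obj M)) :=
      h.left.acyclic_of_iso (h.isoP.app M).symm (h.left.acyclic_P M)
    exact (h.left.lvan_shift (h.map_ν'_shortExact hS (hM 0)) hI n).1
      (ih _ (h.coacyclic_X₃ hS hM (h.coacyclic_I M)) _ (by omega))

lemma mono_counit (hl : ∃ m, ∀ n, m ≤ n → ∀ M, h.LVan n M) {M : A}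
    (hM : h.coacyclic M) : Mono (h.adj.counit.app M) := by
  have hS := h.cocover_shortExact M
  have hI : h.left.acyclic (ν'.obj ((P ⋙ ν).obj M)) :=
    h.left.acyclic_of_iso (h.isoP.app M).symm (h.left.acyclic_P M)
  have hK := h.acyclic_map_ν' hl (h.coacyclic_X₃ hS hM (h.coacyclic_I M)) 0
  have hm : Mono (ν.map (ν'.map (h.η.app M))) :=
    (h.left.lvan_zero_iff_mono (h.map_ν'_shortExact hS (hM 0)) hI).1 hK
  have e := h.adj.counit.naturality (h.η.app M)
  have := h.isIso_counit_I M
  have : Mono (h.adj.counit.app M ≫ h.η.app M) := by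
    dsimp at e
    rw [← e]
    exact mono_comp' hm (inferInstanceAs (Mono (h.adj.counit.app (ν.obj (P.obj M)))))
  exact mono_of_mono _ (h.η.app M)

lemma isIso_counit_app (hl : ∃ m, ∀ n, m ≤ n → ∀ M, h.LVan n M) {M : A}
    (hM : h.coacyclic M) : IsIso (h.adj.counit.app M) := by
  have hS := h.cocover_shortExact M
  have hC := h.coacyclic_X₃ hS hM (h.coacyclic_I M)
  have hT := h.map_ν'_shortExact hS (hM 0)
  have hU := h.map_ν_shortExact hT (h.acyclic_map_ν' hl hC 0)
  let φ : ShortComplex.mk (ν.map (ν'.map (h.η.app M))) (ν.map (ν'.map (cokernel.π (h.η.app M))))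
      (by rw [← ν.map_comp, ← ν'.map_comp, cokernel.condition, ν'.map_zero, ν.map_zero]) ⟶
      h.cocover M :=
    { τ₁ := h.adj.counit.app _
      τ₂ := h.adj.counit.app _
      τ₃ := h.adj.counit.app _
      comm₁₂ := (h.adj.counit.naturality (h.η.app M)).symm
      comm₂₃ := (h.adj.counit.naturality (cokernel.π (h.η.app M))).symm }
  have := h.isIso_counit_I M
  have hepi : Epi (h.adj.counit.app M) :=
    ShortComplex.epi_of_mono_of_epi_of_mono φ hU.exact hS.mono_f
      (inferInstanceAs (Epi (h.adj.counit.app (ν.obj (P.obj M))))) (h.mono_counit hl hC)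
  have := h.mono_counit hl hM
  exact isIso_of_mono_of_epi _

end NakayamaData

end Gorenstein

/-! ### Gorenstein objects are the acyclic ones, and the Gorenstein dimension -/

section Gorenstein

variable {A : Type w} [Category.{v} A] [Abelian A]

/-- The exact sequences `0 ⟶ M' ⟶ Q ⟶ M ⟶ 0` with `Q` a summand of some `X.obj N` that `F` leaves
exact. -/
def IsStep (X F : A ⥤ A) [F.Additive] (M' M : A) : Prop :=
  ∃ (Q : A) (f : M' ⟶ Q) (g : Q ⟶ M) (w : f ≫ g = 0), (ShortComplex.mk f g w).ShortExact ∧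
    summandsOfImage X Q ∧
    (ShortComplex.mk (F.map f) (F.map g) (by rw [← F.map_comp, w, F.map_zero])).ShortExact

/-- The kernel of a differential of a complex that is spliced from short exact sequences. -/
def kernelIsoOfSeq {Q₁ Q₀ G₁ G₂ : A} {d : Q₁ ⟶ Q₀} (f : G₂ ⟶ Q₁) (g : Q₁ ⟶ G₁) (w : f ≫ g = 0)
    (h : (ShortComplex.mk f g w).ShortExact) (f' : G₁ ⟶ Q₀) (hf' : Mono f') (hd : d = g ≫ f') :
    G₂ ≅ kernel d :=
  have := h.mono_f
  (isKernelCompMono h.exact.fIsKernel f' hd).conePointUniqueUpToIso (limit.isLimit _)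

/-- The kernel of a differential of an acyclic complex, as the cokernel of another one. -/
def chainCokerIsoKernel {K : ChainComplex A ℤ} (hK : K.Acyclic) {m l : ℤ} (hl : m + 1 = l) :
    chainCoker K (l + 1) ≅ kernel (K.d l m) := by
  subst hl
  exact kernelIsoOfSeq _ _ _ (chainCoker_shortExact K (m + 1) (hK _)) (chainCokerDesc K m)
    (chainCoker_shortExact K m (hK _)).mono_f (by simp)

lemma exists_isStep_seq {X F : A ⥤ A} [F.Additive] {T : ObjectProperty A}
    (hl : ∀ M, T M → ∃ M', T M' ∧ IsStep X F M' M) (hr : ∀ M, T M → ∃ M', T M' ∧ IsStep X F M M')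
    {M : A} (hM : T M) : ∃ G : ℤ → A, G 1 = M ∧ ∀ n, IsStep X F (G (n + 1)) (G n) := by
  choose L hL hL' using fun M : Subtype T => hl M.1 M.2
  choose R hR hR' using fun M : Subtype T => hr M.1 M.2
  let l : ℕ → Subtype T := fun n => Nat.rec ⟨M, hM⟩ (fun _ N => ⟨L N, hL N⟩) n
  let r : ℕ → Subtype T := fun n => Nat.rec ⟨M, hM⟩ (fun _ N => ⟨R N, hR N⟩) n
  -- The sequences read 0 → G (n+1) → Q n → G n → 0, so the kernel of Q₀ → Q₋₁ is `G 1`. Hence `M`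
  -- sits at index 1, `l` fills the larger indices and `r` fills 0 and the negative ones.
  refine ⟨fun n => match n with
    | .ofNat 0 => (r 1).1
    | .ofNat (n + 1) => (l n).1
    | .negSucc n => (r (n + 2)).1, rfl, fun n => ?_⟩
  match n with
  | .ofNat 0 => exact hR' ⟨M, hM⟩
  | .ofNat (n + 1) => exact hL' (l n)
  | .negSucc 0 => exact hR' (r 1)
  | .negSucc (n + 1) => exact hR' (r (n + 2))

lemma totallyAcyclicKernels_of_steps {X F : A ⥤ A} [F.Additive] {T : ObjectProperty A}
    (hl : ∀ M, T M → ∃ M', T M' ∧ IsStep X F M' M) (hr : ∀ M, T M → ∃ M', T M' ∧ IsStep X F M M')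
    {M : A} (hM : T M) : totallyAcyclicKernels X F M := by
  obtain ⟨G, rfl, hG⟩ := exists_isStep_seq hl hr hM
  choose Q f g w h hQ hF using hG
  refine ⟨chainOfSeq f g w, hQ, fun i => ?_, fun i => ?_, ?_⟩
  · obtain ⟨n, rfl⟩ : ∃ n, i = n + 1 := ⟨i - 1, by omega⟩
    exact chainOfSeq_exactAt f g w h n
  · obtain ⟨n, rfl⟩ : ∃ n, i = n + 1 := ⟨i - 1, by omega⟩
    rw [chain_exactAt_succ_iff']
    have : Epi (F.map (g (n + 1 + 1))) := (hF _).epi_g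
    have : Mono (F.map (f n)) := (hF _).mono_f
    have e (n : ℤ) : F.map ((chainOfSeq f g w).d (n + 1) n) = F.map (g (n + 1)) ≫ F.map (f n) := by
      rw [chainOfSeq_d, F.map_comp]
    exact exact_congr (splice_exact (F.map (g (n + 1 + 1))) (F.map (f n)) (hF (n + 1)).exact
      (by rw [Category.assoc, ← F.map_comp_assoc (f _), w, F.map_zero, zero_comp, comp_zero]))
      (e _) (e _) _
  · suffices H : ∀ m l n : ℤ, m + 1 = l → l + 1 = n →
        Nonempty (G n ≅ kernel ((chainOfSeq f g w).d l m)) from H _ _ _ (by rfl) (by rfl)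
    rintro m _ _ rfl rfl
    exact ⟨kernelIsoOfSeq (f (m + 1)) (g (m + 1)) (w _) (h _) (f m) (h m).mono_f
      (chainOfSeq_d f g w m)⟩

namespace NakayamaData

variable {P ν ν' : A ⥤ A} (h : NakayamaData P ν ν') [P.Additive] [ν.Additive] [ν'.Additive]

/-- Exactness of ν(Q) is the vanishing of L₁ν at every cokernel of the complex. As the complex never
ends, shifting to the next cokernel raises the degree, so the induction must treat all cokernels
together. -/
lemma acyclic_of_gorensteinProjective {M : A} (hM : gorensteinProjective P ν M) :
    h.left.acyclic M := by
  obtain ⟨Q, hQ, hK, hF, ⟨e⟩⟩ := hM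
  refine h.left.acyclic_of_iso (e ≪≫ (chainCokerIsoKernel hK (by rfl)).symm) fun j => ?_
  suffices H : ∀ n, h.LVan j (chainCoker Q n) from H _
  induction j with
  | zero =>
    intro n
    refine (h.left.lvan_zero_iff_mono (chainCoker_shortExact Q n (hK _))
      (h.left.acyclic_of_summandsOfImage (hQ n))).2 ?_
    exact (chain_map_exactAt_succ_iff ν h.left.rightExact Q n).1 (hF _)
  | succ j ih =>
    intro n
    exact (h.left.lvan_shift (chainCoker_shortExact Q n (hK _))
      (h.left.acyclic_of_summandsOfImage (hQ n)) j).2 (ih _)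

omit [P.Additive] [ν.Additive] in
include h in
-- The left exact functor `ν'` keeps the cokernel embedded in the next term. What it maps to there
-- is a cycle of `ν'(J)`, and exactness of that complex lifts it.
lemma epi_map_chainCoker {J : ChainComplex A ℤ}
    (hF : ((ν'.mapHomologicalComplex _).obj J).Acyclic) (hK : J.Acyclic) (m : ℤ) :
    Epi (ν'.map (cokernel.π (J.d (m + 1 + 1 + 1) (m + 1 + 1)))) := by
  have := h.preservesFiniteLimits_ν'
  have := (chainCoker_shortExact J (m + 1) (hK _)).mono_f
  rw [epi_iff_surjective_up_to_refinements]
  intro B x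
  have hE := (chain_exactAt_succ_iff' _ _).1 (hF (m + 1))
  obtain ⟨B', π, hπ, z, hz⟩ := hE.exact_up_to_refinements
    (x ≫ ν'.map (chainCokerDesc J (m + 1))) (by
      change (x ≫ ν'.map (chainCokerDesc J (m + 1))) ≫ ν'.map (J.d (m + 1) m) = 0
      rw [Category.assoc, ← ν'.map_comp]
      have : chainCokerDesc J (m + 1) ≫ J.d (m + 1) m = 0 := by
        rw [← cancel_epi (cokernel.π _)]
        simp
      rw [this, ν'.map_zero, comp_zero])
  refine ⟨B', π, hπ, z, ?_⟩
  change π ≫ x ≫ ν'.map (chainCokerDesc J (m + 1)) = z ≫ ν'.map (J.d (m + 1 + 1) (m + 1)) at hz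
  change B' ⟶ ν'.obj (J.X (m + 1 + 1)) at z
  have e : ν'.map (J.d (m + 1 + 1) (m + 1)) =
      ν'.map (cokernel.π (J.d (m + 1 + 1 + 1) (m + 1 + 1))) ≫ ν'.map (chainCokerDesc J (m + 1)) := by
    rw [← ν'.map_comp, cokernel.π_desc]
  exact (cancel_mono (ν'.map (chainCokerDesc J (m + 1)))).1
    ((Category.assoc _ _ _).trans (hz.trans ((congrArg (z ≫ ·) e).trans (Category.assoc _ _ _).symm)))

lemma coacyclic_of_gorensteinInjective {M : A} (hM : gorensteinInjective P ν ν' M) :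
    h.coacyclic M := by
  obtain ⟨J, hJ, hK, hF, ⟨e⟩⟩ := hM
  intro j
  refine h.rvan_of_iso (e ≪≫ (chainCokerIsoKernel hK (by rfl)).symm) ?_
  suffices H : ∀ n, h.RVan j (chainCoker J n) from H _
  induction j with
  | zero =>
    intro n
    obtain ⟨m, rfl⟩ : ∃ m, n = m + 1 + 1 + 1 := ⟨n - 3, by omega⟩
    exact (h.rvan_zero_iff_epi (chainCoker_shortExact J (m + 1 + 1) (hK _))
      (h.coacyclic_of_summandsOfImage (hJ _))).2 (h.epi_map_chainCoker hF hK m)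
  | succ j ih =>
    intro n
    obtain ⟨m, rfl⟩ : ∃ m, n = m + 1 := ⟨n - 1, by omega⟩
    exact (h.rvan_shift (chainCoker_shortExact J m (hK _))
      (h.coacyclic_of_summandsOfImage (hJ _)) j).2 (ih _)

lemma isStep_left {M : A} (hM : h.left.acyclic M) :
    ∃ M', h.left.acyclic M' ∧ IsStep P ν M' M :=
  have hS := h.left.cover_shortExact M
  ⟨_, h.left.acyclic_X₁ hS (h.left.acyclic_P M) hM, _, _, _, _, hS,
    LeftAdapted.summandsOfImage_obj P M, h.map_ν_shortExact hS (hM 0)⟩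

/-- The object embeds as M ≅ ν'νM → ν'I(νM) ≅ P(νM). Under `ν` this embedding becomes `η` at νM,
which is mono, so L₁ν of the cokernel vanishes and the cokernel is acyclic. -/
lemma isStep_right (hr : ∃ m, ∀ n, m ≤ n → ∀ M, h.RVan n M) {M : A} (hM : h.left.acyclic M) :
    ∃ M', h.left.acyclic M' ∧ IsStep P ν M M' := by
  have := h.preservesFiniteLimits_ν'
  have := h.isIso_unit_app hr hM
  let f : M ⟶ P.obj (ν.obj M) :=
    h.adj.unit.app M ≫ ν'.map (h.η.app (ν.obj M)) ≫ inv (h.adj.unit.app (P.obj (ν.obj M)))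
  have hf : Mono f := mono_comp' inferInstance (mono_comp' inferInstance inferInstance)
  -- The two morphisms are compared through their adjoint transposes.
  have hνf : ν.map f = h.η.app (ν.obj M) := by
    apply (h.adj.homEquiv _ _).injective
    rw [Adjunction.homEquiv_unit, Adjunction.homEquiv_unit]
    refine (h.adj.unit.naturality f).symm.trans ?_
    simp [f]
  have hS : (ShortComplex.mk f (cokernel.π f) (cokernel.condition f)).ShortExact :=
    { exact := ShortComplex.exact_cokernel f
      mono_f := hf
      epi_g := inferInstanceAs (Epi (cokernel.π f)) }
  have hP := h.left.acyclic_P (ν.obj M)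
  have hM' : h.left.acyclic (cokernel f) := fun n => by
    cases n with
    | zero =>
      refine (h.left.lvan_zero_iff_mono hS hP).2 ?_
      change Mono (ν.map f)
      rw [hνf]
      infer_instance
    | succ n => exact (h.left.lvan_shift hS hP n).2 (hM n)
  exact ⟨_, hM', _, _, _, _, hS, LeftAdapted.summandsOfImage_obj P _,
    h.map_ν_shortExact hS (hM' 0)⟩

lemma isStep_right' {M : A} (hM : h.coacyclic M) :
    ∃ M', h.coacyclic M' ∧ IsStep (P ⋙ ν) ν' M M' :=
  have hS := h.cocover_shortExact M
  ⟨_, h.coacyclic_X₃ hS hM (h.coacyclic_I M), _, _, _, _, hS,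
    LeftAdapted.summandsOfImage_obj (P ⋙ ν) M, h.map_ν'_shortExact hS (hM 0)⟩

/-- Dually, I(ν'M) = νPν'M → νν'M ≅ M is an epimorphism. It remains one under `ν'`, because up to
the unit it becomes `ε` at ν'M. -/
lemma isStep_left' (hl : ∃ m, ∀ n, m ≤ n → ∀ M, h.LVan n M) {M : A} (hM : h.coacyclic M) :
    ∃ M', h.coacyclic M' ∧ IsStep (P ⋙ ν) ν' M' M := by
  have := h.preservesFiniteColimits_ν
  have := h.isIso_counit_app hl hM
  let g : ν.obj (P.obj (ν'.obj M)) ⟶ M := ν.map (h.ε.app (ν'.obj M)) ≫ h.adj.counit.app M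
  have hg : Epi g := epi_comp' inferInstance inferInstance
  have hνg : h.adj.unit.app (P.obj (ν'.obj M)) ≫ ν'.map g = h.ε.app (ν'.obj M) := by
    have e := h.adj.unit.naturality (h.ε.app (ν'.obj M))
    dsimp at e
    rw [ν'.map_comp, ← reassoc_of% e, h.adj.right_triangle_components]
    exact Category.comp_id _
  have hνg' : Epi (ν'.map g) := by
    have : Epi (h.adj.unit.app (P.obj (ν'.obj M)) ≫ ν'.map g) := by
      rw [hνg]
      exact h.epi _
    exact epi_of_epi (h.adj.unit.app (P.obj (ν'.obj M))) _
  have hS : (ShortComplex.mk (kernel.ι g) g (kernel.condition g)).ShortExact :=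
    { exact := ShortComplex.exact_kernel g
      mono_f := inferInstanceAs (Mono (kernel.ι g))
      epi_g := hg }
  have hI := h.coacyclic_I (ν'.obj M)
  have hM' : h.coacyclic (kernel g) := fun n => by
    cases n with
    | zero => exact (h.rvan_zero_iff_epi hS hI).2 hνg'
    | succ n => exact (h.rvan_shift hS hI n).2 (hM n)
  exact ⟨_, hM', _, _, _, _, hS, LeftAdapted.summandsOfImage_obj (P ⋙ ν) _,
    h.map_ν'_shortExact hS (hM' 0)⟩

lemma gorensteinProjective_eq (hr : ∃ m, ∀ n, m ≤ n → ∀ M, h.RVan n M) :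
    gorensteinProjective P ν = h.left.acyclic := by
  ext M
  exact ⟨h.acyclic_of_gorensteinProjective, totallyAcyclicKernels_of_steps
    (fun _ => h.isStep_left) fun _ => h.isStep_right hr⟩

lemma gorensteinInjective_eq (hl : ∃ m, ∀ n, m ≤ n → ∀ M, h.LVan n M) :
    gorensteinInjective P ν ν' = h.coacyclic := by
  ext M
  exact ⟨h.coacyclic_of_gorensteinInjective, totallyAcyclicKernels_of_steps
    (fun _ => h.isStep_left' hl) fun _ => h.isStep_right'⟩

end NakayamaData

/-- A resolution in the opposite category. -/
def LeftSeq.unop {M : A} (s : LeftSeq (op M)) : RightSeq M where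
  G n := (s.G n).unop
  Q n := (s.Q n).unop
  f n := (s.g n).unop
  g n := (s.f n).unop
  w n := Quiver.Hom.op_inj (s.w n)
  shortExact n := (s.shortExact n).unop
  iso := s.iso.unop.symm

/-- A coresolution, as a resolution in the opposite category. -/
def RightSeq.op {M : A} (s : RightSeq M) : LeftSeq (op M) where
  G n := .op (s.G n)
  Q n := .op (s.Q n)
  f n := (s.g n).op
  g n := (s.f n).op
  w n := Quiver.Hom.unop_inj (s.w n)
  shortExact n := (s.shortExact n).op
  iso := s.iso.op.symm

namespace NakayamaData

variable {P ν ν' : A ⥤ A} (h : NakayamaData P ν ν') [P.Additive] [ν.Additive] [ν'.Additive]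

lemma coresolution_exactAt_iff {X : ObjectProperty A} (hX : ∀ M, X M → h.coacyclic M) {M : A}
    (R : RightResolution X M) (n : ℕ) :
    ((ν'.mapHomologicalComplex _).obj R.complex).ExactAt (n + 1) ↔ h.RVan n M := by
  rw [cochain_map_exactAt_succ_iff ν' h.preservesFiniteLimits_ν']
  refine Iff.trans ?_ (h.right.mono_map_seq_iff R.seq.op (fun n => hX _ (R.prop n)) n)
  exact (op_mono_iff (ν'.map (R.seq.g n))).symm

lemma rightDerivedVanishes_iff (n : ℕ) (M : A) :
    RightDerivedVanishes P ν ν' (n + 1) M ↔ h.RVan n M := by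
  refine ⟨fun hM => ?_, fun hM R => ?_⟩
  · rw [← h.coresolution_exactAt_iff (fun _ => h.coacyclic_of_summandsOfImage)]
    exact hM ((h.right.standardSeq (op M)).unop.coresolution
      fun n => LeftAdapted.summandsOfImage_obj (P ⋙ ν) _)
  · exact (h.coresolution_exactAt_iff (fun _ => h.coacyclic_of_summandsOfImage) R n).2 hM

lemma coresolutionDim_coacyclic_le_iff (M : A) (s : ℕ) :
    coresolutionDim h.coacyclic M ≤ s ↔ ∀ n, s ≤ n → h.RVan n M := by
  rw [coresolutionDim, iInf_natCast_le_iff]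
  refine ⟨fun ⟨m, hm, R, hR⟩ n hn =>
    h.right.lvan_of_isZero_seq R.seq.op R.prop (fun i hi => (hR i hi).op) (hm.trans hn),
    fun hM => ⟨s, le_rfl, (h.right.truncatedSeq (op M) s).unop.coresolution
      (h.right.acyclic_truncatedSeq hM), fun i hi => (h.right.isZero_truncatedSeq (op M) hi).unop⟩⟩

lemma isLeast_iff_of_succ {p : ℕ → Prop} {q : ℕ → Prop} (hpq : ∀ i, q (i + 1) ↔ p i) (s : ℕ) :
    (∀ i, s < i → q i) ↔ ∀ i, s ≤ i → p i :=
  ⟨fun H i hi => (hpq i).1 (H _ (by omega)), fun H i hi => by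
    obtain ⟨j, rfl⟩ : ∃ j, i = j + 1 := ⟨i - 1, by omega⟩
    exact (hpq j).2 (H j (by omega))⟩

/-- All four numbers are the least degree beyond which the derived functors vanish, once the
Gorenstein objects are identified with the acyclic and coacyclic ones. -/
lemma hasGorensteinDimension {n : ℕ}
    (hl : IsLeast {s : ℕ | ∀ i, s ≤ i → ∀ M, h.LVan i M} n)
    (hr : IsLeast {s : ℕ | ∀ i, s ≤ i → ∀ M, h.RVan i M} n) :
    HasGorensteinDimension P ν ν' n := by
  have el (s : ℕ) : (∀ (M : A) (i : ℕ), s < i → LeftDerivedVanishes P ν i M) ↔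
      ∀ i, s ≤ i → ∀ M, h.LVan i M :=
    (forall_congr' fun M => isLeast_iff_of_succ
      (fun i => h.left.leftDerivedVanishes_iff i M) s).trans (by tauto)
  have er (s : ℕ) : (∀ (M : A) (i : ℕ), s < i → RightDerivedVanishes P ν ν' i M) ↔
      ∀ i, s ≤ i → ∀ M, h.RVan i M :=
    (forall_congr' fun M => isLeast_iff_of_succ
      (fun i => h.rightDerivedVanishes_iff i M) s).trans (by tauto)
  refine ⟨fun M => ⟨M, h.ε.app M, h.epi M⟩, ⟨h.adj, ⟨h.adjP⟩, h.isIso_unit⟩, ⟨n, ?_⟩, ?_, ?_, ?_, ?_⟩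
  · exact fun M i hi => ⟨(el n).2 hl.1 M i hi, (er n).2 hr.1 M i hi⟩
  · rw [h.gorensteinProjective_eq ⟨n, hr.1⟩]
    refine iSup_eq_natCast_of_isLeast _ ?_
    simp only [h.left.resolutionDim_acyclic_le_iff]
    convert hl using 3
    tauto
  · rw [h.gorensteinInjective_eq ⟨n, hl.1⟩]
    refine iSup_eq_natCast_of_isLeast _ ?_
    simp only [h.coresolutionDim_coacyclic_le_iff]
    convert hr using 3
    tauto
  · simp only [el]
    exact hl
  · simp only [er]
    exact hr

end NakayamaData

end Gorenstein

/-! ### Left vanishing bounds right vanishing -/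

section Bound

variable {A : Type w} [Category.{v} A] [Abelian A]

section Pullback

variable {X₁ X₂ X₃ : A} {f : X₁ ⟶ X₂} {g : X₂ ⟶ X₃} {w : f ≫ g = 0}

/-- The pullback of a short exact sequence along a morphism to its third term. -/
lemma shortExact_pullback (hS : (ShortComplex.mk f g w).ShortExact) {Y : A} (y : Y ⟶ X₃) :
    (ShortComplex.mk (pullback.lift f (0 : X₁ ⟶ Y) (by rw [w, zero_comp])) (pullback.snd g y)
      (pullback.lift_snd _ _ _)).ShortExact where
  exact := by
    have : Mono f := hS.mono_f
    rw [ShortComplex.exact_iff_exact_up_to_refinements]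
    intro B x hx
    change B ⟶ pullback g y at x
    change x ≫ pullback.snd g y = 0 at hx
    have hx' : (x ≫ pullback.fst g y) ≫ g = 0 := by
      rw [Category.assoc, pullback.condition, reassoc_of% hx, zero_comp]
    have e : hS.exact.lift _ hx' ≫ f = _ := hS.exact.lift_f _ hx'
    refine ⟨B, 𝟙 B, inferInstance, hS.exact.lift _ hx', ?_⟩
    refine (Category.id_comp x).trans (pullback.hom_ext ?_ ?_)
    · exact ((Category.assoc _ _ _).trans ((congrArg (_ ≫ ·) (pullback.lift_fst _ _ _)).trans e)).symm
    · exact hx.trans ((Category.assoc _ _ _).trans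
        ((congrArg (_ ≫ ·) (pullback.lift_snd _ _ _)).trans comp_zero)).symm
  mono_f := by
    have : Mono f := hS.mono_f
    have : Mono (pullback.lift f (0 : X₁ ⟶ Y) (by rw [w, zero_comp]) ≫ pullback.fst g y) := by
      rw [pullback.lift_fst]
      infer_instance
    exact mono_of_mono _ (pullback.fst g y)
  epi_g := by
    have : Epi g := hS.epi_g
    exact inferInstanceAs (Epi (pullback.snd g y))

lemma shortExact_pullback' (hS : (ShortComplex.mk f g w).ShortExact) {Y : A} (y : Y ⟶ X₃) :
    (ShortComplex.mk (pullback.lift (0 : X₁ ⟶ Y) f (by rw [w, zero_comp])) (pullback.fst y g)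
      (pullback.lift_fst _ _ _)).ShortExact := by
  have e : pullback.lift f (0 : X₁ ⟶ Y) (by rw [w, zero_comp]) ≫ (pullbackSymmetry g y).hom =
      pullback.lift (0 : X₁ ⟶ Y) f (by rw [w, zero_comp]) := by
    apply pullback.hom_ext
    · rw [Category.assoc, pullbackSymmetry_hom_comp_fst]
      exact (pullback.lift_snd _ _ _).trans (pullback.lift_fst _ _ _).symm
    · rw [Category.assoc, pullbackSymmetry_hom_comp_snd]
      exact (pullback.lift_fst _ _ _).trans (pullback.lift_snd _ _ _).symm
  refine ShortComplex.shortExact_of_iso ?_ (shortExact_pullback hS y)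
  refine ShortComplex.isoMk (Iso.refl X₁) (pullbackSymmetry g y) (Iso.refl Y) ?_ ?_
  · exact (Category.id_comp _).trans e.symm
  · exact (pullbackSymmetry_hom_comp_fst g y).trans (Category.comp_id _).symm

lemma exists_retraction [Projective X₃] (hS : (ShortComplex.mk f g w).ShortExact) :
    ∃ r : X₂ ⟶ X₁, f ≫ r = 𝟙 X₁ :=
  have : Projective (ShortComplex.mk f g w).X₃ := ‹Projective X₃›
  ⟨_, hS.splittingOfProjective.f_r⟩

lemma shortExact_pullback_epi (hS : (ShortComplex.mk f g w).ShortExact) {Y : A} (y : Y ⟶ X₂)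
    (hy : Epi y) : (ShortComplex.mk (pullback.snd f y) (y ≫ g)
      (by rw [← Category.assoc, ← pullback.condition, Category.assoc, w, comp_zero])).ShortExact where
  exact := by
    have : Mono f := hS.mono_f
    rw [ShortComplex.exact_iff_exact_up_to_refinements]
    intro B x hx
    change B ⟶ Y at x
    have hx' : (x ≫ y) ≫ g = 0 := (Category.assoc _ _ _).trans hx
    have e : hS.exact.lift _ hx' ≫ f = _ := hS.exact.lift_f _ hx'
    refine ⟨B, 𝟙 B, inferInstance, pullback.lift (hS.exact.lift _ hx') x e, ?_⟩
    exact (Category.id_comp _).trans (pullback.lift_snd _ _ _).symm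
  mono_f := by
    have : Mono f := hS.mono_f
    exact inferInstanceAs (Mono (pullback.snd f y))
  epi_g := by
    have : Epi g := hS.epi_g
    exact inferInstanceAs (Epi (y ≫ g))

end Pullback

namespace NakayamaData

variable {P ν ν' : A ⥤ A} (h : NakayamaData P ν ν')

include h in
-- By adjunction, maps out of νX are maps out of the projective object `X` into ν' of the target.
lemma exists_lift_ν {X W W' : A} [Projective X] (p : W ⟶ W') (hp : Epi (ν'.map p))
    (y : ν.obj X ⟶ W') : ∃ z, z ≫ p = y := by
  refine ⟨(h.adj.homEquiv _ _).symm (Projective.factorThru (h.adj.homEquiv _ _ y) (ν'.map p)), ?_⟩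
  rw [← Adjunction.homEquiv_naturality_right_symm, Projective.factorThru_comp,
    Equiv.symm_apply_apply]

include h in
-- Hom(PνX, E) = Hom(νX, I E) = Hom(X, ν'I E) = Hom(X, P E), and `P` is exact.
lemma projective_P_ν {X : A} (hX : Projective X) : Projective (P.obj (ν.obj X)) where
  factors {E B} x e he := by
    have := h.preservesFiniteColimits_P
    have hp : Epi (ν'.map ((P ⋙ ν).map e)) := by
      have e₁ := h.isoP.hom.naturality e
      have : Epi (h.isoP.hom.app E ≫ ((P ⋙ ν) ⋙ ν').map e) := by
        rw [← e₁]
        exact epi_comp' (inferInstanceAs (Epi (P.map e)))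
          (inferInstanceAs (Epi (h.isoP.hom.app B)))
      exact @epi_of_epi _ _ _ _ _ (h.isoP.hom.app E) _ this
    obtain ⟨z, hz⟩ := h.exists_lift_ν ((P ⋙ ν).map e) hp (h.adjP.homEquiv _ _ x)
    refine ⟨(h.adjP.homEquiv _ _).symm z, ?_⟩
    rw [← Adjunction.homEquiv_naturality_right_symm, hz, Equiv.symm_apply_apply]

variable [P.Additive] [ν.Additive] [ν'.Additive]

include h in
lemma map_P_shortExact {X₁ X₂ X₃ : A} {f : X₁ ⟶ X₂} {g : X₂ ⟶ X₃} {w : f ≫ g = 0}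
    (hS : (ShortComplex.mk f g w).ShortExact) :
    (ShortComplex.mk (P.map f) (P.map g) (by rw [← P.map_comp, w, P.map_zero])).ShortExact :=
  h.left.exact hS

lemma acyclic_of_projective {X : A} (hX : Projective X) : h.left.acyclic X :=
  h.left.acyclic_of_summandsOfImage
    ⟨X, ⟨⟨Projective.factorThru (𝟙 X) (h.ε.app X), h.ε.app X, Projective.factorThru_comp _ _⟩⟩⟩

section FullyFaithful

variable (hr : ∃ m, ∀ n, m ≤ n → ∀ M, h.RVan n M)

include hr

/-- Only the unit at the target must be invertible, so `ν` is fully faithful on maps into acyclic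
objects from arbitrary ones. -/
lemma exists_map_ν_eq {X N : A} (hN : h.left.acyclic N) (y : ν.obj X ⟶ ν.obj N) :
    ∃ z, ν.map z = y := by
  have := h.isIso_unit_app hr hN
  refine ⟨h.adj.unit.app X ≫ ν'.map y ≫ inv (h.adj.unit.app N), ?_⟩
  apply (h.adj.homEquiv _ _).injective
  rw [Adjunction.homEquiv_unit, Adjunction.homEquiv_unit]
  refine (h.adj.unit.naturality _).symm.trans ?_
  simp

lemma eq_of_map_ν_eq {X N : A} (hN : h.left.acyclic N) {y z : X ⟶ N} (e : ν.map y = ν.map z) :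
    y = z := by
  have := h.isIso_unit_app hr hN
  rw [← cancel_mono (h.adj.unit.app N)]
  exact (h.adj.unit.naturality y).trans ((congrArg (fun x => h.adj.unit.app X ≫ ν'.map x) e).trans
    (h.adj.unit.naturality z).symm)

end FullyFaithful

/-- A coresolution, cut into short exact sequences, by images under `ν` of projective objects,
except that in degree `0` the object is only acyclic. It is zero beyond degree `r`. -/
structure ProjSeq (r : ℕ) where
  T : ℕ → A
  Z : ℕ → A
  f : ∀ i, Z i ⟶ ν.obj (T i)
  e : ∀ i, ν.obj (T i) ⟶ Z (i + 1)
  w : ∀ i, f i ≫ e i = 0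
  shortExact : ∀ i, (ShortComplex.mk _ _ (w i)).ShortExact
  acyclic_zero : h.left.acyclic (T 0)
  projective : ∀ i, Projective (T (i + 1))
  isZero : ∀ i, r < i → IsZero (T i)

namespace ProjSeq

variable {h} {r : ℕ} (s : h.ProjSeq r)

lemma acyclic (i : ℕ) : h.left.acyclic (s.T i) := by
  cases i with
  | zero => exact s.acyclic_zero
  | succ i => exact h.acyclic_of_projective (s.projective i)

instance (i : ℕ) : Mono (s.f i) := (s.shortExact i).mono_f

instance (i : ℕ) : Epi (s.e i) := (s.shortExact i).epi_g

lemma isZero_Z {i : ℕ} (hi : r < i) : IsZero (s.Z i) := by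
  rw [IsZero.iff_id_eq_zero, ← cancel_mono (s.f i)]
  exact (ν.map_isZero (s.isZero i hi)).eq_of_tgt _ _

/-- Descending induction from the zero end of the sequence: each sequence splits after `P`, so
P(Z_{i+1}) is a summand of PνT_{i+1}. Index 0 is excluded because T₀ need not be projective. -/
lemma projective_P_Z (i : ℕ) : Projective (P.obj (s.Z (i + 1))) := by
  suffices H : ∀ k i, r ≤ i + k → Projective (P.obj (s.Z (i + 1))) from H r i (by omega)
  intro k
  induction k with
  | zero =>
    intro i hi
    have := P.map_isZero (s.isZero_Z (i := i + 1) (by omega))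
    exact ⟨fun _ _ _ => ⟨0, this.eq_of_src _ _⟩⟩
  | succ k ih =>
    intro i hi
    have := ih (i + 1) (by omega)
    have := h.projective_P_ν (s.projective i)
    obtain ⟨ρ, hρ⟩ := exists_retraction (h.map_P_shortExact (s.shortExact (i + 1)))
    exact (Retract.mk (P.map (s.f (i + 1))) ρ hρ).projective

/-- Maps to I(N) are maps out of `P` of the source, and `P` splits the sequence because P(Z_{i+1})
is projective. -/
lemma exists_extension_I (i : ℕ) {N : A} (x : s.Z i ⟶ (P ⋙ ν).obj N) :
    ∃ y, s.f i ≫ y = x := by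
  have := s.projective_P_Z i
  obtain ⟨ρ, hρ⟩ := exists_retraction (h.map_P_shortExact (s.shortExact i))
  refine ⟨h.adjP.homEquiv _ _ (ρ ≫ (h.adjP.homEquiv _ _).symm x), ?_⟩
  rw [← Adjunction.homEquiv_naturality_left, reassoc_of% hρ, Equiv.apply_symm_apply]

/-- Embed `W` in I(W) with cokernel W' and extend there. The defect is a map from Z_{i+1} to W',
which extends to νT_{i+1} by descending induction on `i`, as W' is again coacyclic. -/
lemma exists_extension (i : ℕ) {W : A} (hW : h.coacyclic W) (x : s.Z i ⟶ W) :
    ∃ y, s.f i ≫ y = x := by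
  suffices H : ∀ k i, r < i + k → ∀ {W : A} (hW : h.coacyclic W) (x : s.Z i ⟶ W),
    ∃ y, s.f i ≫ y = x from H (r + 1) i (by omega) hW x
  intro k
  induction k with
  | zero => exact fun i hi W hW x => ⟨0, (s.isZero_Z hi).eq_of_src _ _⟩
  | succ k ih =>
    intro i hi W hW x
    have hS := h.cocover_shortExact W
    obtain ⟨a, ha⟩ := s.exists_extension_I i (x ≫ h.η.app W)
    have hb' : s.f i ≫ a ≫ cokernel.π (h.η.app W) = 0 := by
      rw [reassoc_of% ha, cokernel.condition, comp_zero]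
    let b' : s.Z (i + 1) ⟶ cokernel (h.η.app W) := (s.shortExact i).exact.desc _ hb'
    have eb' : s.e i ≫ b' = a ≫ cokernel.π (h.η.app W) := (s.shortExact i).exact.g_desc _ hb'
    obtain ⟨b, hb⟩ := ih (i + 1) (by omega) (h.coacyclic_X₃ hS hW (h.coacyclic_I W)) b'
    have := s.projective i
    -- Since R¹ν'(W) = 0, the projection I(W) → W' stays epi under `ν'`, so `b` lifts. Subtracting
    -- the lift makes `a` land in `W` without changing it on `Z i`.
    obtain ⟨c, hc⟩ := h.exists_lift_ν (X := s.T (i + 1)) (cokernel.π (h.η.app W))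
      ((h.rvan_zero_iff_epi hS (h.coacyclic_I W)).1 (hW 0)) b
    have hd : (a - s.e i ≫ s.f (i + 1) ≫ c) ≫ cokernel.π (h.η.app W) = 0 := by
      rw [Preadditive.sub_comp, Category.assoc, Category.assoc, hc, hb, eb', sub_self]
    have : Mono (h.η.app W) := h.mono W
    have ed : hS.exact.lift _ hd ≫ h.η.app W = _ := hS.exact.lift_f _ hd
    refine ⟨hS.exact.lift _ hd, ?_⟩
    rw [← cancel_mono (h.η.app W)]
    refine (Category.assoc _ _ _).trans ((congrArg (s.f i ≫ ·) ed).trans ?_)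
    rw [Preadditive.comp_sub, reassoc_of% s.w i, zero_comp, sub_zero, ha]

lemma exists_d (hr : ∃ m, ∀ n, m ≤ n → ∀ M, h.RVan n M) : ∃ d : ∀ i, s.T i ⟶ s.T (i + 1),
    (∀ i, ν.map (d i) = s.e i ≫ s.f (i + 1)) ∧ ∀ i, d i ≫ d (i + 1) = 0 := by
  choose d hd using fun i => h.exists_map_ν_eq hr (s.acyclic (i + 1)) (s.e i ≫ s.f (i + 1))
  refine ⟨d, hd, fun i => h.eq_of_map_ν_eq hr (s.acyclic _) ?_⟩
  rw [ν.map_comp, hd, hd, ν.map_zero, Category.assoc, reassoc_of% s.w (i + 1), zero_comp,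
    comp_zero]

section

variable (hr : ∃ m, ∀ n, m ≤ n → ∀ M, h.RVan n M) {d : ∀ i, s.T i ⟶ s.T (i + 1)}
  (hd : ∀ i, ν.map (d i) = s.e i ≫ s.f (i + 1))

include hr hd

/-- After `ν` the map factors over Z_{j+2}. It extends from there to νT_{j+2} because νN is
coacyclic, and full faithfulness brings the factorisation back to T. -/
lemma exists_factor_of_acyclic (j : ℕ) {N : A} (hN : h.left.acyclic N) (g : s.T (j + 1) ⟶ N)
    (hg : d j ≫ g = 0) : ∃ g', d (j + 1) ≫ g' = g := by
  have hx : s.f (j + 1) ≫ ν.map g = 0 := by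
    rw [← cancel_epi (s.e j), ← Category.assoc, ← hd, ← ν.map_comp, hg, ν.map_zero, comp_zero]
  let x : s.Z (j + 1 + 1) ⟶ ν.obj N := (s.shortExact (j + 1)).exact.desc _ hx
  have ex : s.e (j + 1) ≫ x = ν.map g := (s.shortExact (j + 1)).exact.g_desc _ hx
  obtain ⟨y, hy⟩ := s.exists_extension _ (h.coacyclic_map_ν hr hN) x
  obtain ⟨g', rfl⟩ := h.exists_map_ν_eq hr hN y
  refine ⟨g', h.eq_of_map_ν_eq hr hN ?_⟩
  rw [ν.map_comp, hd, Category.assoc, hy, ex]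

/-- Each unit of failure of acyclicity of `N` costs one degree. The map lifts to P(N) by
projectivity; its composite with the incoming differential lands in K(N), whose left derived
functors vanish one degree earlier. By induction that composite factors over the differential, and
the corrected lift falls under the acyclic case for P(N). -/
lemma exists_factor (hdd : ∀ i, d i ≫ d (i + 1) = 0) (j : ℕ) {N : A}
    (hN : ∀ n, j ≤ n → h.LVan n N) (g : s.T (j + 1) ⟶ N) (hg : d j ≫ g = 0) :
    ∃ g', d (j + 1) ≫ g' = g := by
  induction j generalizing N with
  | zero => exact s.exists_factor_of_acyclic hr hd 0 (fun n => hN n (Nat.zero_le n)) g hg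
  | succ j ih =>
    have := s.projective (j + 1)
    have hS := h.left.cover_shortExact N
    have : Epi (h.ε.app N) := h.epi N
    let g₁ : s.T (j + 1 + 1) ⟶ P.obj N := Projective.factorThru g (h.ε.app N)
    have hg₁ : g₁ ≫ h.ε.app N = g := Projective.factorThru_comp _ _
    have hl : (d (j + 1) ≫ g₁) ≫ h.ε.app N = 0 := by rw [Category.assoc, hg₁, hg]
    have el : hS.exact.lift _ hl ≫ h.left.ι.app N = _ := hS.exact.lift_f _ hl
    obtain ⟨g₂, hg₂⟩ := ih (N := h.left.K.obj N) (fun n hn => hN (n + 1) (by omega))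
      (hS.exact.lift _ hl) (by
        rw [← cancel_mono (h.left.ι.app N)]
        refine (Category.assoc _ _ _).trans ((congrArg (d j ≫ ·) el).trans ?_)
        simp [reassoc_of% hdd j])
    obtain ⟨g₃, hg₃⟩ := s.exists_factor_of_acyclic hr hd (j + 1) (h.left.acyclic_P N)
      (g₁ - g₂ ≫ h.left.ι.app N) (by
        rw [Preadditive.comp_sub, ← Category.assoc, hg₂, sub_eq_zero]
        exact el.symm)
    refine ⟨g₃ ≫ h.ε.app N, ?_⟩
    have e : h.left.ι.app N ≫ h.ε.app N = 0 := h.left.ι_ε N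
    rw [reassoc_of% hg₃, Preadditive.sub_comp, Category.assoc, e, comp_zero, sub_zero, hg₁]

end

lemma rvan_Z_zero (hr : ∃ m, ∀ n, m ≤ n → ∀ M, h.RVan n M) (i n : ℕ) (hi : h.RVan n (s.Z i)) :
    h.RVan (n + i) (s.Z 0) := by
  induction i generalizing n with
  | zero => exact hi
  | succ i ih =>
    have := ih (n + 1) ((h.rvan_shift (s.shortExact i) (h.coacyclic_map_ν hr (s.acyclic i)) n).2 hi)
    rwa [Nat.add_right_comm, Nat.add_assoc] at this

/-- The last differential T_q → T_{q+1} is epi. As its endpoints are acyclic, `ν'ν` leaves it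
unchanged, so the last map of the coresolution is epi after `ν'`; this is the vanishing of R¹ν' at
Z_q, that is of R^{q+1}ν' at Z₀. -/
lemma rvan {q : ℕ} (s : h.ProjSeq (q + 1)) (hr : ∃ m, ∀ n, m ≤ n → ∀ M, h.RVan n M)
    (hl : ∀ n, q ≤ n → ∀ M, h.LVan n M) : h.RVan q (s.Z 0) := by
  obtain ⟨d, hd, hdd⟩ := s.exists_d hr
  obtain ⟨g, hg⟩ := s.exists_factor hr hd hdd q (fun n hn => hl n hn _) (cokernel.π (d q))
    (cokernel.condition _)
  have h0 : cokernel.π (d q) = 0 := by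
    -- The projection to the cokernel of `d q` factors through T_{q+2}, which is zero.
    rw [← hg, (s.isZero (q + 1 + 1) (by omega)).eq_of_src g 0, comp_zero]
  have hdq : Epi (d q) := Preadditive.epi_of_cokernel_zero h0
  have := h.isIso_unit_app hr (s.acyclic (q + 1))
  have e := h.adj.unit.naturality (d q)
  have h₁ : Epi (ν'.map (ν.map (d q))) := by
    have : Epi (h.adj.unit.app (s.T q) ≫ ν'.map (ν.map (d q))) := by
      dsimp at e
      rw [← e]
      infer_instance
    exact epi_of_epi (h.adj.unit.app (s.T q)) _
  have h₂ : IsIso (s.f (q + 1)) := by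
    have : Epi (s.f (q + 1)) :=
      (s.shortExact (q + 1)).exact.epi_f ((s.isZero_Z (i := q + 1 + 1) (by omega)).eq_of_tgt _ _)
    exact isIso_of_mono_of_epi _
  have h₃ : ν'.map (s.e q) = ν'.map (ν.map (d q)) ≫ inv (ν'.map (s.f (q + 1))) := by
    rw [hd, ν'.map_comp, Category.assoc, IsIso.hom_inv_id, Category.comp_id]
  have := s.rvan_Z_zero hr q 0
    ((h.rvan_zero_iff_epi (s.shortExact q) (h.coacyclic_map_ν hr (s.acyclic q))).2 (by
      rw [h₃]
      infer_instance))
  rwa [zero_add] at this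

end ProjSeq

lemma shortExact_of_isIso {X Y Z : A} (f : X ⟶ Y) (hf : IsIso f) (hZ : IsZero Z) :
    (ShortComplex.mk f (0 : Y ⟶ Z) comp_zero).ShortExact where
  exact := by
    rw [ShortComplex.exact_iff_epi _ rfl]
    exact inferInstanceAs (Epi f)
  mono_f := inferInstanceAs (Mono f)
  epi_g := ⟨fun _ _ _ => hZ.eq_of_src _ _⟩

/-- The sequence of a coacyclic object. -/
def projSeqOfCoacyclic (hl : ∃ m, ∀ n, m ≤ n → ∀ M, h.LVan n M) {B : A} (hB : h.coacyclic B) :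
    h.ProjSeq 0 :=
  have := h.isIso_counit_app hl hB
  { T := fun i => match i with
      | 0 => ν'.obj B
      | _ + 1 => 0
    Z := fun i => match i with
      | 0 => B
      | _ + 1 => 0
    f := fun i => match i with
      | 0 => inv (h.adj.counit.app B)
      | _ + 1 => 0
    e := fun _ => 0
    w := fun _ => comp_zero
    shortExact := fun i => by
      cases i with
      | zero => exact shortExact_of_isIso _ inferInstance (isZero_zero A)
      | succ i => exact shortExact_of_isIso _ ⟨0, (isZero_zero A).eq_of_src _ _,
          (ν.map_isZero (isZero_zero A)).eq_of_src _ _⟩ (isZero_zero A)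
    acyclic_zero := h.acyclic_map_ν' hl hB
    projective := fun _ => inferInstanceAs (Projective (0 : A))
    isZero := fun i hi => match i with
      | _ + 1 => isZero_zero A }

/-- The sequence of an object that embeds into a coacyclic object. -/
def ProjSeq.extend [EnoughProjectives A] {r : ℕ} (s : h.ProjSeq r)
    (hr : ∃ m, ∀ n, m ≤ n → ∀ M, h.RVan n M) (hl : ∃ m, ∀ n, m ≤ n → ∀ M, h.LVan n M)
    {B J : A} {f : B ⟶ J} {g : J ⟶ s.Z 0} {w : f ≫ g = 0}
    (hS : (ShortComplex.mk f g w).ShortExact) (hJ : h.coacyclic J) : h.ProjSeq (r + 1) :=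
  let p := Projective.π (s.T 0)
  have hX := h.acyclic_of_projective (inferInstanceAs (Projective (Projective.over (s.T 0))))
  have hp : (ShortComplex.mk (kernel.ι p) p (kernel.condition p)).ShortExact :=
    { exact := ShortComplex.exact_kernel p
      mono_f := inferInstanceAs (Mono (kernel.ι p))
      epi_g := inferInstanceAs (Epi (Projective.π (s.T 0))) }
  have hY := h.left.acyclic_X₁ hp hX s.acyclic_zero
  have hνp := h.map_ν_shortExact hp (s.acyclic_zero 0)
  -- Let X → T₀ be a projective cover with kernel Y, and W the pullback of νX along Z₀ → νT₀. The
  -- four sequences are 0 → W → νX → Z₁ → 0, 0 → νY → W → Z₀ → 0, 0 → B → V → W → 0 and 0 → νY → V →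
  -- J → 0. The last one makes V coacyclic, so V ≅ νν'V can serve as the new term of degree 0.
  have h₁ := shortExact_pullback_epi (s.shortExact 0) (ν.map p) hνp.epi_g
  have h₂ := shortExact_pullback' hνp (s.f 0)
  have h₃ := shortExact_pullback hS (pullback.fst (s.f 0) (ν.map p))
  have h₄ := shortExact_pullback' h₂ g
  have hV := h.coacyclic_X₂ h₄ (h.coacyclic_map_ν hr hY) hJ
  have := h.isIso_counit_app hl hV
  let V := pullback g (pullback.fst (s.f 0) (ν.map p))
  { T := fun i => match i with
      | 0 => ν'.obj V
      | 1 => Projective.over (s.T 0)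
      | i + 2 => s.T (i + 1)
    Z := fun i => match i with
      | 0 => B
      | 1 => pullback (s.f 0) (ν.map p)
      | i + 2 => s.Z (i + 1)
    f := fun i => match i with
      | 0 => pullback.lift f 0 (by rw [w, zero_comp]) ≫ inv (h.adj.counit.app V)
      | 1 => pullback.snd _ _
      | i + 2 => s.f (i + 1)
    e := fun i => match i with
      | 0 => h.adj.counit.app V ≫ pullback.snd _ _
      | 1 => ν.map p ≫ s.e 0
      | i + 2 => s.e (i + 1)
    w := fun i => match i with
      | 0 => by
        rw [Category.assoc, IsIso.inv_hom_id_assoc]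
        exact pullback.lift_snd _ _ _
      | 1 => by
        rw [← Category.assoc, ← pullback.condition, Category.assoc, s.w, comp_zero]
      | i + 2 => s.w (i + 1)
    shortExact := fun i => match i with
      | 0 => by
        refine ShortComplex.shortExact_of_iso ?_ h₃
        refine ShortComplex.isoMk (S₁ := ShortComplex.mk _ _ _) (S₂ := ShortComplex.mk _ _ _)
          (Iso.refl _) (asIso (h.adj.counit.app V)).symm (Iso.refl _) (Category.id_comp _) ?_
        exact (IsIso.inv_hom_id_assoc _ _).trans (Category.comp_id _).symm
      | 1 => h₁
      | i + 2 => s.shortExact (i + 1)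
    acyclic_zero := h.acyclic_map_ν' hl hV
    projective := fun i => match i with
      | 0 => inferInstanceAs (Projective (Projective.over (s.T 0)))
      | i + 1 => s.projective i
    isZero := fun i hi => match i with
      | 1 => absurd hi (by omega)
      | i + 2 => s.isZero (i + 1) (by omega) }

lemma exists_projSeq [EnoughProjectives A]
    (hr : ∃ m, ∀ n, m ≤ n → ∀ M, h.RVan n M) (hl : ∃ m, ∀ n, m ≤ n → ∀ M, h.LVan n M)
    {r : ℕ} {B : A} (hB : ∀ n, r ≤ n → h.RVan n B) : ∃ s : h.ProjSeq r, s.Z 0 = B := by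
  induction r generalizing B with
  | zero => exact ⟨h.projSeqOfCoacyclic hl fun n => hB n (Nat.zero_le n), rfl⟩
  | succ r ih =>
    have hS : (ShortComplex.mk (h.η.app B) (cokernel.π (h.η.app B))
      (cokernel.condition _)).ShortExact := h.cocover_shortExact B
    have hJ := h.coacyclic_I B
    obtain ⟨s, hs⟩ := ih (B := cokernel (h.η.app B)) fun n hn =>
      (h.rvan_shift hS hJ n).1 (hB _ (by omega))
    generalize cokernel.condition (h.η.app B) = w at hS
    generalize cokernel.π (h.η.app B) = p at w hS
    generalize cokernel (h.η.app B) = B' at p w hS hs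
    subst hs
    exact ⟨s.extend h hr hl hS hJ, rfl⟩

/-- Vanishing of the left derived functors beyond degree `s` entails vanishing of the right derived
functors beyond degree `s`, provided that these vanish in all large degrees. -/
theorem rvan_of_lvan [EnoughProjectives A] (hr : ∃ m, ∀ n, m ≤ n → ∀ M, h.RVan n M) {s : ℕ}
    (hl : ∀ n, s ≤ n → ∀ M, h.LVan n M) : ∀ n, s ≤ n → ∀ M, h.RVan n M := by
  obtain ⟨m, hm⟩ := id hr
  suffices H : ∀ k n, m ≤ n + k → s ≤ n → ∀ M, h.RVan n M from
    fun n hn => H m n (by omega) hn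
  intro k
  induction k with
  | zero => exact fun n hn _ => hm n hn
  | succ k ih =>
    intro n hn hs M
    -- The induction hypothesis gives vanishing from index `n + 1` on, hence a sequence of length `n
    -- + 1`; `ProjSeq.rvan` then gains index `n`.
    obtain ⟨t, rfl⟩ := h.exists_projSeq hr ⟨s, hl⟩ (r := n + 1) (B := M) fun i hi =>
      ih i (by omega) (by omega) M
    exact t.rvan hr fun i hi => hl i (by omega)

end NakayamaData

end Bound

/-! ### Right derived vanishing as vanishing of Ext -/

section Ext

open Abelian

variable {A : Type w} [Category.{v} A] [Abelian A]

lemma projDim_le_iff (M : A) (t : ℕ) : projDim M ≤ t ↔ HasProjectiveDimensionLE M t := by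
  rw [← projectiveDimension_le_iff, projDim, WithBot.unbotD_le_iff]
  · rfl
  · exact fun _ => bot_le

lemma iSup_projDim_le_iff {ι : Type*} (X : ι → A) (t : ℕ) :
    ⨆ i, projDim (X i) ≤ t ↔ ∀ i, HasProjectiveDimensionLE (X i) t := by
  rw [iSup_le_iff]
  exact forall_congr' fun i => projDim_le_iff _ _

/-- The kernel of an epimorphism from a projective object. -/
lemma exists_projective_cover [EnoughProjectives A] (X : A) :
    ∃ (X' Q : A) (f : X' ⟶ Q) (g : Q ⟶ X) (w : f ≫ g = 0), Projective Q ∧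
      (ShortComplex.mk f g w).ShortExact :=
  ⟨_, Projective.over X, kernel.ι (Projective.π X), Projective.π X, kernel.condition _, inferInstance,
    { exact := ShortComplex.exact_kernel _
      mono_f := inferInstanceAs (Mono (kernel.ι _))
      epi_g := inferInstanceAs (Epi (Projective.π X)) }⟩

/-- Syzygies inherit the property `p`, and all morphisms to `W` from first syzygies of objects with
this property extend. -/
def SyzygiesExtend (p : ObjectProperty A) (W : A) : Prop :=
  ∀ {X' Q X : A} (f : X' ⟶ Q) (g : Q ⟶ X) (w : f ≫ g = 0),
    (ShortComplex.mk f g w).ShortExact → Projective Q → p X →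
      p X' ∧ ∀ x : X' ⟶ W, ∃ y : Q ⟶ W, f ≫ y = x

universe t

variable [HasExt.{t} A]

/-- If all morphisms to `W` from first syzygies of objects with property `p` extend, and syzygies
inherit this property, then all `Ext` groups with values in `W` vanish. -/
lemma subsingleton_ext_of_extension [EnoughProjectives A] {p : ObjectProperty A} {W : A}
    (hp : SyzygiesExtend p W) {X : A} (hX : p X) (j : ℕ) : Subsingleton (Ext X W (j + 1)) := by
  refine subsingleton_of_forall_eq 0 fun e => ?_
  obtain ⟨X', Q, f, g, w, hQ, hS⟩ := exists_projective_cover X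
  obtain ⟨hX', hext⟩ := hp f g w hS hQ hX
  obtain ⟨x, rfl⟩ := Ext.contravariant_sequence_exact₃ hS W e (Ext.eq_zero_of_projective _)
    (add_comm 1 j)
  cases j with
  | zero =>
    obtain ⟨x, rfl⟩ := Ext.homEquiv₀.symm.surjective x
    obtain ⟨y, rfl⟩ := hext x
    rw [Ext.homEquiv₀_symm_apply, ← Ext.mk₀_comp_mk₀]
    exact (Ext.comp_assoc _ _ _ _ _ (by rfl)).symm.trans (by
      rw [hS.extClass_comp, Ext.zero_comp])
  | succ j =>
    have := subsingleton_ext_of_extension hp hX' j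
    rw [this.eq_zero x]
    simp

section

variable {X₁ X₂ X₃ : A} {f : X₁ ⟶ X₂} {g : X₂ ⟶ X₃} {w : f ≫ g = 0}
  (hS : (ShortComplex.mk f g w).ShortExact) (D : A)
  (h₂ : ∀ j, Subsingleton (Ext D X₂ (j + 1)))

include hS h₂

lemma subsingleton_ext_succ_iff (n : ℕ) :
    Subsingleton (Ext D X₁ (n + 2)) ↔ Subsingleton (Ext D X₃ (n + 1)) := by
  constructor
  · intro h
    refine subsingleton_of_forall_eq 0 fun e => ?_
    obtain ⟨x, rfl⟩ := Ext.covariant_sequence_exact₃ D hS e rfl (h.elim _ _)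
    rw [(h₂ n).elim x 0]
    simp
  · intro h
    refine subsingleton_of_forall_eq 0 fun e => ?_
    obtain ⟨x, rfl⟩ := Ext.covariant_sequence_exact₁ D hS e ((h₂ (n + 1)).elim _ _) rfl
    rw [h.elim x 0]
    simp

lemma subsingleton_ext_one_iff :
    Subsingleton (Ext D X₁ 1) ↔ ∀ y : D ⟶ X₃, ∃ z, z ≫ g = y := by
  constructor
  · intro h y
    obtain ⟨x, hx⟩ := Ext.covariant_sequence_exact₃ D hS (Ext.mk₀ y) (zero_add 1) (h.elim _ _)
    obtain ⟨z, rfl⟩ := Ext.homEquiv₀.symm.surjective x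
    exact ⟨z, Ext.homEquiv₀.symm.injective (by simpa using hx)⟩
  · intro h
    refine subsingleton_of_forall_eq 0 fun e => ?_
    obtain ⟨x, rfl⟩ := Ext.covariant_sequence_exact₁ D hS e ((h₂ 0).elim _ _) (zero_add 1)
    obtain ⟨y, rfl⟩ := Ext.homEquiv₀.symm.surjective x
    obtain ⟨z, rfl⟩ := h y
    rw [Ext.homEquiv₀_symm_apply, ← Ext.mk₀_comp_mk₀]
    exact (Ext.comp_assoc _ _ _ _ _ (by rfl)).trans (by
      rw [hS.comp_extClass, Ext.comp_zero])

end

namespace NakayamaData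

variable {P ν ν' : A ⥤ A} (h : NakayamaData P ν ν') [P.Additive] [ν.Additive] [ν'.Additive]
  {ι : Type*} (D : ι → A)
  (hD : ∀ {W W' : A} (g : W ⟶ W'), Epi (ν'.map g) ↔ ∀ (i : ι) (y : D i ⟶ W'), ∃ z, z ≫ g = y)

include hD

/-- `hD` says that the functor `ν'` detects epimorphisms as the family Hom(D i, -) does. Since `hI`
makes the objects I(N) acyclic for this family too, both sides shift along M → I(M) in the same way.
-/
lemma rvan_iff_ext (hI : ∀ i N j, Subsingleton (Ext (D i) (ν.obj (P.obj N)) (j + 1))) (n : ℕ)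
    (M : A) : h.RVan n M ↔ ∀ i, Subsingleton (Ext (D i) M (n + 1)) := by
  have hS (M : A) : (ShortComplex.mk (X₁ := M) (h.η.app M) (cokernel.π (h.η.app M))
    (cokernel.condition _)).ShortExact := h.cocover_shortExact M
  induction n generalizing M with
  | zero =>
    rw [h.rvan_zero_iff_epi (hS M) (h.coacyclic_I M), hD]
    exact forall_congr' fun i => (subsingleton_ext_one_iff (hS M) (D i) (hI i M)).symm
  | succ n ih =>
    exact (h.rvan_shift (hS M) (h.coacyclic_I M) n).trans ((ih _).trans
      (forall_congr' fun i => (subsingleton_ext_succ_iff (hS M) (D i) (hI i M) n).symm))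

omit [HasExt.{t} A] in
lemma rvan_iff_hasProjectiveDimensionLE [EnoughProjectives A] {p : ObjectProperty A}
    (hpD : ∀ i, p (D i)) (hpI : ∀ N, SyzygiesExtend p (ν.obj (P.obj N))) (t : ℕ) :
    (∀ n, t ≤ n → ∀ M, h.RVan n M) ↔ ∀ i, HasProjectiveDimensionLE (D i) t := by
  let := HasExt.standard A
  have hI i N j : Subsingleton (Ext (D i) (ν.obj (P.obj N)) (j + 1)) :=
    subsingleton_ext_of_extension (hpI N) (hpD i) j
  simp only [h.rvan_iff_ext D hD hI]
  refine ⟨fun H i => ⟨fun j hj Y => ?_⟩, fun H n hn M i => ?_⟩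
  · obtain ⟨n, rfl⟩ : ∃ n, j = n + 1 := ⟨j - 1, by omega⟩
    exact H n (by omega) Y i
  · exact HasProjectiveDimensionLT.subsingleton (D i) (t + 1) (n + 1) (by omega) M

end NakayamaData

end Ext

/-! ### Modules through their values and actions -/

section Modules

variable {k : Type u} [CommRing k] {C : Type u} [Category.{u} C] [Preadditive C] [Linear k C]

/-- The value of a module at an object. -/
abbrev val (M : CMod k C) (c : C) : ModuleCat.{u} k := M.obj.obj c

/-- The action of a morphism on a module. -/
def act (M : CMod k C) {c d : C} (f : c ⟶ d) : val M c →ₗ[k] val M d := (M.obj.map f).hom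

/-- A component of a morphism of modules. -/
def app {M N : CMod k C} (f : M ⟶ N) (c : C) : val M c →ₗ[k] val N c := (f.hom.app c).hom

@[simp]
lemma act_id (M : CMod k C) (c : C) (m : val M c) : act M (𝟙 c) m = m := by
  simp [act]

@[simp]
lemma act_act (M : CMod k C) {c d e : C} (f : c ⟶ d) (g : d ⟶ e) (m : val M c) :
    act M g (act M f m) = act M (f ≫ g) m := by
  simp [act]

lemma act_add (M : CMod k C) {c d : C} (f g : c ⟶ d) (m : val M c) :
    act M (f + g) m = act M f m + act M g m := by
  have := M.property.1
  simp [act, Functor.map_add]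

lemma act_smul (M : CMod k C) {c d : C} (r : k) (f : c ⟶ d) (m : val M c) :
    act M (r • f) m = r • act M f m := by
  have := M.property.2
  simp [act, Functor.map_smul]

@[simp]
lemma app_act {M N : CMod k C} (φ : M ⟶ N) {c d : C} (f : c ⟶ d) (m : val M c) :
    app φ d (act M f m) = act N f (app φ c m) :=
  congrArg (fun x => x.hom m) (φ.hom.naturality f)

@[simp]
lemma app_comp {M N L : CMod k C} (φ : M ⟶ N) (ψ : N ⟶ L) (c : C) (m : val M c) :
    app (φ ≫ ψ) c m = app ψ c (app φ c m) := rfl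

lemma hom_ext {M N : CMod k C} {φ ψ : M ⟶ N} (h : ∀ c m, app φ c m = app ψ c m) : φ = ψ := by
  ext c : 3
  exact ModuleCat.hom_ext <| LinearMap.ext fun m => h c m

/-- A morphism of modules from its components. -/
def mkHom {M N : CMod k C} (φ : ∀ c, val M c →ₗ[k] val N c)
    (h : ∀ {c d : C} (f : c ⟶ d) (m : val M c), φ d (act M f m) = act N f (φ c m)) : M ⟶ N :=
  ObjectProperty.homMk
    { app := fun c => ModuleCat.ofHom (φ c)
      naturality := fun _ _ f => ModuleCat.hom_ext <| LinearMap.ext fun m => h f m }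

/-- Evaluation of modules at an object. -/
abbrev evalAt (k : Type u) [CommRing k] {C : Type u} [Category.{u} C] [Preadditive C] [Linear k C]
    (c : C) : CMod k C ⥤ ModuleCat.{u} k :=
  (linearFunctors k C).ι ⋙ (evaluation C (ModuleCat.{u} k)).obj c

instance : PreservesFiniteLimits (linearFunctors k C).ι := ⟨fun J _ _ => inferInstance⟩

instance : PreservesFiniteColimits (linearFunctors k C).ι := ⟨fun J _ _ => inferInstance⟩

instance (c : C) : PreservesFiniteLimits (evalAt k c) := comp_preservesFiniteLimits _ _

instance (c : C) : PreservesFiniteColimits (evalAt k c) := comp_preservesFiniteColimits _ _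

lemma isIso_of_bijective {M N : CMod k C} (φ : M ⟶ N) (h : ∀ c, Function.Bijective (app φ c)) :
    IsIso φ := by
  have (c : C) : IsIso (φ.hom.app c) := (ConcreteCategory.isIso_iff_bijective _).2 (h c)
  have : IsIso φ.hom := NatIso.isIso_of_isIso_app _
  have : IsIso ((linearFunctors k C).ι.map φ) := this
  exact isIso_of_reflects_iso φ (linearFunctors k C).ι

lemma mono_iff {M N : CMod k C} (φ : M ⟶ N) :
    Mono φ ↔ ∀ c, Function.Injective (app φ c) := by
  refine ⟨fun h c => ?_, fun h => ⟨fun g g' e => hom_ext fun c x => h c ?_⟩⟩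
  · have : Mono ((evalAt k c).map φ) := inferInstance
    exact (ModuleCat.mono_iff_injective _).1 this
  · exact congrArg (fun t => app t c x) e

lemma epi_iff {M N : CMod k C} (φ : M ⟶ N) :
    Epi φ ↔ ∀ c, Function.Surjective (app φ c) := by
  refine ⟨fun h c => ?_, fun h => ⟨fun g g' e => hom_ext fun c x => ?_⟩⟩
  · have : Epi ((evalAt k c).map φ) := inferInstance
    exact (ModuleCat.epi_iff_surjective _).1 this
  · obtain ⟨y, rfl⟩ := h c x
    exact congrArg (fun t => app t c y) e

lemma shortExact_iff {M N L : CMod k C} {φ : M ⟶ N} {ψ : N ⟶ L} (w : φ ≫ ψ = 0) :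
    (ShortComplex.mk φ ψ w).ShortExact ↔ ∀ c, Function.Injective (app φ c) ∧
      Function.Exact (app φ c) (app ψ c) ∧ Function.Surjective (app ψ c) := by
  constructor
  · intro h c
    have := h.map_of_exact (evalAt k c)
    exact ⟨(ModuleCat.mono_iff_injective _).1 this.mono_f,
      (ShortComplex.ShortExact.moduleCat_exact_iff_function_exact _).1 this.exact,
      (ModuleCat.epi_iff_surjective _).1 this.epi_g⟩
  · intro h
    have := (mono_iff φ).2 fun c => (h c).1
    have := (epi_iff ψ).2 fun c => (h c).2.2
    refine { exact := ?_, mono_f := ‹_›, epi_g := ‹_› }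
    refine ShortComplex.exact_of_f_is_kernel _ (KernelFork.IsLimit.ofι' φ w fun {K} x hx => ?_)
    have hr (c : C) (y : val K c) : ∃ m, app φ c m = app x c y :=
      ((h c).2.1 _).1 (congrArg (fun t => app t c y) hx)
    choose r hr using hr
    refine ⟨mkHom (fun c =>
      { toFun := r c
        map_add' := fun a b => (h c).1 (by simp [hr])
        map_smul' := fun a b => (h c).1 (by simp [hr]) }) fun {c d} f m => (h d).1 ?_, ?_⟩
    · simp [hr]
    · exact hom_ext fun c m => hr c m

end Modules

/-! ### The adjoints of the evaluation functor: induction i_! and coinduction i_* -/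

section Induction

variable {k : Type u} [CommRing k] {C : Type u} [Category.{u} C] [Preadditive C] [Linear k C]

/-- The functors whose coproduct is `i_! B`. -/
abbrev shriekSummand (B : C → ModuleCat.{u} k) (d : C) : C ⥤ ModuleCat.{u} k :=
  (linearCoyoneda k C).obj (op d) ⋙ tensorRight (B d)

/-- The element `f ⊗ b` of `(i_! B)(c)`. -/
def iMk (B : C → ModuleCat.{u} k) (d c : C) :
    (d ⟶ c) →ₗ[k] B d →ₗ[k] val ((iLowerShriek k C).obj B) c :=
  (TensorProduct.mk k (d ⟶ c) (B d)).compr₂ ((Sigma.ι (shriekSummand B) d).app c).hom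

@[simp]
lemma act_iMk (B : C → ModuleCat.{u} k) {d c c' : C} (g : c ⟶ c') (f : d ⟶ c) (b : B d) :
    act ((iLowerShriek k C).obj B) g (iMk B d c f b) = iMk B d c' (f ≫ g) b :=
  congrArg (fun x => x.hom (f ⊗ₜ[k] b)) ((Sigma.ι (shriekSummand B) d).naturality g).symm

lemma iHom_ext {B : C → ModuleCat.{u} k} {c : C} {W : Type u} [AddCommGroup W] [Module k W]
    {l l' : val ((iLowerShriek k C).obj B) c →ₗ[k] W}
    (h : ∀ d f b, l (iMk B d c f b) = l' (iMk B d c f b)) : l = l' := by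
  have hc : IsColimit (((evaluation C (ModuleCat.{u} k)).obj c).mapCocone
    (colimit.cocone (Discrete.functor (shriekSummand B)))) :=
    isColimitOfPreserves _ (colimit.isColimit _)
  have : ModuleCat.ofHom (Y := W) l = ModuleCat.ofHom l' :=
    hc.hom_ext fun ⟨d⟩ => ModuleCat.hom_ext <| TensorProduct.ext' fun f b => h d f b
  exact congrArg ModuleCat.Hom.hom this

/-- The morphism out of `C(d, -) ⊗ B_d` that is determined by a linear map. -/
def shriekSummandDesc {B : C → ModuleCat.{u} k} {N : CMod k C} {d : C} (β : B d →ₗ[k] val N d) :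
    shriekSummand B d ⟶ N.obj where
  app c := ModuleCat.ofHom (X := TensorProduct k (d ⟶ c) (B d)) <| TensorProduct.lift
    { toFun := fun f => act N f ∘ₗ β
      map_add' := fun f g => LinearMap.ext fun _ => act_add N f g _
      map_smul' := fun r f => LinearMap.ext fun _ => act_smul N r f _ }
  naturality _ _ g := ModuleCat.hom_ext <| TensorProduct.ext' fun f _ => (act_act N f g _).symm

/-- The morphism out of `i_! B` that is determined by a family of linear maps. -/
def iDesc {B : C → ModuleCat.{u} k} {N : CMod k C} (β : ∀ d, B d →ₗ[k] val N d) :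
    (iLowerShriek k C).obj B ⟶ N :=
  ObjectProperty.homMk <| Sigma.desc fun d => shriekSummandDesc (β d)

@[simp]
lemma app_iDesc {B : C → ModuleCat.{u} k} {N : CMod k C} (β : ∀ d, B d →ₗ[k] val N d) {d c : C}
    (f : d ⟶ c) (b : B d) : app (iDesc β) c (iMk B d c f b) = act N f (β d b) :=
  congrArg (fun x => (x.app c).hom (f ⊗ₜ[k] b))
    (Sigma.ι_desc (f := shriekSummand B) (fun d => shriekSummandDesc (β d)) d)

lemma shriek_hom_ext {B : C → ModuleCat.{u} k} {N : CMod k C}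
    {φ ψ : (iLowerShriek k C).obj B ⟶ N}
    (h : ∀ d b, app φ d (iMk B d d (𝟙 d) b) = app ψ d (iMk B d d (𝟙 d) b)) : φ = ψ := by
  refine hom_ext fun c m => LinearMap.congr_fun (iHom_ext fun d f b => ?_) m
  have e : iMk B d c f b = act _ f (iMk B d d (𝟙 d) b) := by simp
  rw [e, app_act, app_act, h]

@[simp]
lemma app_shriek_map {B B' : C → ModuleCat.{u} k} (φ : B ⟶ B') {d c : C} (f : d ⟶ c) (b : B d) :
    app ((iLowerShriek k C).map φ) c (iMk B d c f b) = iMk B' d c f ((φ d).hom b) := by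
  have := congrArg (fun x => (x.app c).hom (f ⊗ₜ[k] b)) (Sigma.ι_map
    (f := shriekSummand B) (g := shriekSummand B') (fun c : C =>
        Functor.whiskerLeft _ ((tensoringRight (ModuleCat.{u} k)).map (φ c))) d)
  exact this

/-- The adjunction `i_! ⊣ i^*`. -/
def shriekAdj (k : Type u) [CommRing k] (C : Type u) [Category.{u} C] [Preadditive C] [Linear k C] :
    iLowerShriek k C ⊣ iUpperStar k C :=
  Adjunction.mkOfHomEquiv
    { homEquiv := fun B N =>
        { toFun := fun φ c => ModuleCat.ofHom (app φ c ∘ₗ iMk B c c (𝟙 c))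
          invFun := fun β => iDesc fun c => (β c).hom
          left_inv := fun φ => shriek_hom_ext fun d b =>
            (app_iDesc _ (𝟙 d) b).trans (act_id N d _)
          right_inv := fun β => funext fun c => ModuleCat.hom_ext <| LinearMap.ext fun b =>
            (app_iDesc _ (𝟙 c) b).trans (act_id N c _) }
      homEquiv_naturality_left_symm := fun {B B' N} φ β => shriek_hom_ext fun d b =>
        (app_iDesc (fun c => ((φ ≫ β) c).hom) (𝟙 d) b).trans
          ((congrArg (app _ d) (app_shriek_map φ (𝟙 d) b)).trans
            (app_iDesc (fun c => (β c).hom) (𝟙 d) _)).symm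
      homEquiv_naturality_right := fun _ _ => rfl }

/-- The module `i_* B`, with `(i_* B)(c) = ∏ d, Hom_k(C(c, d), B_d)`. -/
def starObj (B : C → ModuleCat.{u} k) : CMod k C where
  obj :=
    { obj := fun c => ModuleCat.of k (∀ d, (c ⟶ d) →ₗ[k] B d)
      map := fun {c c'} f => ModuleCat.ofHom
        { toFun := fun h d => h d ∘ₗ Linear.leftComp k d f
          map_add' := fun _ _ => rfl
          map_smul' := fun _ _ => rfl }
      map_id := fun c => by
        ext h d g
        simp
      map_comp := fun f f' => by
        ext h d g
        simp }
  property :=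
    ⟨⟨fun {c c' f g} => by
      ext h d x
      simp⟩, ⟨fun {c c'} f r => by
      ext h d x
      simp⟩⟩

/-- An element of `(i_* B)(c)`, as a family of linear maps. -/
abbrev starVal {B : C → ModuleCat.{u} k} {c : C} (h : val (starObj B) c) (d : C) :
    (c ⟶ d) →ₗ[k] B d := h d

@[simp]
lemma act_star {B : C → ModuleCat.{u} k} {c c' : C} (f : c ⟶ c') (h : val (starObj B) c) (d : C)
    (g : c' ⟶ d) : starVal (act (starObj B) f h) d g = starVal h d (f ≫ g) := rfl

lemma star_ext {B : C → ModuleCat.{u} k} {c : C} {h h' : val (starObj B) c}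
    (e : ∀ d g, starVal h d g = starVal h' d g) : h = h' :=
  funext fun d => LinearMap.ext fun g => e d g

/-- The morphism to `i_* B` that is determined by a family of linear maps. -/
def starLift {B : C → ModuleCat.{u} k} {M : CMod k C} (β : ∀ d, val M d →ₗ[k] B d) :
    M ⟶ starObj B :=
  mkHom (fun c =>
    { toFun := fun m d =>
        { toFun := fun g => β d (act M g m)
          map_add' := fun f g => by rw [act_add, map_add]
          map_smul' := fun r f => by rw [act_smul, map_smul]; rfl }
      map_add' := fun m m' => star_ext fun d g =>
        (congrArg (β d) (map_add (act M g) m m')).trans (map_add (β d) _ _)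
      map_smul' := fun r m => star_ext fun d g =>
        (congrArg (β d) (map_smul (act M g) r m)).trans (map_smul (β d) _ _) })
    fun f m => star_ext fun d g => congrArg (β d) (act_act M f g m)

@[simp]
lemma starVal_starLift {B : C → ModuleCat.{u} k} {M : CMod k C} (β : ∀ d, val M d →ₗ[k] B d)
    {c : C} (m : val M c) (d : C) (g : c ⟶ d) :
    starVal (app (starLift β) c m) d g = β d (act M g m) := rfl

/-- The functor `i_*`. -/
def iLowerStar (k : Type u) [CommRing k] (C : Type u) [Category.{u} C] [Preadditive C]
    [Linear k C] : (C → ModuleCat.{u} k) ⥤ CMod k C where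
  obj := starObj
  map φ := mkHom (fun c =>
    { toFun := fun h d => (φ d).hom ∘ₗ starVal h d
      map_add' := fun _ _ => star_ext fun d _ => map_add (φ d).hom _ _
      map_smul' := fun _ _ => star_ext fun d _ => map_smul (φ d).hom _ _ }) fun _ _ => rfl

lemma starVal_map {B B' : C → ModuleCat.{u} k} (φ : B ⟶ B') {c : C} (h : val (starObj B) c) (d : C)
    (g : c ⟶ d) : starVal (app ((iLowerStar k C).map φ) c h) d g = (φ d).hom (starVal h d g) := rfl

/-- The adjunction `i^* ⊣ i_*`. -/
def starAdj (k : Type u) [CommRing k] (C : Type u) [Category.{u} C] [Preadditive C] [Linear k C] :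
    iUpperStar k C ⊣ iLowerStar k C :=
  Adjunction.mkOfHomEquiv
    { homEquiv := fun M B =>
        { toFun := fun β => starLift fun d => (β d).hom
          invFun := fun φ d => ModuleCat.ofHom
            { toFun := fun m => starVal (app φ d m) d (𝟙 d)
              map_add' := fun m m' =>
                congrArg (fun h => starVal h d (𝟙 d)) (map_add (app φ d) m m')
              map_smul' := fun r m =>
                congrArg (fun h => starVal h d (𝟙 d)) (map_smul (app φ d) r m) }
          left_inv := fun β => funext fun d => ModuleCat.hom_ext <| LinearMap.ext fun m =>
            congrArg (β d).hom (act_id M d m)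
          right_inv := fun φ => hom_ext fun c m => star_ext fun d g => by
            refine (congrArg (fun h => starVal h d (𝟙 d)) (app_act φ g m)).trans ?_
            exact (act_star g _ d (𝟙 d)).trans (congrArg (starVal (app φ c m) d)
              (Category.comp_id g)) }
      homEquiv_naturality_left_symm := fun _ _ => rfl
      homEquiv_naturality_right := fun _ _ => rfl }

instance : (iUpperStar k C).Faithful where
  map_injective {M N f g} h := hom_ext fun c m =>
    congrArg (fun x => (x c).hom m) h

end Induction

/-! ### Projective modules and modules with projective values -/

section Projectives

variable {k : Type u} [CommRing k] {C : Type u} [Category.{u} C] [Preadditive C] [Linear k C]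

lemma epi_iDesc {B : C → ModuleCat.{u} k} {N : CMod k C} (β : ∀ d, B d →ₗ[k] val N d)
    (hβ : ∀ d, Function.Surjective (β d)) : Epi (iDesc β) :=
  (epi_iff _).2 fun c n => by
    obtain ⟨b, rfl⟩ := hβ c n
    exact ⟨iMk B c c (𝟙 c) b, (app_iDesc β (𝟙 c) b).trans (act_id N c _)⟩

lemma projective_shriek {B : C → ModuleCat.{u} k} (hB : ∀ c, Projective (B c)) :
    Projective ((iLowerShriek k C).obj B) where
  factors {E N} x e he := by
    have (c : C) : ∃ y : B c ⟶ val E c,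
        y ≫ e.hom.app c = ModuleCat.ofHom (app x c ∘ₗ iMk B c c (𝟙 c)) := by
      have : Epi (e.hom.app c) := (ModuleCat.epi_iff_surjective _).2 ((epi_iff e).1 he c)
      exact ⟨Projective.factorThru _ (e.hom.app c), Projective.factorThru_comp _ _⟩
    choose y hy using this
    refine ⟨iDesc fun c => (y c).hom, shriek_hom_ext fun d b => ?_⟩
    rw [app_comp]
    refine (congrArg (app e d) ((app_iDesc _ (𝟙 d) b).trans (act_id E d _))).trans ?_
    exact congrArg (fun t => t.hom b) (hy d)

instance : EnoughProjectives (CMod k C) where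
  presentation M :=
    ⟨{ p := (iLowerShriek k C).obj fun c => Projective.over (val M c)
       projective := projective_shriek fun _ => inferInstance
       f := iDesc fun c => (Projective.π (val M c)).hom
       epi := epi_iDesc _ fun c =>
        (ModuleCat.epi_iff_surjective (Projective.π (val M c))).1 inferInstance }⟩

variable (k C) in
/-- The modules with projective values. -/
def projectiveValues : ObjectProperty (CMod k C) := fun M => ∀ c, Module.Projective k (val M c)

/-- The components of a morphism to `i_* B`. -/
def starCoord {M : CMod k C} {B : C → ModuleCat.{u} k} (φ : M ⟶ starObj B) (d : C) :
    val M d →ₗ[k] B d where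
  toFun m := starVal (app φ d m) d (𝟙 d)
  map_add' m m' := congrArg (fun h => starVal h d (𝟙 d)) (map_add (app φ d) m m')
  map_smul' r m := congrArg (fun h => starVal h d (𝟙 d)) (map_smul (app φ d) r m)

lemma starVal_app {M : CMod k C} {B : C → ModuleCat.{u} k} (φ : M ⟶ starObj B) {c : C}
    (m : val M c) (d : C) (g : c ⟶ d) :
    starVal (app φ c m) d g = starCoord φ d (act M g m) := by
  refine Eq.trans ?_ (congrArg (fun h => starVal h d (𝟙 d)) (app_act φ g m)).symm
  exact ((act_star g _ d (𝟙 d)).trans (congrArg (starVal (app φ c m) d)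
    (Category.comp_id g))).symm

lemma epi_star_map (hC : ∀ c d : C, Module.Projective k (c ⟶ d)) {B B' : C → ModuleCat.{u} k}
    (φ : B ⟶ B') (hφ : ∀ c, Function.Surjective (φ c).hom) : Epi ((iLowerStar k C).map φ) :=
  (epi_iff _).2 fun c h => by
    choose y hy using fun d => Module.projective_lifting_property (φ d).hom (starVal h d) (hφ d)
    exact ⟨y, funext hy⟩

/-- Evaluation is left adjoint to i_*, which preserves epimorphisms because the Hom modules are
projective; hence evaluation preserves projectives. -/
lemma projectiveValues_of_projective (hC : ∀ c d : C, Module.Projective k (c ⟶ d)) {Q : CMod k C}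
    (hQ : Projective Q) : projectiveValues k C Q := fun d => by
  classical
  refine (IsProjective.iff_projective _).2 ⟨fun {E N} x e he => ?_⟩
  let φ : (fun _ : C => E) ⟶ fun _ => N := fun _ => e
  let e' : (starObj fun _ : C => E) ⟶ starObj fun _ => N := (iLowerStar k C).map φ
  have : Epi e' := epi_star_map hC φ fun _ => (ModuleCat.epi_iff_surjective e).1 he
  -- A lifting problem at the single object `d` becomes one for families by putting zero elsewhere;
  -- constant families `E` and `N` keep the targets independent of the object.
  let β : ∀ c, val Q c →ₗ[k] N := fun c => if h : c = d then h ▸ x.hom else 0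
  have hβ : β d = x.hom := dif_pos rfl
  let y : Q ⟶ starObj fun _ => E :=
    Projective.factorThru (starLift β) e'
  have hy : y ≫ e' = starLift β := Projective.factorThru_comp _ _
  refine ⟨ModuleCat.ofHom (starCoord y d), ModuleCat.hom_ext <| LinearMap.ext fun m => ?_⟩
  have h := congrArg (fun t => starVal (app t d m) d (𝟙 d)) hy
  refine Eq.trans h ((starVal_starLift β m d (𝟙 d)).trans ?_)
  rw [hβ]
  exact congrArg x.hom (act_id Q d m)

/-- The values of `X` are projective, so the sequence splits at each object, though not naturally.
That is enough: a map to i_*B is an arbitrary family of linear maps on the values. -/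
lemma syzygiesExtend_starObj (hC : ∀ c d : C, Module.Projective k (c ⟶ d))
    (B : C → ModuleCat.{u} k) : SyzygiesExtend (projectiveValues k C) (starObj B) := by
  intro X' Q X f g w hS hQ hX
  have (c : C) : ∃ r : val Q c →ₗ[k] val X' c, ∀ m, r (app f c m) = m := by
    have : Projective (val X c) := (IsProjective.iff_projective _).1 (hX c)
    obtain ⟨r, hr⟩ := exists_retraction (X₁ := val X' c) (X₂ := val Q c) (X₃ := val X c)
      (f := f.hom.app c) (g := g.hom.app c) (w := congrArg (fun t => t.hom.app c) w)
      (hS.map_of_exact (evalAt k c))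
    exact ⟨r.hom, fun m => congrArg (fun t => t.hom m) hr⟩
  choose r hr using this
  refine ⟨fun c => ?_, fun x => ⟨starLift fun d => starCoord x d ∘ₗ r d, ?_⟩⟩
  · have := projectiveValues_of_projective hC hQ c
    exact Module.Projective.of_split (app f c) (r c) (LinearMap.ext (hr c))
  · refine hom_ext fun c m => star_ext fun d h => ?_
    refine (starVal_starLift _ (app f c m) d h).trans (Eq.trans ?_ (starVal_app x m d h).symm)
    refine congrArg (starCoord x d) ?_
    rw [← app_act]
    exact hr d _

lemma SyzygiesExtend.of_iso {A : Type*} [Category* A] [Abelian A] {p : ObjectProperty A} {W W' : A}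
    (e : W ≅ W') (h : SyzygiesExtend p W) : SyzygiesExtend p W' :=
  fun f g w hS hQ hX => ⟨(h f g w hS hQ hX).1, fun x => by
    obtain ⟨y, hy⟩ := (h f g w hS hQ hX).2 (x ≫ e.inv)
    exact ⟨y ≫ e.hom, by rw [reassoc_of% hy, e.inv_hom_id, Category.comp_id]⟩⟩

end Projectives

/-! ### The coend in ν by generators and relations, and the adjunction ν ⊣ ν⁻ -/

section Nu

variable {k : Type u} [CommRing k] {C : Type u} [Category.{u} C] [Preadditive C] [Linear k C]

/-- Linear forms, as morphisms of modules. -/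
def formEquiv (k : Type u) [CommRing k] (V : Type u) [AddCommGroup V] [Module k V] :
    (V →ₗ[k] k) ≃ₗ[k] (ModuleCat.of k V ⟶ ModuleCat.of k k) :=
  (ModuleCat.homLinearEquiv (S := k) (M := ModuleCat.of k V) (N := ModuleCat.of k k)).symm

/-- The bifunctor whose coend is `(ν M)(c)`. -/
abbrev nuBifunctor (M : CMod k C) (c : C) : Cᵒᵖ ⥤ C ⥤ ModuleCat.{u} k :=
  ((externalProductBifunctorCurried Cᵒᵖ C (ModuleCat.{u} k)).obj ((dualRight k C).obj c).obj).obj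
    M.obj

/-- The element `φ ⊗ m` of `(ν M)(c)`. -/
def nuMk (M : CMod k C) (c e : C) :
    ((c ⟶ e) →ₗ[k] k) →ₗ[k] val M e →ₗ[k] val ((nu k C).obj M) c :=
  (TensorProduct.mk k (ModuleCat.of k (c ⟶ e) ⟶ ModuleCat.of k k) (val M e)).compr₂
    (coend.ι (nuBifunctor M c) e).hom ∘ₗ (formEquiv k (c ⟶ e)).toLinearMap

lemma nuMk_act (M : CMod k C) {c d e : C} (φ : (c ⟶ e) →ₗ[k] k) (f : d ⟶ e) (m : val M d) :
    nuMk M c e φ (act M f m) = nuMk M c d (φ ∘ₗ Linear.rightComp k c f) m :=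
  (congrArg (fun t => t.hom (ModuleCat.ofHom φ ⊗ₜ[k] m))
    (coend.condition (nuBifunctor M c) f)).symm

lemma act_nuMk (M : CMod k C) {c c' e : C} (g : c ⟶ c') (φ : (c ⟶ e) →ₗ[k] k) (m : val M e) :
    act ((nu k C).obj M) g (nuMk M c e φ m) = nuMk M c' e (φ ∘ₗ Linear.leftComp k e g) m :=
  congrArg (fun t => t.hom (ModuleCat.ofHom φ ⊗ₜ[k] m))
    (coend.ι_map (((externalProductBifunctorCurried Cᵒᵖ C (ModuleCat.{u} k)).map
              ((dualRight k C).map g).hom).app M.obj) e)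

lemma app_nu_map {M N : CMod k C} (f : M ⟶ N) {c e : C} (φ : (c ⟶ e) →ₗ[k] k) (m : val M e) :
    app ((nu k C).map f) c (nuMk M c e φ m) = nuMk N c e φ (app f e m) :=
  congrArg (fun t => t.hom (ModuleCat.ofHom φ ⊗ₜ[k] m)) (ι_nu_map k C f c e)

lemma nuHom_ext {M : CMod k C} {c : C} {W : Type u} [AddCommGroup W] [Module k W]
    {l l' : val ((nu k C).obj M) c →ₗ[k] W}
    (h : ∀ e φ m, l (nuMk M c e φ m) = l' (nuMk M c e φ m)) : l = l' := by
  have : ModuleCat.ofHom (Y := W) l = ModuleCat.ofHom l' :=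
    coend.hom_ext (F := nuBifunctor M c) fun e => ModuleCat.hom_ext <|
      TensorProduct.ext' fun φ m => h e φ.hom m
  exact congrArg ModuleCat.Hom.hom this

/-- The linear map out of `(ν M)(c)` that is determined by a balanced family of bilinear maps. -/
def nuDesc {M : CMod k C} {c : C} {W : Type u} [AddCommGroup W] [Module k W]
    (β : ∀ e, ((c ⟶ e) →ₗ[k] k) →ₗ[k] val M e →ₗ[k] W)
    (hβ : ∀ {d e : C} (φ : (c ⟶ e) →ₗ[k] k) (f : d ⟶ e) (m : val M d),
      β e φ (act M f m) = β d (φ ∘ₗ Linear.rightComp k c f) m) :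
    val ((nu k C).obj M) c →ₗ[k] W :=
  (coend.desc (F := nuBifunctor M c) (X := ModuleCat.of k W)
    (fun e => ModuleCat.ofHom (X := TensorProduct k (ModuleCat.of k (c ⟶ e) ⟶ ModuleCat.of k k)
      (val M e)) (TensorProduct.lift (β e ∘ₗ (formEquiv k (c ⟶ e)).symm.toLinearMap)))
    fun d e f => ModuleCat.hom_ext <| TensorProduct.ext' fun φ m => (hβ φ.hom f m).symm).hom

@[simp]
lemma nuDesc_nuMk {M : CMod k C} {c : C} {W : Type u} [AddCommGroup W] [Module k W]
    (β : ∀ e, ((c ⟶ e) →ₗ[k] k) →ₗ[k] val M e →ₗ[k] W)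
    (hβ : ∀ {d e : C} (φ : (c ⟶ e) →ₗ[k] k) (f : d ⟶ e) (m : val M d),
      β e φ (act M f m) = β d (φ ∘ₗ Linear.rightComp k c f) m) {e : C} (φ : (c ⟶ e) →ₗ[k] k)
    (m : val M e) : nuDesc β hβ (nuMk M c e φ m) = β e φ m :=
  congrArg (fun t => t.hom (ModuleCat.ofHom φ ⊗ₜ[k] m))
    (coend.ι_desc (F := nuBifunctor M c) (X := ModuleCat.of k W)
    (fun e => ModuleCat.ofHom (X := TensorProduct k (ModuleCat.of k (c ⟶ e) ⟶ ModuleCat.of k k)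
      (val M e)) (TensorProduct.lift (β e ∘ₗ (formEquiv k (c ⟶ e)).symm.toLinearMap)))
    (fun d e f => ModuleCat.hom_ext <| TensorProduct.ext' fun φ m => (hβ φ.hom f m).symm) e)

/-- The left module `D(C(-, c))`. -/
abbrev dl (k : Type u) [CommRing k] {C : Type u} [Category.{u} C] [Preadditive C] [Linear k C]
    (c : C) : CMod k C := (dualLeft k C).obj (op c)

/-- The linear forms on `C(a, c)`, as the elements of `D(C(-, c))(a)`. -/
def dlMk (c a : C) : ((a ⟶ c) →ₗ[k] k) ≃ₗ[k] val (dl k c) a :=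
  formEquiv k (a ⟶ c)

lemma dl_hom_ext {c : C} {N : CMod k C} {α β : dl k c ⟶ N}
    (h : ∀ a φ, app α a (dlMk c a φ) = app β a (dlMk c a φ)) : α = β :=
  hom_ext fun a x => by
    obtain ⟨φ, rfl⟩ := (dlMk c a).surjective x
    exact h a φ

lemma app_dualLeft_map {c c' : C} (f : c ⟶ c') {a : C} (φ : (a ⟶ c') →ₗ[k] k) :
    app ((dualLeft k C).map f.op) a (dlMk c' a φ) = dlMk c a (φ ∘ₗ Linear.rightComp k a f) := rfl

/-- An element of `(ν⁻ N)(c)`, as a morphism of modules. -/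
abbrev nuMinusHom {N : CMod k C} {c : C} (x : val ((nuMinus k C).obj N) c) : dl k c ⟶ N := x

/-- The morphism to `ν⁻ N` that is determined by a balanced family of bilinear maps. -/
def nuUnhom {M N : CMod k C} (α : (nu k C).obj M ⟶ N) : M ⟶ (nuMinus k C).obj N :=
  mkHom (fun c =>
    { toFun := fun m => mkHom (fun a => app α a ∘ₗ (nuMk M a c).flip m ∘ₗ (dlMk c a).symm.toLinearMap)
        fun {a b} f x => by
          obtain ⟨φ, rfl⟩ := (dlMk c a).surjective x
          refine Eq.trans ?_ (app_act α f (nuMk M a c φ m))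
          rw [act_nuMk]
          rfl
      map_add' := fun m m' => dl_hom_ext fun a φ =>
        (congrArg (app α a) (map_add (nuMk M a c φ) m m')).trans (map_add (app α a) _ _)
      map_smul' := fun r m => dl_hom_ext fun a φ =>
        (congrArg (app α a) (map_smul (nuMk M a c φ) r m)).trans (map_smul (app α a) _ _) })
    fun {c d} f m => dl_hom_ext fun a φ => congrArg (app α a) (nuMk_act M φ f m)

/-- The pairing of `D(C(a, c))` with `M(c)` that is determined by a morphism to `ν⁻ N`. -/
def nuPairing {M N : CMod k C} (β : M ⟶ (nuMinus k C).obj N) (a c : C) :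
    ((a ⟶ c) →ₗ[k] k) →ₗ[k] val M c →ₗ[k] val N a :=
  LinearMap.mk₂ k (fun φ m => app (nuMinusHom (app β c m)) a (dlMk c a φ))
    (fun φ φ' m => by rw [map_add, map_add])
    (fun r φ m => by rw [map_smul, map_smul])
    (fun φ m m' => congrArg (fun t => app (nuMinusHom t) a (dlMk c a φ)) (map_add (app β c) m m'))
    (fun r φ m => congrArg (fun t => app (nuMinusHom t) a (dlMk c a φ)) (map_smul (app β c) r m))

lemma nuPairing_act {M N : CMod k C} (β : M ⟶ (nuMinus k C).obj N) (a : C) {d e : C}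
    (φ : (a ⟶ e) →ₗ[k] k) (f : d ⟶ e) (m : val M d) :
    nuPairing β a e φ (act M f m) = nuPairing β a d (φ ∘ₗ Linear.rightComp k a f) m :=
  congrArg (fun t => app (nuMinusHom t) a (dlMk _ a φ)) (app_act β f m)

/-- The morphism out of `ν M` that corresponds to a morphism to `ν⁻ N`. -/
def nuHom {M N : CMod k C} (β : M ⟶ (nuMinus k C).obj N) : (nu k C).obj M ⟶ N :=
  mkHom (fun a => nuDesc (nuPairing β a) (nuPairing_act β a)) fun {a b} f x => by
    refine LinearMap.congr_fun (f := nuDesc (nuPairing β b) (nuPairing_act β b) ∘ₗ act _ f)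
      (g := act N f ∘ₗ nuDesc (nuPairing β a) (nuPairing_act β a))
      (nuHom_ext fun e φ m => ?_) x
    rw [LinearMap.comp_apply, LinearMap.comp_apply, act_nuMk, nuDesc_nuMk, nuDesc_nuMk]
    exact app_act (nuMinusHom (app β e m)) f (dlMk e a φ)

lemma app_nuHom {M N : CMod k C} (β : M ⟶ (nuMinus k C).obj N) {c a : C} (m : val M c)
    (φ : (a ⟶ c) →ₗ[k] k) :
    app (nuHom β) a (nuMk M a c φ m) = app (nuMinusHom (app β c m)) a (dlMk c a φ) :=
  nuDesc_nuMk _ (nuPairing_act β a) φ m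

/-- The adjunction `ν ⊣ ν⁻`. -/
def nuAdj (k : Type u) [CommRing k] (C : Type u) [Category.{u} C] [Preadditive C] [Linear k C] :
    nu k C ⊣ nuMinus k C :=
  Adjunction.mkOfHomEquiv
    { homEquiv := fun M N =>
        { toFun := nuUnhom
          invFun := nuHom
          left_inv := fun α => hom_ext fun c x => LinearMap.congr_fun
            (nuHom_ext fun e φ m => app_nuHom (nuUnhom α) m φ) x
          right_inv := fun β => hom_ext fun c m => dl_hom_ext fun a φ => app_nuHom β m φ }
      homEquiv_naturality_left_symm := fun {M M' N} f β => hom_ext fun c x => LinearMap.congr_fun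
        (nuHom_ext fun e φ m => by
          refine (app_nuHom (f ≫ β) m φ).trans (Eq.trans ?_
            (congrArg (app (nuHom β) c) (app_nu_map f φ m)).symm)
          exact (app_nuHom β (app f e m) φ).symm) x
      homEquiv_naturality_right := fun _ _ => rfl }

end Nu

/-! ### Elementary elements of coinduced modules and the comparison maps -/

section Finiteness

variable {k : Type u} [CommRing k] {C : Type u} [Category.{u} C] [Preadditive C] [Linear k C]

lemma exists_dual_basis (V : Type u) [AddCommGroup V] [Module k V] [Module.Finite k V]
    [Module.Projective k V] : ∃ (n : ℕ) (x : Fin n → V) (φ : Fin n → V →ₗ[k] k),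
      ∀ v, ∑ i, φ i v • x i = v := by
  obtain ⟨n, f, g, -, -, h⟩ := Module.Finite.exists_comp_eq_id_of_projective k V
  refine ⟨n, fun i => f (Pi.single i 1), fun i => LinearMap.proj i ∘ₗ g, fun v => ?_⟩
  refine Eq.trans ?_ (LinearMap.congr_fun h v)
  rw [LinearMap.comp_apply, LinearMap.pi_apply_eq_sum_univ f (g v)]
  refine Finset.sum_congr rfl fun i _ => ?_
  refine congrArg (fun t => g v i • f t) (funext fun j => ?_)
  simp [Pi.single_apply, eq_comm]

lemma sum_form_smul {V : Type u} [AddCommGroup V] [Module k V] {n : ℕ} {x : Fin n → V}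
    {φ : Fin n → V →ₗ[k] k} (h : ∀ v, ∑ i, φ i v • x i = v) (ψ : V →ₗ[k] k) :
    ∑ i, ψ (x i) • φ i = ψ := by
  ext v
  conv_rhs => rw [← h v, map_sum]
  simp [mul_comm]

open Classical in
/-- The family of linear maps in `(i_* B)(c)` concentrated at `d` given by `ψ` and `b`. -/
def starDelta {B : C → ModuleCat.{u} k} (c d : C) :
    ((c ⟶ d) →ₗ[k] k) →ₗ[k] B d →ₗ[k] val (starObj B) c :=
  LinearMap.mk₂ k (fun ψ b => (Pi.single d ((LinearMap.toSpanSingleton k (B d) b) ∘ₗ ψ) :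
      ∀ d, (c ⟶ d) →ₗ[k] B d))
    (fun ψ ψ' b => by rw [LinearMap.comp_add]; exact Pi.single_add _ _ _)
    (fun r ψ b => by rw [LinearMap.comp_smul]; exact Pi.single_smul _ _ _)
    (fun ψ b b' => by
      rw [LinearMap.toSpanSingleton_add, LinearMap.add_comp]; exact Pi.single_add _ _ _)
    (fun r ψ b => by
      rw [LinearMap.toSpanSingleton_smul, LinearMap.smul_comp]; exact Pi.single_smul _ _ _)

lemma starVal_starDelta_self {B : C → ModuleCat.{u} k} {c d : C} (ψ : (c ⟶ d) →ₗ[k] k) (b : B d)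
    (g : c ⟶ d) : starVal (starDelta c d ψ b) d g = ψ g • b := by
  classical
  exact LinearMap.congr_fun
    (Pi.single_eq_same (M := fun d => (c ⟶ d) →ₗ[k] B d) d
      (LinearMap.toSpanSingleton k (B d) b ∘ₗ ψ)) g

lemma starVal_starDelta_of_ne {B : C → ModuleCat.{u} k} {c d d' : C} (ψ : (c ⟶ d) →ₗ[k] k) (b : B d)
    (hd : d' ≠ d) (g : c ⟶ d') : starVal (starDelta c d ψ b) d' g = 0 := by
  classical
  exact LinearMap.congr_fun
    (Pi.single_eq_of_ne (M := fun d => (c ⟶ d) →ₗ[k] B d) hd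
      (LinearMap.toSpanSingleton k (B d) b ∘ₗ ψ)) g

lemma act_starDelta {B : C → ModuleCat.{u} k} {c c' d : C} (f : c ⟶ c') (ψ : (c ⟶ d) →ₗ[k] k)
    (b : B d) : act (starObj B) f (starDelta c d ψ b) =
      starDelta c' d (ψ ∘ₗ Linear.leftComp k d f) b := by
  refine star_ext fun d' g => ?_
  rw [act_star]
  by_cases hd : d' = d
  · subst hd
    rw [starVal_starDelta_self, starVal_starDelta_self]
    rfl
  · rw [starVal_starDelta_of_ne _ _ hd, starVal_starDelta_of_ne _ _ hd]

/-- Evaluation of elements of `(i_* B)(c)`. -/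
def starEval {B : C → ModuleCat.{u} k} {c d : C} (g : c ⟶ d) : val (starObj B) c →ₗ[k] B d where
  toFun h := starVal h d g
  map_add' _ _ := rfl
  map_smul' _ _ := rfl

/-- The morphism from `D(C(-, d))` to `i_* B` that is determined by an element of `B_d`. -/
def deltaHom {B : C → ModuleCat.{u} k} (d : C) (b : B d) : dl k d ⟶ starObj B :=
  mkHom (fun a => (starDelta a d).flip b ∘ₗ (dlMk d a).symm.toLinearMap) fun {a a'} f x => by
    obtain ⟨φ, rfl⟩ := (dlMk d a).surjective x
    exact (act_starDelta f φ b).symm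

lemma app_deltaHom {B : C → ModuleCat.{u} k} {d : C} (b : B d) {a : C} (φ : (a ⟶ d) →ₗ[k] k) :
    app (deltaHom d b) a (dlMk d a φ) = starDelta a d φ b := rfl

/-- The elements of `(ν⁻ (i_* B))(d)` that are determined by the elements of `B_d`. -/
def deltaNuMinus (B : C → ModuleCat.{u} k) (d : C) :
    B d →ₗ[k] val ((nuMinus k C).obj (starObj B)) d where
  toFun b := deltaHom d b
  map_add' b b' := dl_hom_ext fun a φ => map_add (starDelta a d φ) b b'
  map_smul' r b := dl_hom_ext fun a φ => map_smul (starDelta a d φ) r b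

/-- The canonical morphism from `i_! B` to `ν⁻ (i_* B)`. -/
def shriekToNuMinus (B : C → ModuleCat.{u} k) :
    (iLowerShriek k C).obj B ⟶ (nuMinus k C).obj (starObj B) :=
  iDesc (deltaNuMinus B)

lemma nuMinusHom_shriekToNuMinus {B : C → ModuleCat.{u} k} {d c : C} (f : d ⟶ c) (b : B d) :
    nuMinusHom (app (shriekToNuMinus B) c (iMk B d c f b)) =
      (dualLeft k C).map f.op ≫ deltaHom d b :=
  app_iDesc (deltaNuMinus B) f b

lemma app_shriekToNuMinus {B : C → ModuleCat.{u} k} {d c a : C} (f : d ⟶ c) (b : B d)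
    (φ : (a ⟶ c) →ₗ[k] k) :
    app (nuMinusHom (app (shriekToNuMinus B) c (iMk B d c f b))) a (dlMk c a φ) =
      starDelta a d (φ ∘ₗ Linear.rightComp k a f) b := by
  rw [nuMinusHom_shriekToNuMinus, app_comp, app_dualLeft_map, app_deltaHom]

/-- The canonical morphism from `ν (i_! B)` to `i_* B`. -/
def nuShriekToStar (B : C → ModuleCat.{u} k) :
    (nu k C).obj ((iLowerShriek k C).obj B) ⟶ starObj B :=
  nuHom (shriekToNuMinus B)

lemma app_nuShriekToStar {B : C → ModuleCat.{u} k} {d c a : C} (f : d ⟶ c) (b : B d)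
    (φ : (a ⟶ c) →ₗ[k] k) :
    app (nuShriekToStar B) a (nuMk _ a c φ (iMk B d c f b)) =
      starDelta a d (φ ∘ₗ Linear.rightComp k a f) b :=
  (app_nuHom (shriekToNuMinus B) (iMk B d c f b) φ).trans (app_shriekToNuMinus f b φ)

lemma nuMk_iMk {B : C → ModuleCat.{u} k} {d c a : C} (f : d ⟶ c) (b : B d)
    (φ : (a ⟶ c) →ₗ[k] k) : nuMk _ a c φ (iMk B d c f b) =
      nuMk _ a d (φ ∘ₗ Linear.rightComp k a f) (iMk B d d (𝟙 d) b) := by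
  rw [← nuMk_act, act_iMk, Category.id_comp]

lemma nuShriek_hom_ext {B : C → ModuleCat.{u} k} {a : C} {W : Type u} [AddCommGroup W] [Module k W]
    {l l' : val ((nu k C).obj ((iLowerShriek k C).obj B)) a →ₗ[k] W}
    (h : ∀ d (φ : (a ⟶ d) →ₗ[k] k) b, l (nuMk _ a d φ (iMk B d d (𝟙 d) b)) =
      l' (nuMk _ a d φ (iMk B d d (𝟙 d) b))) : l = l' := by
  refine nuHom_ext fun e φ m => ?_
  refine LinearMap.congr_fun (f := l ∘ₗ nuMk _ a e φ) (g := l' ∘ₗ nuMk _ a e φ)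
    (iHom_ext fun d f b => ?_) m
  rw [LinearMap.comp_apply, LinearMap.comp_apply, nuMk_iMk, h]

end Finiteness

/-! ### Finiteness makes the comparison maps ν i_! → i_* and i_! → ν⁻ i_* invertible -/

section Finiteness

variable {k : Type u} [CommRing k] {C : Type u} [Category.{u} C] [Preadditive C] [Linear k C]

lemma sum_sum_starDelta {B : C → ModuleCat.{u} k} {a : C} (S : Finset C)
    (hS : ∀ d ∉ S, ∀ g : a ⟶ d, g = 0) {n : C → ℕ} {x : ∀ d, Fin (n d) → (a ⟶ d)}
    {φ : ∀ d, Fin (n d) → (a ⟶ d) →ₗ[k] k} (hx : ∀ d v, ∑ i, φ d i v • x d i = v)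
    (h : val (starObj B) a) :
    ∑ d ∈ S, ∑ i, starDelta a d (φ d i) (starVal h d (x d i)) = h := by
  refine star_ext fun d g => ?_
  change starEval g (∑ d ∈ S, ∑ i, starDelta a d (φ d i) (starVal h d (x d i))) = _
  rw [map_sum]
  by_cases hd : d ∈ S
  · rw [Finset.sum_eq_single d]
    · rw [map_sum]
      refine Eq.trans (Finset.sum_congr rfl fun i _ => starVal_starDelta_self _ _ g) ?_
      conv_rhs => rw [← hx d g, map_sum]
      exact Finset.sum_congr rfl fun i _ => (map_smul (starVal h d) _ _).symm
    · intro d' _ hd'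
      rw [map_sum]
      exact Finset.sum_eq_zero fun i _ => starVal_starDelta_of_ne _ _ hd'.symm g
    · exact fun hd' => absurd hd hd'
  · rw [hS d hd g, map_zero]
    refine Finset.sum_eq_zero fun d' hd' => ?_
    rw [map_sum]
    refine Finset.sum_eq_zero fun i _ => map_zero (starVal _ d)

lemma sum_sum_starVal_starDelta {B : C → ModuleCat.{u} k} {a : C} (S : Finset C)
    (hS : ∀ d ∉ S, ∀ g : a ⟶ d, g = 0) {n : C → ℕ} {x : ∀ d, Fin (n d) → (a ⟶ d)}
    {φ : ∀ d, Fin (n d) → (a ⟶ d) →ₗ[k] k} (hx : ∀ d v, ∑ i, φ d i v • x d i = v)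
    {W : Type*} [AddCommGroup W] [Module k W] (T : ∀ d, ((a ⟶ d) →ₗ[k] k) →ₗ[k] B d →ₗ[k] W)
    (d : C) (ψ : (a ⟶ d) →ₗ[k] k) (b : B d) :
    ∑ e ∈ S, ∑ i, T e (φ e i) (starVal (starDelta a d ψ b) e (x e i)) = T d ψ b := by
  by_cases hd : d ∈ S
  · rw [Finset.sum_eq_single d]
    · conv_rhs => rw [← sum_form_smul (hx d) ψ, map_sum, LinearMap.sum_apply]
      refine Finset.sum_congr rfl fun i _ => ?_
      rw [starVal_starDelta_self, map_smul, map_smul, LinearMap.smul_apply]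
    · intro d' _ hd'
      refine Finset.sum_eq_zero fun i _ => ?_
      rw [starVal_starDelta_of_ne ψ b hd', map_zero]
    · exact fun hd' => absurd hd hd'
  · have : ψ = 0 := LinearMap.ext fun g => by rw [hS d hd g, map_zero, map_zero]
    rw [this, map_zero, map_zero, LinearMap.zero_apply]
    refine Finset.sum_eq_zero fun e _ => Finset.sum_eq_zero fun i _ => ?_
    exact map_zero (T e (φ e i))

lemma app_nuShriekToStar_id {B : C → ModuleCat.{u} k} {d a : C} (b : B d)
    (φ : (a ⟶ d) →ₗ[k] k) :
    app (nuShriekToStar B) a (nuMk _ a d φ (iMk B d d (𝟙 d) b)) = starDelta a d φ b := by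
  rw [app_nuShriekToStar]
  congr 2
  ext g
  simp

/-- Tensoring with an induced module gives ⨁_d D(C(a,d)) ⊗ B_d, and the target is ∏_d Hom_k(C(a,d),
B_d). Dual bases identify the factors, and local boundedness leaves only finitely many of them; both
enter the explicit inverse. -/
lemma bijective_nuShriekToStar (hb : IsLocallyBounded C) (hf : IsHomFinite k C)
    (B : C → ModuleCat.{u} k) (a : C) : Function.Bijective (app (nuShriekToStar B) a) := by
  choose n x φ hx using fun d =>
    have := (hf a d).1
    have := (hf a d).2
    exists_dual_basis (k := k) (a ⟶ d)
  -- Outside `S` the modules C(a,d) vanish, so the inverse is a finite sum.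
  let S := (hb a).1.toFinset
  have hS : ∀ d ∉ S, ∀ g : a ⟶ d, g = 0 := fun d hd g => by
    by_contra hg
    exact hd ((Set.Finite.mem_toFinset _).2 ⟨g, hg⟩)
  let T (d : C) : ((a ⟶ d) →ₗ[k] k) →ₗ[k] B d →ₗ[k] val ((nu k C).obj ((iLowerShriek k C).obj B)) a :=
    (nuMk ((iLowerShriek k C).obj B) a d).compl₂ (iMk B d d (𝟙 d))
  let inv : val (starObj B) a →ₗ[k] val ((nu k C).obj ((iLowerShriek k C).obj B)) a :=
    ∑ d ∈ S, ∑ i, T d (φ d i) ∘ₗ starEval (x d i)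
  have hinv (h) : inv h = ∑ d ∈ S, ∑ i, T d (φ d i) (starVal h d (x d i)) := by
    simp only [inv, LinearMap.sum_apply]
    rfl
  have h₁ : inv ∘ₗ app (nuShriekToStar B) a = LinearMap.id := by
    refine nuShriek_hom_ext fun d ψ b => ?_
    rw [LinearMap.comp_apply, app_nuShriekToStar_id, hinv]
    exact sum_sum_starVal_starDelta S hS hx T d ψ b
  refine ⟨fun y y' e => ?_, fun h => ⟨inv h, ?_⟩⟩
  · exact (LinearMap.congr_fun h₁ y).symm.trans ((congrArg inv e).trans (LinearMap.congr_fun h₁ y'))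
  · rw [hinv, map_sum]
    refine Eq.trans (Finset.sum_congr rfl fun d _ => ?_) (sum_sum_starDelta S hS hx h)
    rw [map_sum]
    exact Finset.sum_congr rfl fun i _ => app_nuShriekToStar_id _ _

lemma starCoord_comp_deltaHom {B : C → ModuleCat.{u} k} {c d : C} (f : d ⟶ c) (b : B d)
    (φ : (d ⟶ c) →ₗ[k] k) :
    starCoord ((dualLeft k C).map f.op ≫ deltaHom d b) d (dlMk c d φ) = φ f • b := by
  refine (starVal_starDelta_self (φ ∘ₗ Linear.rightComp k d f) b (𝟙 d)).trans ?_
  simp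

lemma starCoord_comp_deltaHom_of_ne {B : C → ModuleCat.{u} k} {c d e : C} (f : d ⟶ c) (b : B d)
    (φ : (e ⟶ c) →ₗ[k] k) (h : e ≠ d) :
    starCoord ((dualLeft k C).map f.op ≫ deltaHom d b) e (dlMk c e φ) = 0 :=
  starVal_starDelta_of_ne (φ ∘ₗ Linear.rightComp k e f) b h (𝟙 e)

lemma star_hom_ext {M : CMod k C} {B : C → ModuleCat.{u} k} {ψ ψ' : M ⟶ starObj B}
    (h : ∀ d m, starCoord ψ d m = starCoord ψ' d m) : ψ = ψ' :=
  hom_ext fun c m => star_ext fun d g => by rw [starVal_app, starVal_app, h]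

/-- The components of a morphism from `D(C(-, c))` to `i_* B`, as linear maps in the morphism. -/
def dlCoord (B : C → ModuleCat.{u} k) (c d : C) (φ : (d ⟶ c) →ₗ[k] k) :
    val ((nuMinus k C).obj (starObj B)) c →ₗ[k] B d where
  toFun x := starCoord (nuMinusHom x) d (dlMk c d φ)
  map_add' _ _ := rfl
  map_smul' _ _ := rfl

lemma dlCoord_ext {B : C → ModuleCat.{u} k} {c : C} {x y : val ((nuMinus k C).obj (starObj B)) c}
    (h : ∀ d φ, dlCoord B c d φ x = dlCoord B c d φ y) : x = y :=
  star_hom_ext (ψ := nuMinusHom x) (ψ' := nuMinusHom y) fun d m => by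
    obtain ⟨φ, rfl⟩ := (dlMk c d).surjective m
    exact h d φ

lemma dlCoord_shriekToNuMinus {B : C → ModuleCat.{u} k} {c d : C} (f : d ⟶ c) (b : B d)
    (φ : (d ⟶ c) →ₗ[k] k) :
    dlCoord B c d φ (app (shriekToNuMinus B) c (iMk B d c f b)) = φ f • b :=
  (congrArg (fun t => starCoord t d (dlMk c d φ)) (nuMinusHom_shriekToNuMinus f b)).trans
    (starCoord_comp_deltaHom f b φ)

lemma dlCoord_shriekToNuMinus_of_ne {B : C → ModuleCat.{u} k} {c d e : C} (f : d ⟶ c) (b : B d)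
    (φ : (e ⟶ c) →ₗ[k] k) (h : e ≠ d) :
    dlCoord B c e φ (app (shriekToNuMinus B) c (iMk B d c f b)) = 0 :=
  (congrArg (fun t => starCoord t e (dlMk c e φ)) (nuMinusHom_shriekToNuMinus f b)).trans
    (starCoord_comp_deltaHom_of_ne f b φ h)

lemma dlCoord_sum {B : C → ModuleCat.{u} k} {c d : C} {n : ℕ} {x : Fin n → (d ⟶ c)}
    {φ : Fin n → (d ⟶ c) →ₗ[k] k} (hx : ∀ v, ∑ i, φ i v • x i = v) (ψ : (d ⟶ c) →ₗ[k] k)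
    (y : val ((nuMinus k C).obj (starObj B)) c) :
    ∑ i, ψ (x i) • dlCoord B c d (φ i) y = dlCoord B c d ψ y := by
  have h (χ : (d ⟶ c) →ₗ[k] k) : dlCoord B c d χ y =
    (starCoord (nuMinusHom y) d ∘ₗ (dlMk c d).toLinearMap) χ := rfl
  conv_rhs => rw [h, ← sum_form_smul hx ψ, map_sum]
  exact Finset.sum_congr rfl fun i _ => (map_smul (starCoord (nuMinusHom y) d ∘ₗ (dlMk c d).toLinearMap) _ _).symm

/-- A map from D(C(-,c)) to i_*B is a family in ∏_d Hom_k(D(C(d,c)), B_d), which finiteness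
identifies with ⨁_d C(d,c) ⊗ B_d. Here boundedness is used for the objects mapping to `c`. -/
lemma bijective_shriekToNuMinus (hb : IsLocallyBounded C) (hf : IsHomFinite k C)
    (B : C → ModuleCat.{u} k) (c : C) : Function.Bijective (app (shriekToNuMinus B) c) := by
  choose n x φ hx using fun d =>
    have := (hf d c).1
    have := (hf d c).2
    exists_dual_basis (k := k) (d ⟶ c)
  let S := (hb c).2.toFinset
  have hS : ∀ d ∉ S, ∀ g : d ⟶ c, g = 0 := fun d hd g => by
    by_contra hg
    exact hd ((Set.Finite.mem_toFinset _).2 ⟨g, hg⟩)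
  let inv : val ((nuMinus k C).obj (starObj B)) c →ₗ[k] val ((iLowerShriek k C).obj B) c :=
    ∑ d ∈ S, ∑ i, iMk B d c (x d i) ∘ₗ dlCoord B c d (φ d i)
  have hinv (h) : inv h = ∑ d ∈ S, ∑ i, iMk B d c (x d i) (dlCoord B c d (φ d i) h) := by
    simp only [inv, LinearMap.sum_apply]
    rfl
  have h₁ : inv ∘ₗ app (shriekToNuMinus B) c = LinearMap.id := by
    refine iHom_ext fun d f b => ?_
    rw [LinearMap.comp_apply, hinv, LinearMap.id_apply]
    by_cases hd : d ∈ S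
    · rw [Finset.sum_eq_single d]
      · conv_rhs => rw [← hx d f, map_sum, LinearMap.sum_apply]
        refine Finset.sum_congr rfl fun i _ => ?_
        rw [dlCoord_shriekToNuMinus, map_smul, map_smul, LinearMap.smul_apply]
      · intro d' _ hd'
        refine Finset.sum_eq_zero fun i _ => ?_
        rw [dlCoord_shriekToNuMinus_of_ne f b _ hd', map_zero]
      · exact fun hd' => absurd hd hd'
    · rw [hS d hd f, map_zero, LinearMap.zero_apply]
      exact Finset.sum_eq_zero fun e _ => Finset.sum_eq_zero fun i _ => by
        rw [map_zero, map_zero, map_zero]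
  refine ⟨fun y y' e => ?_, fun h => ⟨inv h, dlCoord_ext fun d ψ => ?_⟩⟩
  · exact (LinearMap.congr_fun h₁ y).symm.trans ((congrArg inv e).trans (LinearMap.congr_fun h₁ y'))
  · rw [hinv, map_sum, map_sum]
    by_cases hd : d ∈ S
    · rw [Finset.sum_eq_single d]
      · rw [map_sum, map_sum, ← dlCoord_sum (hx d) ψ h]
        exact Finset.sum_congr rfl fun i _ => dlCoord_shriekToNuMinus _ _ _
      · intro d' _ hd'
        rw [map_sum, map_sum]
        exact Finset.sum_eq_zero fun i _ => dlCoord_shriekToNuMinus_of_ne _ _ _ hd'.symm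
      · exact fun hd' => absurd hd hd'
    · have : ψ = 0 := LinearMap.ext fun g => by rw [hS d hd g, map_zero, map_zero]
      rw [← dlCoord_sum (hx d) ψ h, this]
      refine Eq.trans (Finset.sum_eq_zero fun e he => ?_)
        (Finset.sum_eq_zero fun i _ => by rw [LinearMap.zero_apply, zero_smul]).symm
      rw [map_sum, map_sum]
      exact Finset.sum_eq_zero fun i _ => dlCoord_shriekToNuMinus_of_ne _ _ _ fun hde => hd (hde ▸ he)

end Finiteness

/-! ### The Nakayama functor relative to P -/

section Nakayama

variable {k : Type u} [CommRing k] {C : Type u} [Category.{u} C] [Preadditive C] [Linear k C]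

lemma app_star_map_starDelta {B B' : C → ModuleCat.{u} k} (φ : B ⟶ B') {c d : C}
    (ψ : (c ⟶ d) →ₗ[k] k) (b : B d) :
    app ((iLowerStar k C).map φ) c (starDelta c d ψ b) = starDelta c d ψ ((φ d).hom b) := by
  refine star_ext fun e g => ?_
  rw [starVal_map]
  by_cases he : e = d
  · subst he
    rw [starVal_starDelta_self, starVal_starDelta_self, map_smul]
  · rw [starVal_starDelta_of_ne _ _ he, starVal_starDelta_of_ne _ _ he, map_zero]

/-- The components of the isomorphism between `ν i_!` and `i_*`. -/
abbrev nuShriekMap (B : C → ModuleCat.{u} k) :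
    (iLowerShriek k C ⋙ nu k C).obj B ⟶ (iLowerStar k C).obj B := nuShriekToStar B

lemma nuShriekMap_naturality {B B' : C → ModuleCat.{u} k} (φ : B ⟶ B') :
    (iLowerShriek k C ⋙ nu k C).map φ ≫ nuShriekMap B' =
      nuShriekMap B ≫ (iLowerStar k C).map φ :=
  hom_ext fun a x => LinearMap.congr_fun
    (f := app ((iLowerShriek k C ⋙ nu k C).map φ ≫ nuShriekMap B') a)
    (g := app (nuShriekMap B ≫ (iLowerStar k C).map φ) a) (nuShriek_hom_ext fun d ψ b => by
      refine Eq.trans (congrArg (app (nuShriekToStar B') a) ((app_nu_map _ _ _).trans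
        (congrArg (nuMk _ a d ψ) (app_shriek_map φ _ _)))) ?_
      refine (app_nuShriekToStar_id _ _).trans ((app_star_map_starDelta φ ψ b).symm.trans ?_)
      exact congrArg (app ((iLowerStar k C).map φ) a) (app_nuShriekToStar_id b ψ).symm) x

variable (hb : IsLocallyBounded C) (hf : IsHomFinite k C)

include hb hf in
lemma isIso_nuShriekMap (B : C → ModuleCat.{u} k) : IsIso (nuShriekMap B) :=
  isIso_of_bijective _ (bijective_nuShriekToStar hb hf B)

/-- The isomorphism between `ν i_!` and `i_*`. -/
def nuShriekIso : iLowerShriek k C ⋙ nu k C ≅ iLowerStar k C :=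
  NatIso.ofComponents
    (fun B =>
      have := isIso_nuShriekMap hb hf B
      asIso (nuShriekMap B))
    nuShriekMap_naturality

/-- The isomorphism between `ν P` and `i_* i^*`. -/
def nuPIso : functorP k C ⋙ nu k C ≅ iUpperStar k C ⋙ iLowerStar k C :=
  Functor.associator _ _ _ ≪≫ Functor.isoWhiskerLeft (iUpperStar k C) (nuShriekIso hb hf)

include hb hf in
-- The unit followed by ν⁻ of the isomorphism ν i_!B ≅ i_*B is the comparison map i_!B → ν⁻ i_*B,
-- and both are invertible.
lemma isIso_nuAdj_unit (B : C → ModuleCat.{u} k) :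
    IsIso ((nuAdj k C).unit.app ((iLowerShriek k C).obj B)) := by
  have : IsIso (nuShriekToStar B) := isIso_nuShriekMap hb hf B
  have := isIso_of_bijective _ (bijective_shriekToNuMinus hb hf B)
  have h : (nuAdj k C).unit.app ((iLowerShriek k C).obj B) ≫ (nuMinus k C).map (nuShriekToStar B) =
      shriekToNuMinus B :=
    hom_ext fun c m => dl_hom_ext fun a φ => app_nuHom (shriekToNuMinus B) m φ
  have : IsIso ((nuAdj k C).unit.app ((iLowerShriek k C).obj B) ≫
      (nuMinus k C).map (nuShriekToStar B)) := h ▸ inferInstance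
  exact IsIso.of_isIso_comp_right _ ((nuMinus k C).map (nuShriekToStar B))

lemma exists_unit_retraction {A B : Type*} [Category* A] [Category* B] {F : A ⥤ B} {G : B ⥤ A}
    (adj : F ⊣ G) {H : A ⥤ A} (φ : H ≅ F ⋙ G) (N : A) :
    ∃ s, (adj.unit ≫ φ.inv).app (H.obj N) ≫ s = 𝟙 (H.obj N) := by
  have h₁ : adj.unit.app (H.obj N) ≫ G.map (F.map (φ.hom.app N)) =
      φ.hom.app N ≫ adj.unit.app (G.obj (F.obj N)) := (adj.unit.naturality (φ.hom.app N)).symm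
  refine ⟨φ.hom.app (H.obj N) ≫ G.map (F.map (φ.hom.app N)) ≫ G.map (adj.counit.app (F.obj N)) ≫
    φ.inv.app N, ?_⟩
  rw [NatTrans.comp_app, Category.assoc, φ.inv_hom_id_app_assoc, reassoc_of% h₁,
    adj.right_triangle_components_assoc, φ.hom_inv_id_app]

/-- The functor `P` has the Nakayama functor `ν ⊣ ν⁻`. -/
def nakayamaData : NakayamaData (functorP k C) (nu k C) (nuMinus k C) where
  adj := nuAdj k C
  adjP := ((starAdj k C).comp (shriekAdj k C)).ofNatIsoRight (nuPIso hb hf).symm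
  isIso_unit _ := isIso_nuAdj_unit hb hf _
  ε := (shriekAdj k C).counit
  epi M := (shriekAdj k C).counit_epi_of_R_faithful M
  split_ε N := ⟨(iLowerShriek k C).map ((shriekAdj k C).unit.app _),
    (shriekAdj k C).left_triangle_components _⟩
  η := (starAdj k C).unit ≫ (nuPIso hb hf).inv
  mono M := @mono_comp _ _ _ _ _ ((starAdj k C).unit.app M) ((starAdj k C).unit_mono_of_L_faithful M)
    ((nuPIso hb hf).inv.app M) (IsIso.mono_of_iso _)
  split_η N := exists_unit_retraction (starAdj k C) (nuPIso hb hf) N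

instance : (functorP k C).Additive where
  map_add {M N f g} := shriek_hom_ext fun d b => by
    refine (app_shriek_map _ (𝟙 d) b).trans ((map_add (iMk _ d d (𝟙 d)) _ _).trans ?_)
    exact (congrArg₂ (· + ·) (app_shriek_map ((iUpperStar k C).map f) (𝟙 d) b)
      (app_shriek_map ((iUpperStar k C).map g) (𝟙 d) b)).symm

end Nakayama

/-! ### Vanishing of the right derived functors and the dimensions of D(C(-,c)) -/

section RightVanishing

variable {k : Type u} [CommRing k] {C : Type u} [Category.{u} C] [Preadditive C] [Linear k C]

lemma epi_nuMinus_map_iff {N N' : CMod k C} (g : N ⟶ N') :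
    Epi ((nuMinus k C).map g) ↔ ∀ (c : C) (y : dl k c ⟶ N'), ∃ z, z ≫ g = y :=
  epi_iff _

lemma projectiveValues_dl (hf : IsHomFinite k C) (c : C) : projectiveValues k C (dl k c) := fun a =>
  have := (hf a c).1
  have := (hf a c).2
  Module.Projective.of_equiv (dlMk c a)

/-- By definition ν⁻ tests against the modules D(C(-,c)). These have projective values, and I(N) is
isomorphic to a coinduced module, so the Ext criterion applies. -/
lemma rvan_iff_dualLeft (hb : IsLocallyBounded C) (hf : IsHomFinite k C) (t : ℕ) :
    (∀ n, t ≤ n → ∀ M, (nakayamaData hb hf).RVan n M) ↔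
      (⨆ c : C, projDim ((dualLeft k C).obj (op c))) ≤ t := by
  rw [iSup_projDim_le_iff]
  exact (nakayamaData hb hf).rvan_iff_hasProjectiveDimensionLE (fun c : C => dl k c)
    epi_nuMinus_map_iff (projectiveValues_dl hf)
    (fun N => SyzygiesExtend.of_iso ((nuPIso hb hf).app N).symm
      (syzygiesExtend_starObj (fun c d => (hf c d).2) _)) t

end RightVanishing

/-! ### Duals of modules with values in injective k-modules -/

section Duality

variable {k : Type u} [CommRing k] {C : Type u} [Category.{u} C] [Preadditive C] [Linear k C]

/-- The right module `Hom_k(M(-), E)` of a left module `M`. -/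
def dualInto (E : Type u) [AddCommGroup E] [Module k E] (M : CMod k C) : CMod k Cᵒᵖ where
  obj :=
    { obj := fun c => ModuleCat.of k (val M c.unop →ₗ[k] E)
      map := fun f => ModuleCat.ofHom ((LinearMap.lcomp k E (act M f.unop)))
      map_id := fun c => by
        ext l : 2
        exact LinearMap.ext fun m => congrArg l (act_id M _ m)
      map_comp := fun f g => by
        ext l : 2
        exact LinearMap.ext fun m => congrArg l (act_act M g.unop f.unop m).symm }
  property :=
    ⟨⟨fun {c c' f g} => by
      ext l : 2
      exact LinearMap.ext fun m => (congrArg l (act_add M f.unop g.unop m)).trans (map_add l _ _)⟩,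
    ⟨fun {c c'} f r => by
      ext l : 2
      exact LinearMap.ext fun m => (congrArg l (act_smul M r f.unop m)).trans (map_smul l _ _)⟩⟩

variable {E : Type u} [AddCommGroup E] [Module k E]

/-- An element of `Hom_k(M(c), E)`, as a linear map. -/
abbrev dualVal {M : CMod k C} {c : C} (l : val (dualInto E M) (op c)) : val M c →ₗ[k] E := l

/-- A linear map, as an element of `Hom_k(M(c), E)`. -/
abbrev dualMk {M : CMod k C} {c : C} (l : val M c →ₗ[k] E) : val (dualInto E M) (op c) := l

/-- The morphism of right modules that is dual to a morphism of left modules. -/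
def dualIntoMap (E : Type u) [AddCommGroup E] [Module k E] {M N : CMod k C} (φ : M ⟶ N) :
    dualInto E N ⟶ dualInto E M :=
  mkHom (fun c => LinearMap.lcomp k E (app φ c.unop)) fun f l =>
    LinearMap.ext fun m => congrArg (dualVal l) (app_act φ f.unop m).symm

lemma dualIntoMap_comp {M N L : CMod k C} {φ : M ⟶ N} {ψ : N ⟶ L} (w : φ ≫ ψ = 0) :
    dualIntoMap E ψ ≫ dualIntoMap E φ = 0 :=
  hom_ext fun c l => LinearMap.ext fun m =>
    (congrArg (fun t => dualVal l (app t c.unop m)) w).trans (map_zero (dualVal l))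

lemma shortExact_dualInto (hE : Injective (ModuleCat.of k E)) {M N L : CMod k C} {φ : M ⟶ N}
    {ψ : N ⟶ L} {w : φ ≫ ψ = 0} (h : (ShortComplex.mk φ ψ w).ShortExact) :
    (ShortComplex.mk (dualIntoMap E ψ) (dualIntoMap E φ) (dualIntoMap_comp w)).ShortExact := by
  refine (shortExact_iff _).2 fun c => ?_
  obtain ⟨h₁, h₂, h₃⟩ := (shortExact_iff w).1 h c.unop
  refine ⟨fun l l' e => ?_, fun l => ⟨fun e => ?_, ?_⟩, fun l => ?_⟩
  · refine LinearMap.ext fun m => ?_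
    obtain ⟨n, rfl⟩ := h₃ m
    exact LinearMap.congr_fun (f := dualVal l ∘ₗ app ψ c.unop) (g := dualVal l' ∘ₗ app ψ c.unop) e n
  · have hl (x) (hx : app ψ c.unop x = 0) : dualVal l x = 0 := by
      obtain ⟨y, rfl⟩ := (h₂ x).1 hx
      exact LinearMap.congr_fun (f := dualVal l ∘ₗ app φ c.unop) (g := 0) e y
    choose s hs using h₃
    have hl' (x y) (hxy : app ψ c.unop x = app ψ c.unop y) : dualVal l x = dualVal l y :=
      sub_eq_zero.1 (by rw [← map_sub]; exact hl _ (by rw [map_sub, hxy, sub_self]))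
    refine ⟨dualMk (M := L)
      { toFun := fun x => dualVal l (s x)
        map_add' := fun x y => by
          rw [← map_add]
          exact hl' _ _ (by rw [map_add, hs, hs, hs])
        map_smul' := fun r x => by
          rw [← map_smul]
          exact hl' _ _ (by rw [map_smul, hs, hs, RingHom.id_apply]) }, LinearMap.ext fun x => hl' _ _ (hs _)⟩
  · rintro ⟨l, rfl⟩
    exact LinearMap.ext fun m => ((congrArg (dualVal l) ((h₂ _).2 ⟨m, rfl⟩))).trans
      (map_zero (dualVal l))
  · have : Mono (φ.hom.app c.unop) := (ModuleCat.mono_iff_injective _).2 h₁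
    exact ⟨(Injective.factorThru (J := ModuleCat.of k E) (ModuleCat.ofHom (dualVal l))
        (φ.hom.app c.unop)).hom,
      congrArg ModuleCat.Hom.hom (Injective.comp_factorThru (J := ModuleCat.of k E)
        (ModuleCat.ofHom (dualVal l)) (φ.hom.app c.unop))⟩

/-- A family of bilinear maps, as a cocone. -/
def shriekValCocone {B : C → ModuleCat.{u} k} {c : C} (β : ∀ d, (d ⟶ c) →ₗ[k] B d →ₗ[k] E) :
    Cocone (Discrete.functor (shriekSummand B) ⋙ (evaluation C (ModuleCat.{u} k)).obj c) where
  pt := ModuleCat.of k E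
  ι := Discrete.natTrans fun d => ModuleCat.ofHom (X := TensorProduct k (d.as ⟶ c) (B d.as))
    (TensorProduct.lift (β d.as))

/-- The linear map out of `(i_! B)(c)` that is determined by a family of bilinear maps. -/
def shriekValDesc {B : C → ModuleCat.{u} k} {c : C} (β : ∀ d, (d ⟶ c) →ₗ[k] B d →ₗ[k] E) :
    val ((iLowerShriek k C).obj B) c →ₗ[k] E :=
  ((isColimitOfPreserves ((evaluation C (ModuleCat.{u} k)).obj c)
    (colimit.isColimit (Discrete.functor (shriekSummand B)))).desc
      (shriekValCocone β)).hom

lemma shriekValDesc_iMk {B : C → ModuleCat.{u} k} {c : C}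
    (β : ∀ d, (d ⟶ c) →ₗ[k] B d →ₗ[k] E) {d : C} (f : d ⟶ c) (b : B d) :
    shriekValDesc β (iMk B d c f b) = β d f b :=
  congrArg (fun t => t.hom (f ⊗ₜ[k] b))
    ((isColimitOfPreserves ((evaluation C (ModuleCat.{u} k)).obj c)
    (colimit.isColimit (Discrete.functor (shriekSummand B)))).fac
      (shriekValCocone β) ⟨d⟩)

end Duality

/-! ### Vanishing of the left derived functors from the dimensions of D(C(c,-)) -/

section LeftVanishing

variable {k : Type u} [CommRing k] {C : Type u} [Category.{u} C] [Preadditive C] [Linear k C]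
  {E : Type u} [AddCommGroup E] [Module k E]

/-- The family of `k`-modules `Hom_k(B_d, E)`. -/
abbrev dualFamily (E : Type u) [AddCommGroup E] [Module k E] (B : C → ModuleCat.{u} k)
    (d : Cᵒᵖ) : ModuleCat.{u} k :=
  ModuleCat.of k (B d.unop →ₗ[k] E)

/-- The canonical morphism from the dual of `i_! B` to the coinduced module of the dual of `B`. -/
def dualShriekHom (E : Type u) [AddCommGroup E] [Module k E] (B : C → ModuleCat.{u} k) :
    dualInto E ((iLowerShriek k C).obj B) ⟶ starObj (dualFamily E B) :=
  starLift fun d => LinearMap.lcomp k E (iMk B d.unop d.unop (𝟙 _))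

lemma starVal_dualShriekHom {B : C → ModuleCat.{u} k} {c d : C}
    (l : val ((iLowerShriek k C).obj B) c →ₗ[k] E) (f : d ⟶ c) (b : B d) :
    dualVal (M := (iLowerShriek k C).obj B) l (iMk B d c f b) =
      (starVal (app (dualShriekHom E B) (op c) (dualMk l)) (op d) f.op : B d →ₗ[k] E) b :=
  (congrArg l ((act_iMk B f (𝟙 d) b).trans (by rw [Category.id_comp]))).symm

/-- Morphisms in a linear category and in its opposite. -/
def opHomEquiv (k : Type u) [CommRing k] {C : Type u} [Category.{u} C] [Preadditive C] [Linear k C]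
    (c d : C) : (d ⟶ c) ≃ₗ[k] (op c ⟶ op d) where
  toFun := Quiver.Hom.op
  invFun := Quiver.Hom.unop
  map_add' _ _ := rfl
  map_smul' _ _ := rfl
  left_inv _ := rfl
  right_inv _ := rfl

/-- Hom_k(-, E) turns the direct sum of the C(d,c) ⊗ B_d into the product of the Hom_k(C(d,c),
Hom_k(B_d, E)). The dual of an induced module is therefore coinduced, without finiteness. -/
lemma isIso_dualShriekHom (B : C → ModuleCat.{u} k) : IsIso (dualShriekHom E B) := by
  refine isIso_of_bijective _ fun c => ⟨fun l l' e => ?_, fun h => ?_⟩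
  · refine iHom_ext fun d f b => (starVal_dualShriekHom (dualVal l) f b).trans
      (Eq.trans ?_ (starVal_dualShriekHom (dualVal l') f b).symm)
    exact congrArg (fun t => (starVal t (op d) f.op : B d →ₗ[k] E) b) e
  · let β (d : C) : (d ⟶ c.unop) →ₗ[k] B d →ₗ[k] E :=
      (starVal h (op d)) ∘ₗ (opHomEquiv k c.unop d).toLinearMap
    refine ⟨dualMk (shriekValDesc β), star_ext fun d f => LinearMap.ext fun b => ?_⟩
    exact (starVal_dualShriekHom (shriekValDesc β) f.unop b).symm.trans (shriekValDesc_iMk β f.unop b)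

variable (k) in
/-- The right module `D(C(c, -))`. -/
abbrev dr (c : C) : CMod k Cᵒᵖ := (dualRight k C).obj c

/-- The linear forms on `C(c, e)`, as the elements of `D(C(c, -))(e)`. -/
def drMk (c e : C) : ((c ⟶ e) →ₗ[k] k) ≃ₗ[k] val (dr k c) (op e) :=
  formEquiv k (c ⟶ e)

/-- The morphism from `D(C(c, -))` to the dual of `M` that corresponds to a linear map out of
`(ν M)(c)`. -/
def drHom {M : CMod k C} {c : C} (y : val ((nu k C).obj M) c →ₗ[k] E) : dr k c ⟶ dualInto E M :=
  mkHom (fun e => (nuMk M c e.unop).compr₂ y ∘ₗ (drMk c e.unop).symm.toLinearMap)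
    fun {e d} f x => by
      obtain ⟨φ, rfl⟩ := (drMk c e.unop).surjective x
      exact LinearMap.ext fun m => congrArg y (nuMk_act M φ f.unop m).symm

/-- The bilinear maps that belong to a morphism from `D(C(c, -))` to the dual of `M`. -/
def drPairing {M : CMod k C} {c : C} (z : dr k c ⟶ dualInto E M) (e : C) :
    ((c ⟶ e) →ₗ[k] k) →ₗ[k] val M e →ₗ[k] E :=
  (app z (op e)) ∘ₗ (drMk c e).toLinearMap

lemma drPairing_act {M : CMod k C} {c : C} (z : dr k c ⟶ dualInto E M) {d e : C}
    (φ : (c ⟶ e) →ₗ[k] k) (f : d ⟶ e) (m : val M d) :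
    drPairing z e φ (act M f m) = drPairing z d (φ ∘ₗ Linear.rightComp k c f) m :=
  congrArg (fun t => dualVal t m) (app_act z f.op (drMk c e φ)).symm

/-- A morphism is a monomorphism after the application of `ν` if the morphisms from the modules
`D(C(c, -))` to duals into injective modules extend. -/
lemma mono_nu_map {K Q : CMod k C} (f : K ⟶ Q)
    (H : ∀ (E : ModuleCat.{u} k), Injective E → ∀ (c : C) (y : dr k c ⟶ dualInto E K),
      ∃ z, z ≫ dualIntoMap E f = y) : Mono ((nu k C).map f) := by
  refine (mono_iff _).2 fun c => ?_
  let i := Injective.ι (val ((nu k C).obj K) c)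
  -- Linear maps (νK)(c) → E correspond to morphisms D(C(c,-)) → Hom_k(K,E). Extending the embedding
  -- into an injective module over (νQ)(c) shows that the map out of (νK)(c) is injective.
  obtain ⟨z, hz⟩ := H (Injective.under (val ((nu k C).obj K) c)) inferInstance c (drHom i.hom)
  have h : nuDesc (drPairing z) (drPairing_act z) ∘ₗ app ((nu k C).map f) c = i.hom := by
    refine nuHom_ext fun e φ m => ?_
    rw [LinearMap.comp_apply, app_nu_map, nuDesc_nuMk]
    exact congrArg (fun t => dualVal (app t (op e) (drMk c e φ)) m) hz
  have hi : Function.Injective i.hom := (ModuleCat.mono_iff_injective i).1 inferInstance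
  rw [← h] at hi
  exact Function.Injective.of_comp (f := nuDesc (drPairing z) (drPairing_act z)) hi

lemma projectiveValues_dr (hf : IsHomFinite k C) (c : C) : projectiveValues k Cᵒᵖ (dr k c) :=
  fun e =>
    have := (hf c e.unop).1
    have := (hf c e.unop).2
    Module.Projective.of_equiv (drMk c e.unop)

lemma projective_op_hom (hf : IsHomFinite k C) (c d : Cᵒᵖ) : Module.Projective k (c ⟶ d) :=
  have := (hf d.unop c.unop).2
  Module.Projective.of_equiv (opHomEquiv k c.unop d.unop)

lemma syzygiesExtend_dualInto (hf : IsHomFinite k C) (N : CMod k C) :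
    SyzygiesExtend (projectiveValues k Cᵒᵖ) (dualInto E ((functorP k C).obj N)) :=
  have := isIso_dualShriekHom (E := E) ((iUpperStar k C).obj N)
  SyzygiesExtend.of_iso (asIso (dualShriekHom E ((iUpperStar k C).obj N))).symm
    (syzygiesExtend_starObj (projective_op_hom hf) _)

variable (hb : IsLocallyBounded C) (hf : IsHomFinite k C)

open Abelian

universe t

/-- Dualising the cover 0 → K → P M → M → 0 into injective `E` gives a coresolution step whose
middle term has no Ext from D(C(c,-)). Both sides shift along it, and in degree one `mono_nu_map`
applies. -/
lemma lvan_of_ext [HasExt.{t} (CMod k Cᵒᵖ)] (n : ℕ) (M : CMod k C)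
    (H : ∀ (E : ModuleCat.{u} k), Injective E → ∀ c : C,
      Subsingleton (Ext (dr k c) (dualInto E M) (n + 1))) : (nakayamaData hb hf).LVan n M := by
  have hI (E : ModuleCat.{u} k) (c : C) (N : CMod k C) (j : ℕ) :
      Subsingleton (Ext (dr k c) (dualInto E ((functorP k C).obj N)) (j + 1)) :=
    subsingleton_ext_of_extension (syzygiesExtend_dualInto hf N) (projectiveValues_dr hf c) j
  have hS (E : ModuleCat.{u} k) (hE : Injective E) (M : CMod k C) :=
    shortExact_dualInto (E := E) hE ((nakayamaData hb hf).left.cover_shortExact M)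
  induction n generalizing M with
  | zero =>
    exact mono_nu_map _ fun E hE c => (subsingleton_ext_one_iff (hS E hE M) (dr k c) (hI E c M)).1
      (H E hE c)
  | succ n ih =>
    exact ih _ fun E hE c => (subsingleton_ext_succ_iff (hS E hE M) (dr k c) (hI E c M) n).1
      (H E hE c)

lemma lvan_of_dualRight {t : ℕ} (ht : (⨆ c : C, projDim ((dualRight k C).obj c)) ≤ t) (n : ℕ)
    (hn : t ≤ n) (M : CMod k C) : (nakayamaData hb hf).LVan n M := by
  let := HasExt.standard (CMod k Cᵒᵖ)
  rw [iSup_projDim_le_iff] at ht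
  refine lvan_of_ext hb hf n M fun E _ c => ?_
  have := ht c
  exact HasProjectiveDimensionLT.subsingleton (dr k c) (t + 1) (n + 1) (by omega) _

end LeftVanishing

/-! ### Passage to the opposite category and comparison of the two suprema -/

section Transfer

lemma hasProjectiveDimensionLE_obj {A : Type*} [Category* A] [Abelian A] [EnoughProjectives A]
    {B : Type*} [Category* B] [Abelian B] (F : A ⥤ B) [F.PreservesZeroMorphisms]
    (hF : ∀ {S : ShortComplex A}, S.ShortExact → (S.map F).ShortExact)
    (hp : ∀ {X : A}, Projective X → Projective (F.obj X)) (t : ℕ) :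
    ∀ X : A, HasProjectiveDimensionLE X t → HasProjectiveDimensionLE (F.obj X) t := by
  induction t with
  | zero =>
    intro X hX
    exact (projective_iff_hasProjectiveDimensionLE_zero _).1
      (hp ((projective_iff_hasProjectiveDimensionLE_zero _).2 hX))
  | succ t ih =>
    intro X hX
    obtain ⟨X', Q, f, g, w, hQ, hS⟩ := exists_projective_cover X
    exact ((hF hS).hasProjectiveDimensionLT_X₃_iff t (hp hQ)).2
      (ih X' ((hS.hasProjectiveDimensionLT_X₃_iff t hQ).1 hX))

variable {k : Type u} [CommRing k] {C : Type u} [Category.{u} C] [Preadditive C] [Linear k C]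

variable (k C) in
/-- Left modules as left modules over the opposite of the opposite category. -/
def toOpOp : CMod k C ⥤ CMod k Cᵒᵖᵒᵖ where
  obj M :=
    { obj := unopUnop C ⋙ M.obj
      property :=
        ⟨⟨fun {_ _ f g} => M.property.1.map_add (f := f.unop.unop) (g := g.unop.unop)⟩,
          ⟨fun f r => M.property.2.map_smul f.unop.unop r⟩⟩ }
  map {M N} φ := mkHom (fun c => app φ c.unop.unop) fun f m => app_act φ f.unop.unop m

variable (k C) in
/-- The quasi-inverse of `toOpOp`. -/
def ofOpOp : CMod k Cᵒᵖᵒᵖ ⥤ CMod k C where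
  obj M :=
    { obj := opOp C ⋙ M.obj
      property :=
        ⟨⟨fun {_ _ f g} => M.property.1.map_add (f := f.op.op) (g := g.op.op)⟩,
          ⟨fun f r => M.property.2.map_smul f.op.op r⟩⟩ }
  map {M N} φ := mkHom (fun c => app φ (op (op c))) fun f m => app_act φ f.op.op m

variable (k C) in
/-- The adjunction between `toOpOp` and `ofOpOp`. -/
def opOpAdj : toOpOp k C ⊣ ofOpOp k C :=
  Adjunction.mkOfHomEquiv
    { homEquiv := fun M N =>
        { toFun := fun φ => mkHom (fun c => app φ (op (op c))) fun f m => app_act φ f.op.op m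
          invFun := fun φ => mkHom (fun c => app φ c.unop.unop) fun f m => app_act φ f.unop.unop m
          left_inv := fun _ => rfl
          right_inv := fun _ => rfl }
      homEquiv_naturality_left_symm := fun _ _ => rfl
      homEquiv_naturality_right := fun _ _ => rfl }

instance : (toOpOp k C).PreservesZeroMorphisms where
  map_zero _ _ := rfl

/-- `toOpOp` is exact and left adjoint to an epimorphism-preserving functor, so it preserves
projectives and hence bounds on projective dimension. -/
lemma hasProjectiveDimensionLE_toOpOp {t : ℕ} {X : CMod k C} (h : HasProjectiveDimensionLE X t) :
    HasProjectiveDimensionLE ((toOpOp k C).obj X) t := by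
  have : (ofOpOp k C).PreservesEpimorphisms :=
    ⟨fun f hf => (epi_iff _).2 fun c => (epi_iff f).1 hf (op (op c))⟩
  refine hasProjectiveDimensionLE_obj (toOpOp k C) (fun {S} hS => ?_)
    (fun {X} hX => (opOpAdj k C).map_projective X hX) t X h
  exact (shortExact_iff ((S.map (toOpOp k C)).zero)).2 fun c =>
    (shortExact_iff S.zero).1 hS c.unop.unop

/-- The modules `D(C(c, -))` as modules of the other type over the opposite category. -/
def dualRightIso (c : C) : dr k c ≅ dl k (op c) :=
  let φ : dr k c ⟶ dl k (op c) :=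
    mkHom (fun e => (dlMk (op c) e).toLinearMap ∘ₗ
        ((opHomEquiv k e.unop c).symm.dualMap.toLinearMap ∘ₗ (drMk c e.unop).symm.toLinearMap))
      fun _ _ => rfl
  have : IsIso φ := isIso_of_bijective _ fun e => (((drMk c e.unop).symm.trans
    (opHomEquiv k e.unop c).symm.dualMap).trans (dlMk (op c) e)).bijective
  asIso φ

/-- The modules `D(C(-, c))` as modules of the other type over the opposite category. -/
def dualLeftIso (c : C) : (toOpOp k C).obj (dl k c) ≅ dr k (op c) :=
  let φ : (toOpOp k C).obj (dl k c) ⟶ dr k (op c) :=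
    mkHom (fun e => (drMk (op c) e.unop).toLinearMap ∘ₗ
        ((opHomEquiv k c e.unop.unop).symm.dualMap.toLinearMap ∘ₗ
          (dlMk c e.unop.unop).symm.toLinearMap))
      fun _ _ => rfl
  have : IsIso φ := isIso_of_bijective _ fun e => (((dlMk c e.unop.unop).symm.trans
    (opHomEquiv k c e.unop.unop).symm.dualMap).trans (drMk (op c) e.unop)).bijective
  asIso φ

lemma iSup_projDim_dualLeft_op_le (t : ℕ) :
    ⨆ c : Cᵒᵖ, projDim ((dualLeft k Cᵒᵖ).obj (op c)) ≤ t ↔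
      ⨆ c : C, projDim ((dualRight k C).obj c) ≤ t := by
  rw [iSup_projDim_le_iff, iSup_projDim_le_iff]
  refine ⟨fun h c => ?_, fun h c => ?_⟩
  · have := h (op c)
    exact hasProjectiveDimensionLT_of_iso (dualRightIso c).symm _
  · have := h c.unop
    exact hasProjectiveDimensionLT_of_iso (dualRightIso c.unop) _

/-- Right modules over the opposite category live over `Cᵒᵖᵒᵖ`, so here a transport along `toOpOp`
is needed; `iSup_projDim_dualLeft_op_le` compares objects of one category. -/
lemma iSup_projDim_dualRight_op_le {t : ℕ}
    (h : ⨆ c : C, projDim ((dualLeft k C).obj (op c)) ≤ t) :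
    ⨆ c : Cᵒᵖ, projDim ((dualRight k Cᵒᵖ).obj c) ≤ t := by
  rw [iSup_projDim_le_iff] at h ⊢
  intro c
  have := hasProjectiveDimensionLE_toOpOp (h c.unop)
  exact hasProjectiveDimensionLT_of_iso (dualLeftIso c.unop) _

lemma IsLocallyBounded.op (hb : IsLocallyBounded C) : IsLocallyBounded Cᵒᵖ := fun c => by
  refine ⟨((hb c.unop).2.image Opposite.op).subset ?_, ((hb c.unop).1.image Opposite.op).subset ?_⟩
  · rintro d ⟨f, hf⟩
    exact ⟨d.unop, ⟨f.unop, fun h => hf (Quiver.Hom.unop_inj h)⟩, rfl⟩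
  · rintro d ⟨f, hf⟩
    exact ⟨d.unop, ⟨f.unop, fun h => hf (Quiver.Hom.unop_inj h)⟩, rfl⟩

lemma IsHomFinite.op (hf : IsHomFinite k C) : IsHomFinite k Cᵒᵖ := fun c d =>
  have := (hf d.unop c.unop).1
  ⟨Module.Finite.equiv (opHomEquiv k c.unop d.unop), projective_op_hom hf c d⟩

/-- Finiteness of the left supremum enters as the vanishing of R^i ν⁻ for large i, without which
`rvan_of_lvan` does not apply. It provides no sharp bound; that comes from the vanishing of the L_i
ν. -/
lemma dualLeft_le_of_lvan (hb : IsLocallyBounded C) (hf : IsHomFinite k C)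
    (ha : (⨆ c : C, projDim ((dualLeft k C).obj (op c))) < ⊤) {s : ℕ}
    (hs : ∀ n, s ≤ n → ∀ M, (nakayamaData hb hf).LVan n M) :
    ⨆ c : C, projDim ((dualLeft k C).obj (op c)) ≤ s := by
  obtain ⟨m, hm⟩ := ENat.ne_top_iff_exists.1 ha.ne
  exact (rvan_iff_dualLeft hb hf s).1
    ((nakayamaData hb hf).rvan_of_lvan ⟨m, (rvan_iff_dualLeft hb hf m).2 hm.ge⟩ hs)

lemma dualLeft_le_of_dualRight_le (hb : IsLocallyBounded C) (hf : IsHomFinite k C)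
    (ha : (⨆ c : C, projDim ((dualLeft k C).obj (op c))) < ⊤) {s : ℕ}
    (hs : ⨆ c : C, projDim ((dualRight k C).obj c) ≤ s) :
    ⨆ c : C, projDim ((dualLeft k C).obj (op c)) ≤ s :=
  dualLeft_le_of_lvan hb hf ha (lvan_of_dualRight hb hf hs)

lemma dualRight_le_of_dualLeft_le (hb : IsLocallyBounded C) (hf : IsHomFinite k C)
    (hr : (⨆ c : C, projDim ((dualRight k C).obj c)) < ⊤) {s : ℕ}
    (hs : ⨆ c : C, projDim ((dualLeft k C).obj (op c)) ≤ s) :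
    ⨆ c : C, projDim ((dualRight k C).obj c) ≤ s := by
  obtain ⟨m, hm⟩ := ENat.ne_top_iff_exists.1 hr.ne
  exact (iSup_projDim_dualLeft_op_le s).1 (dualLeft_le_of_dualRight_le hb.op hf.op
    (((iSup_projDim_dualLeft_op_le m).2 hm.ge).trans_lt (ENat.natCast_lt_top m))
    (iSup_projDim_dualRight_op_le hs))

end Transfer

end NakayamaGorenstein

end

theorem mainTheorem3 (k : Type u) [CommRing k] (C : Type u) [Category.{u} C] [Preadditive C]
    [Linear k C] (hbounded : NakayamaGorenstein.IsLocallyBounded C)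
    (hfinite : NakayamaGorenstein.IsHomFinite k C)
    (hleft : (⨆ c : C, NakayamaGorenstein.projDim
      ((NakayamaGorenstein.dualLeft k C).obj (op c))) < ⊤)
    (hright : (⨆ c : C, NakayamaGorenstein.projDim
      ((NakayamaGorenstein.dualRight k C).obj c)) < ⊤) :
    (⨆ c : C, NakayamaGorenstein.projDim ((NakayamaGorenstein.dualLeft k C).obj (op c))) =
      (⨆ c : C, NakayamaGorenstein.projDim ((NakayamaGorenstein.dualRight k C).obj c)) ∧
    ∃ n : ℕ,
      (⨆ c : C, NakayamaGorenstein.projDim ((NakayamaGorenstein.dualLeft k C).obj (op c))) = n ∧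
      NakayamaGorenstein.HasGorensteinDimension (NakayamaGorenstein.functorP k C)
        (NakayamaGorenstein.nu k C) (NakayamaGorenstein.nuMinus k C) n := by
  obtain ⟨n, hn⟩ := ENat.ne_top_iff_exists.1 hleft.ne
  obtain ⟨m, hm⟩ := ENat.ne_top_iff_exists.1 hright.ne
  have hr := NakayamaGorenstein.dualRight_le_of_dualLeft_le hbounded hfinite hright hn.ge
  have hl := NakayamaGorenstein.dualLeft_le_of_dualRight_le hbounded hfinite hleft hm.ge
  refine ⟨le_antisymm (hl.trans hm.le) (hr.trans hn.le), n, hn.symm, ?_⟩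
  refine (NakayamaGorenstein.nakayamaData hbounded hfinite).hasGorensteinDimension
    ⟨NakayamaGorenstein.lvan_of_dualRight hbounded hfinite hr, fun s hs => ?_⟩
    ⟨(NakayamaGorenstein.rvan_iff_dualLeft hbounded hfinite n).2 hn.ge, fun s hs => ?_⟩
  -- Minimality for the left derived functors goes through the right ones: a bound `s` for the L_i ν
  -- also bounds the projective dimensions of the D(C(-,c)), whose supremum is `n`.
  · have := NakayamaGorenstein.dualLeft_le_of_lvan hbounded hfinite hleft hs
    rwa [← hn, Nat.cast_le] at this
  · have := (NakayamaGorenstein.rvan_iff_dualLeft hbounded hfinite s).1 hs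
    rwa [← hn, Nat.cast_le] at this
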